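/- **Theorem (Frobenius isomorphism).** Let $\Bbbk$ be a field and $H$ a finite dimensional coquasi Hopf algebra over $\Bbbk$: a coalgebra $(H,\Delta,\varepsilon)$ with coalgebra morphisms $p:H\otimes H\to H$, $p(x\otimes y)=xy$, and $u:\Bbbk\to H$, $u(1)=1$, such that $1x=x=x1$; a convolution-invertible $\phi:H\otimes H\otimes H\to\Bbbk$ with $$\sum (c_1d_1)e_1\,\phi(c_2\otimes d_2\otimes e_2)=\sum\phi(c_1\otimes d_1\otimes e_1)\,c_2(d_2e_2),\qquad \phi(c\otimes 1\otimes d)=\varepsilon(c)\varepsilon(d),$$ $$\sum\phi(c_1d_1\otimes e_1\otimes f_1)\phi(c_2\otimes d_2\otimes e_2f_2)=\sum\phi(c_1\otimes d_1\otimes e_1)\phi(c_2\otimes d_2e_2\otimes f_1)\phi(d_3\otimes e_3\otimes f_2);$$ and an antipode $(S,\alpha,\beta)$, that is, a coalgebra morphism $S:H^{\mathrm{cop}}\to H$ and functionals $\alpha,\beta$ on $H$ with $\sum S(h_1)\alpha(h_2)h_3=\alpha(h)1$, $\sum h_1\beta(h_2)S(h_3)=\beta(h)1$, $\sum\phi^{-1}(h_1\otimes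 S(h_3)\otimes h_5)\beta(h_2)\alpha(h_4)=\varepsilon(h)=\sum\phi(S(h_1)\otimes h_3\otimes S(h_5))\alpha(h_2)\beta(h_4)$. The category ${}^H\mathcal M^H$ of $H$-bicomodules is monoidal for $\otimes=\otimes_\Bbbk$, with coactions $m\otimes n\mapsto\sum m_{-1}n_{-1}\otimes(m_0\otimes n_0)\otimes m_1n_1$ and associativity constraint $$\Phi((l\otimes m)\otimes n)=\sum\phi(l_{-1}\otimes m_{-1}\otimes n_{-1})\;l_0\otimes(m_0\otimes n_0)\;\phi^{-1}(l_1\otimes m_1\otimes n_1);$$ $H$, with its regular coactions, is an algebra in it, and ${}^H\mathcal M^H_H$ (Hopf modules) is the category of its right modules. The free Hopf module on a bicomodule $M$ is $M\otimes H$ with action $(M\otimes H)\otimes H\xrightarrow{\Phi}M\otimes(H\otimes H)\xrightarrow{\mathrm{id}\otimes p}M\otimes H$. For $W\in\mathcal M^H$ let ${}_0W$ be $W$ with the additional left coaction $w\mapsto 1\otimes w$. The antipode $S$ is bijective; let $\overline S$ be its inverse. Let ${}^*H$ be the left dual of $H$ in ${}^H\mathcal M^H$: the linear dual of $H$ with the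 coactions determined by $\sum f_0(y)\,f_{-1}\otimes f_1=\sum f(y_2)\,\overline S(y_1)\otimes S(y_3)$. With $\mathrm{ev}:{}^*H\otimes H\to\Bbbk$, $f\otimes y\mapsto\sum\beta(\overline S(y_1))f(y_2)\alpha(y_3)$ and $\mathrm{coev}:\Bbbk\to H\otimes{}^*H$, $1\mapsto\sum_i\sum\alpha(\overline S((e_i)_1))\,(e_i)_2\,\beta((e_i)_3)\otimes e^i$, where $(e_i)$ is a basis of $H$ and $(e^i)$ its dual basis, the right action $f\otimes x\mapsto f\cdot x$ of $H$ on ${}^*H$ is the composition $${}^*H\otimes H\xrightarrow{\mathrm{id}\otimes\mathrm{coev}}({}^*H\otimes H)\otimes(H\otimes{}^*H)\cong({}^*H\otimes(H\otimes H))\otimes{}^*H\xrightarrow{(\mathrm{id}\otimes p)\otimes\mathrm{id}}({}^*H\otimes H)\otimes{}^*H\xrightarrow{\mathrm{ev}\otimes\mathrm{id}}{}^*H,$$ where $\cong$ is $(\Phi_{{}^*H,H,H}\otimes\mathrm{id})\circ\Phi^{-1}_{{}^*H\otimes H,\,H,\,{}^*H}$. With these structures ${}^*H$ is an object of ${}^H\mathcal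 M^H_H$. Then there is a one-dimensional object $W\in\mathcal M^H$ with ${}_0W\otimes H\cong{}^*H$ in ${}^H\mathcal M^H_H$, and it is unique up to isomorphism in $\mathcal M^H$. Moreover, one can take for $W$ the space of left cointegrals $$W=\Big\{\varphi\in{}^*H:\ \sum x_1\varphi(x_2)=\varphi(x)1\ \text{ for all }x\in H\Big\},$$ which is one-dimensional and a right subcomodule of ${}^*H$, and the isomorphism ${}_0W\otimes H\to{}^*H$ of Hopf modules is the map $\mathcal F(\varphi\otimes x)=\varphi\cdot x$. -/

import Mathlib

open scoped TensorProduct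

universe u v w w'

noncomputable section

/-! ### Convolution with functionals -/

section Convolution

variable {k C V : Type*} [CommSemiring k] [AddCommMonoid C] [Module k C] [Coalgebra k C]
  [AddCommMonoid V] [Module k V]

/-- `c ↦ ∑ g(c₁) f(c₂)`. For `V = k` this is the convolution product `g ⋆ f` of functionals. -/
def convLeft (g : C →ₗ[k] k) (f : C →ₗ[k] V) : C →ₗ[k] V :=
  (TensorProduct.lid k V).toLinearMap ∘ₗ TensorProduct.map g f ∘ₗ Coalgebra.comul

/-- `c ↦ ∑ f(c₁) g(c₂)`. For `V = k` this is the convolution product `f ⋆ g` of functionals. -/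
def convRight (f : C →ₗ[k] V) (g : C →ₗ[k] k) : C →ₗ[k] V :=
  (TensorProduct.rid k V).toLinearMap ∘ₗ TensorProduct.map f g ∘ₗ Coalgebra.comul

variable {D : Type*} [AddCommMonoid D] [Module k D]

/-- `ε ⊗ g` -/
def counitTensor (g : D →ₗ[k] k) : C ⊗[k] D →ₗ[k] k :=
  (TensorProduct.lid k k).toLinearMap ∘ₗ TensorProduct.map Coalgebra.counit g

/-- `g ⊗ ε` -/
def tensorCounit (g : D →ₗ[k] k) : D ⊗[k] C →ₗ[k] k :=
  (TensorProduct.lid k k).toLinearMap ∘ₗ TensorProduct.map g Coalgebra.counit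

end Convolution

/-! ### Coquasi bialgebras and coquasi Hopf algebras -/

/-- A coquasi bialgebra structure on the coalgebra `H`: a product and a unit that are coalgebra
morphisms, and a convolution-invertible associator `φ : H ⊗ H ⊗ H → k`. -/
structure CoquasiBialgebra (k H : Type*) [Field k] [AddCommGroup H] [Module k H]
    [Coalgebra k H] where
  /-- the product `p` -/
  mul : H ⊗[k] H →ₗc[k] H
  /-- the unit `u` -/
  unit : k →ₗc[k] H
  /-- the associator `φ` -/
  phi : (H ⊗[k] H) ⊗[k] H →ₗ[k] k
  /-- the convolution inverse `φ⁻¹` -/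
  phiInv : (H ⊗[k] H) ⊗[k] H →ₗ[k] k
  phi_conv_phiInv : convLeft phi phiInv = Coalgebra.counit
  phiInv_conv_phi : convLeft phiInv phi = Coalgebra.counit
  one_mul : ∀ h : H, mul (unit 1 ⊗ₜ[k] h) = h
  mul_one : ∀ h : H, mul (h ⊗ₜ[k] unit 1) = h
  /-- `∑ (c₁d₁)e₁ φ(c₂ ⊗ d₂ ⊗ e₂) = ∑ φ(c₁ ⊗ d₁ ⊗ e₁) c₂(d₂e₂)` -/
  mul_assoc_phi :
    convRight (mul.toLinearMap ∘ₗ mul.toLinearMap.rTensor H) phi =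
      convLeft phi (mul.toLinearMap ∘ₗ mul.toLinearMap.lTensor H ∘ₗ
        (TensorProduct.assoc k H H H).toLinearMap)
  /-- `φ(p ⊗ id ⊗ id) ⋆ φ(id ⊗ id ⊗ p) = (φ ⊗ ε) ⋆ φ(id ⊗ p ⊗ id) ⋆ (ε ⊗ φ)` -/
  pentagon :
    convLeft (phi ∘ₗ (mul.toLinearMap.rTensor H).rTensor H)
        (phi ∘ₗ mul.toLinearMap.lTensor (H ⊗[k] H) ∘ₗ
          (TensorProduct.assoc k (H ⊗[k] H) H H).toLinearMap) =
      convLeft (tensorCounit phi)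
        (convLeft
          (phi ∘ₗ (mul.toLinearMap.lTensor H ∘ₗ
            (TensorProduct.assoc k H H H).toLinearMap).rTensor H)
          (counitTensor phi ∘ₗ (TensorProduct.assoc k H (H ⊗[k] H) H).toLinearMap ∘ₗ
            TensorProduct.map (TensorProduct.assoc k H H H).toLinearMap LinearMap.id))
  /-- `φ(c ⊗ 1 ⊗ d) = ε(c) ε(d)` -/
  phi_one : ∀ c d : H, phi ((c ⊗ₜ[k] unit 1) ⊗ₜ[k] d) =
    Coalgebra.counit (R := k) c * Coalgebra.counit (R := k) d

/-- A coquasi Hopf algebra: a coquasi bialgebra with an antipode `(S, α, β)`. -/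
structure CoquasiHopfAlgebra (k H : Type*) [Field k] [AddCommGroup H] [Module k H]
    [Coalgebra k H] extends CoquasiBialgebra k H where
  /-- the antipode `S`, a coalgebra morphism from the co-opposite coalgebra of `H` to `H` -/
  S : H →ₗ[k] H
  alpha : H →ₗ[k] k
  beta : H →ₗ[k] k
  counit_S : Coalgebra.counit ∘ₗ S = (Coalgebra.counit : H →ₗ[k] k)
  comul_S : Coalgebra.comul ∘ₗ S =
    TensorProduct.map S S ∘ₗ (TensorProduct.comm k H H).toLinearMap ∘ₗ Coalgebra.comul
  /-- `∑ S(h₁) α(h₂) h₃ = α(h) 1` -/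
  S_alpha : ∀ h : H,
    mul (TensorProduct.map (convRight S alpha) LinearMap.id (Coalgebra.comul (R := k) h)) =
      alpha h • unit 1
  /-- `∑ h₁ β(h₂) S(h₃) = β(h) 1` -/
  beta_S : ∀ h : H,
    mul (TensorProduct.map (convRight LinearMap.id beta) S (Coalgebra.comul (R := k) h)) =
      beta h • unit 1
  /-- `∑ φ⁻¹(h₁ ⊗ S(h₃) ⊗ h₅) β(h₂) α(h₄) = ε(h)` -/
  phiInv_S :
    phiInv ∘ₗ
      TensorProduct.map
        (TensorProduct.map (convRight LinearMap.id beta) (convRight S alpha)) LinearMap.id ∘ₗ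
      Coalgebra.comul.rTensor H ∘ₗ Coalgebra.comul = Coalgebra.counit
  /-- `∑ φ(S(h₁) ⊗ h₃ ⊗ S(h₅)) α(h₂) β(h₄) = ε(h)` -/
  phi_S :
    phi ∘ₗ
      TensorProduct.map
        (TensorProduct.map (convRight S alpha) (convRight LinearMap.id beta)) S ∘ₗ
      Coalgebra.comul.rTensor H ∘ₗ Coalgebra.comul = Coalgebra.counit

/-! ### Comodules and bicomodules -/

/-- A right `C`-comodule structure on the vector space `V`. -/
structure RightComodule (k C V : Type*) [Field k] [AddCommGroup C] [Module k C] [Coalgebra k C]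
    [AddCommGroup V] [Module k V] where
  coact : V →ₗ[k] V ⊗[k] C
  coassoc : (TensorProduct.assoc k V C C).toLinearMap ∘ₗ coact.rTensor C ∘ₗ coact =
    Coalgebra.comul.lTensor V ∘ₗ coact
  counit : (TensorProduct.rid k V).toLinearMap ∘ₗ Coalgebra.counit.lTensor V ∘ₗ coact =
    LinearMap.id

/-- `e` is an isomorphism of right comodules. -/
def RightComodule.IsIso {k C V V' : Type*} [Field k] [AddCommGroup C] [Module k C]
    [Coalgebra k C] [AddCommGroup V] [Module k V] [AddCommGroup V'] [Module k V']
    (X : RightComodule k C V) (X' : RightComodule k C V') (e : V ≃ₗ[k] V') : Prop :=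
  e.toLinearMap.rTensor C ∘ₗ X.coact = X'.coact ∘ₗ e.toLinearMap

/-- A pair of maps `m ↦ ∑ m₋₁ ⊗ m₀` and `m ↦ ∑ m₀ ⊗ m₁`; the axioms are in
`Bicoaction.IsBicomodule`. -/
structure Bicoaction (k C M : Type*) [Field k] [AddCommGroup C] [Module k C]
    [AddCommGroup M] [Module k M] where
  left : M →ₗ[k] C ⊗[k] M
  right : M →ₗ[k] M ⊗[k] C

namespace Bicoaction

/-- The axioms of a `(C, C)`-bicomodule: two commuting counital coassociative coactions. -/
structure IsBicomodule {k C M : Type*} [Field k] [AddCommGroup C] [Module k C] [Coalgebra k C]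
    [AddCommGroup M] [Module k M] (X : Bicoaction k C M) : Prop where
  left_coassoc : (TensorProduct.assoc k C C M).toLinearMap ∘ₗ
    Coalgebra.comul.rTensor M ∘ₗ X.left = X.left.lTensor C ∘ₗ X.left
  left_counit : (TensorProduct.lid k M).toLinearMap ∘ₗ
    Coalgebra.counit.rTensor M ∘ₗ X.left = LinearMap.id
  right_coassoc : (TensorProduct.assoc k M C C).toLinearMap ∘ₗ
    X.right.rTensor C ∘ₗ X.right = Coalgebra.comul.lTensor M ∘ₗ X.right
  right_counit : (TensorProduct.rid k M).toLinearMap ∘ₗ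
    Coalgebra.counit.lTensor M ∘ₗ X.right = LinearMap.id
  comm : (TensorProduct.assoc k C M C).toLinearMap ∘ₗ X.left.rTensor C ∘ₗ X.right =
    X.right.lTensor C ∘ₗ X.left

/-- `f` is a morphism of bicomodules. -/
def IsHom {k C M N : Type*} [Field k] [AddCommGroup C] [Module k C]
    [AddCommGroup M] [Module k M] [AddCommGroup N] [Module k N]
    (X : Bicoaction k C M) (Y : Bicoaction k C N) (f : M →ₗ[k] N) : Prop :=
  f.lTensor C ∘ₗ X.left = Y.left ∘ₗ f ∧ f.rTensor C ∘ₗ X.right = Y.right ∘ₗ f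

/-- The regular bicomodule: `C` with both coactions equal to the comultiplication. -/
def regular (k C : Type*) [Field k] [AddCommGroup C] [Module k C] [Coalgebra k C] :
    Bicoaction k C C where
  left := Coalgebra.comul
  right := Coalgebra.comul

end Bicoaction

section Coactions

variable {k C D M N : Type*} [CommSemiring k] [AddCommMonoid C] [Module k C] [AddCommMonoid D]
  [Module k D] [AddCommMonoid M] [Module k M] [AddCommMonoid N] [Module k N]

/-- `m ⊗ n ↦ ∑ (m₋₁ ⊗ n₋₁) ⊗ (m₀ ⊗ n₀)` -/
def extLeft (l : M →ₗ[k] C ⊗[k] M) (l' : N →ₗ[k] D ⊗[k] N) :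
    M ⊗[k] N →ₗ[k] (C ⊗[k] D) ⊗[k] (M ⊗[k] N) :=
  (TensorProduct.tensorTensorTensorComm k C M D N).toLinearMap ∘ₗ TensorProduct.map l l'

/-- `m ⊗ n ↦ ∑ (m₀ ⊗ n₀) ⊗ (m₁ ⊗ n₁)` -/
def extRight (r : M →ₗ[k] M ⊗[k] C) (r' : N →ₗ[k] N ⊗[k] D) :
    M ⊗[k] N →ₗ[k] (M ⊗[k] N) ⊗[k] (C ⊗[k] D) :=
  (TensorProduct.tensorTensorTensorComm k M C N D).toLinearMap ∘ₗ TensorProduct.map r r'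

/-- `m ↦ ∑ g(m₋₁) m₀` -/
def actLeft (g : C →ₗ[k] k) (l : M →ₗ[k] C ⊗[k] M) : M →ₗ[k] M :=
  (TensorProduct.lid k M).toLinearMap ∘ₗ g.rTensor M ∘ₗ l

/-- `m ↦ ∑ m₀ g(m₁)` -/
def actRight (g : C →ₗ[k] k) (r : M →ₗ[k] M ⊗[k] C) : M →ₗ[k] M :=
  (TensorProduct.rid k M).toLinearMap ∘ₗ g.lTensor M ∘ₗ r

/-- `f ↦ (m ↦ ∑ f(m₀) m₋₁)` -/
def slantLeft (l : M →ₗ[k] C ⊗[k] M) : Module.Dual k M →ₗ[k] M →ₗ[k] C where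
  toFun f := (TensorProduct.rid k C).toLinearMap ∘ₗ f.lTensor C ∘ₗ l
  map_add' f g := by
    rw [LinearMap.lTensor_add, LinearMap.add_comp, LinearMap.comp_add]
  map_smul' a f := by
    rw [LinearMap.lTensor_smul, LinearMap.smul_comp, LinearMap.comp_smul, RingHom.id_apply]

/-- `f ↦ (m ↦ ∑ f(m₀) m₁)` -/
def slantRight (r : M →ₗ[k] M ⊗[k] C) : Module.Dual k M →ₗ[k] M →ₗ[k] C where
  toFun f := (TensorProduct.lid k C).toLinearMap ∘ₗ f.rTensor C ∘ₗ r
  map_add' f g := by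
    rw [LinearMap.rTensor_add, LinearMap.add_comp, LinearMap.comp_add]
  map_smul' a f := by
    rw [LinearMap.rTensor_smul, LinearMap.smul_comp, LinearMap.comp_smul, RingHom.id_apply]

end Coactions

/-! ### The monoidal category of bicomodules and its right `H`-modules -/

namespace CoquasiBialgebra

variable {k H L M N V : Type*} [Field k] [AddCommGroup H] [Module k H] [Coalgebra k H]
  [AddCommGroup L] [Module k L] [AddCommGroup M] [Module k M] [AddCommGroup N] [Module k N]
  [AddCommGroup V] [Module k V]

/-- The tensor product over `k` of two bicomodules, with coactions
`∑ m₋₁n₋₁ ⊗ (m₀ ⊗ n₀)` and `∑ (m₀ ⊗ n₀) ⊗ m₁n₁`. -/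
def tensor (B : CoquasiBialgebra k H) (X : Bicoaction k H M) (Y : Bicoaction k H N) :
    Bicoaction k H (M ⊗[k] N) where
  left := B.mul.toLinearMap.rTensor (M ⊗[k] N) ∘ₗ extLeft X.left Y.left
  right := B.mul.toLinearMap.lTensor (M ⊗[k] N) ∘ₗ extRight X.right Y.right

/-- The associativity constraint
`Φ((l ⊗ m) ⊗ n) = ∑ φ(l₋₁ ⊗ m₋₁ ⊗ n₋₁) l₀ ⊗ (m₀ ⊗ n₀) φ⁻¹(l₁ ⊗ m₁ ⊗ n₁)`. -/
def associator (B : CoquasiBialgebra k H) (X : Bicoaction k H L) (Y : Bicoaction k H M)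
    (Z : Bicoaction k H N) : (L ⊗[k] M) ⊗[k] N →ₗ[k] L ⊗[k] (M ⊗[k] N) :=
  (TensorProduct.assoc k L M N).toLinearMap ∘ₗ
    actRight B.phiInv (extRight (extRight X.right Y.right) Z.right) ∘ₗ
    actLeft B.phi (extLeft (extLeft X.left Y.left) Z.left)

/-- The inverse constraint
`Φ⁻¹(l ⊗ (m ⊗ n)) = ∑ φ⁻¹(l₋₁ ⊗ m₋₁ ⊗ n₋₁) (l₀ ⊗ m₀) ⊗ n₀ φ(l₁ ⊗ m₁ ⊗ n₁)`. -/
def associatorInv (B : CoquasiBialgebra k H) (X : Bicoaction k H L) (Y : Bicoaction k H M)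
    (Z : Bicoaction k H N) : L ⊗[k] (M ⊗[k] N) →ₗ[k] (L ⊗[k] M) ⊗[k] N :=
  actLeft B.phiInv (extLeft (extLeft X.left Y.left) Z.left) ∘ₗ
    actRight B.phi (extRight (extRight X.right Y.right) Z.right) ∘ₗ
    (TensorProduct.assoc k L M N).symm.toLinearMap

/-- `(M, a)` is an object of the category of Hopf modules: a bicomodule `M` with a right action
`a : M ⊗ H → M` of the algebra `H` in the monoidal category of bicomodules. -/
structure IsHopfModule (B : CoquasiBialgebra k H) (X : Bicoaction k H M)
    (a : M ⊗[k] H →ₗ[k] M) : Prop where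
  isBicomodule : X.IsBicomodule
  isHom : (B.tensor X (Bicoaction.regular k H)).IsHom X a
  act_one : ∀ m : M, a (m ⊗ₜ[k] B.unit 1) = m
  act_act : a ∘ₗ a.rTensor H =
    a ∘ₗ B.mul.toLinearMap.lTensor M ∘ₗ
      B.associator X (Bicoaction.regular k H) (Bicoaction.regular k H)

/-- `e` is an isomorphism of Hopf modules: a linear isomorphism that preserves both coactions and
the right action. -/
def IsHopfModuleIso (X : Bicoaction k H M) (a : M ⊗[k] H →ₗ[k] M)
    (Y : Bicoaction k H N) (b : N ⊗[k] H →ₗ[k] N) (e : M ≃ₗ[k] N) : Prop :=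
  X.IsHom Y e.toLinearMap ∧ e.toLinearMap ∘ₗ a = b ∘ₗ e.toLinearMap.rTensor H

/-- The bicomodule `₀V`: the right comodule `V` with the trivial left coaction `v ↦ 1 ⊗ v`. -/
def trivialLeft (B : CoquasiBialgebra k H) (W : RightComodule k H V) : Bicoaction k H V where
  left := TensorProduct.mk k H V (B.unit 1)
  right := W.coact

/-- The bicomodule `M ⊗ H` underlying the free Hopf module on `M`. -/
def free (B : CoquasiBialgebra k H) (X : Bicoaction k H M) : Bicoaction k H (M ⊗[k] H) :=
  B.tensor X (Bicoaction.regular k H)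

/-- The right action `(M ⊗ H) ⊗ H → M ⊗ (H ⊗ H) → M ⊗ H` of the free Hopf module on `M`. -/
def freeAction (B : CoquasiBialgebra k H) (X : Bicoaction k H M) :
    (M ⊗[k] H) ⊗[k] H →ₗ[k] M ⊗[k] H :=
  B.mul.toLinearMap.lTensor M ∘ₗ
    B.associator X (Bicoaction.regular k H) (Bicoaction.regular k H)

/-- The space of left cointegrals: the `f ∈ H^∨` with `∑ x₁ f(x₂) = f(x) 1` for all `x`. -/
def leftCointegrals (B : CoquasiBialgebra k H) : Submodule k (Module.Dual k H) where
  carrier := {f | ∀ x : H, slantLeft (Coalgebra.comul (R := k) (A := H)) f x = f x • B.unit 1}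
  add_mem' {f g} hf hg x := by
    rw [map_add, LinearMap.add_apply, hf x, hg x, LinearMap.add_apply, add_smul]
  zero_mem' x := by
    rw [map_zero, LinearMap.zero_apply, LinearMap.zero_apply, zero_smul]
  smul_mem' a f hf x := by
    rw [map_smul, LinearMap.smul_apply, hf x, LinearMap.smul_apply, smul_assoc]

end CoquasiBialgebra

/-! ### Left duals -/

namespace CoquasiHopfAlgebra

variable {k H M : Type*} [Field k] [AddCommGroup H] [Module k H] [Coalgebra k H]
  [AddCommGroup M] [Module k M]

/-- The inverse `S̄` of the antipode under composition (`0` if there is none). -/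
def SInv (Q : CoquasiHopfAlgebra k H) : H →ₗ[k] H :=
  Ring.inverse (M₀ := Module.End k H) Q.S

variable [FiniteDimensional k M]

/-- The left dual `*M` of a bicomodule: `M^∨` with the coactions determined by
`∑ f₀(m) f₋₁ = ∑ f(m₀) S̄(m₋₁)` and `∑ f₀(m) f₁ = ∑ f(m₀) S(m₁)`. -/
def leftDual (Q : CoquasiHopfAlgebra k H) (X : Bicoaction k H M) :
    Bicoaction k H (Module.Dual k M) where
  left := (TensorProduct.comm k (Module.Dual k M) H).toLinearMap ∘ₗ
    (dualTensorHomEquiv k M H).symm.toLinearMap ∘ₗ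
    LinearMap.compRight k Q.SInv ∘ₗ slantLeft X.left
  right := (dualTensorHomEquiv k M H).symm.toLinearMap ∘ₗ
    LinearMap.compRight k Q.S ∘ₗ slantRight X.right

/-- `ev : *M ⊗ M → k`, `f ⊗ m ↦ ∑ β(S̄(m₋₁)) f(m₀) α(m₁)`. -/
def evLeft (Q : CoquasiHopfAlgebra k H) (X : Bicoaction k H M) :
    Module.Dual k M ⊗[k] M →ₗ[k] k :=
  contractLeft k M ∘ₗ
    (actLeft (Q.beta ∘ₗ Q.SInv) X.left ∘ₗ actRight Q.alpha X.right).lTensor (Module.Dual k M)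

/-- `coev : k → M ⊗ *M`, `1 ↦ ∑ᵢ α(S̄((eᵢ)₋₁)) (eᵢ)₀ β((eᵢ)₁) ⊗ eⁱ` for a basis `(eᵢ)` of `M`
and its dual basis `(eⁱ)`. -/
def coevLeft (Q : CoquasiHopfAlgebra k H) (X : Bicoaction k H M) :
    k →ₗ[k] M ⊗[k] Module.Dual k M :=
  (actLeft (Q.alpha ∘ₗ Q.SInv) X.left ∘ₗ actRight Q.beta X.right).rTensor (Module.Dual k M) ∘ₗ
    coevaluation k M

/-- The right action of `H` on the left dual `*M` of a left `H`-module `(M, a)` in bicomodules: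
`*M ⊗ H → (*M ⊗ H) ⊗ (M ⊗ *M) → ((*M ⊗ H) ⊗ M) ⊗ *M → (*M ⊗ (H ⊗ M)) ⊗ *M → (*M ⊗ M) ⊗ *M → *M`.
-/
def dualAction (Q : CoquasiHopfAlgebra k H) (X : Bicoaction k H M) (a : H ⊗[k] M →ₗ[k] M) :
    Module.Dual k M ⊗[k] H →ₗ[k] Module.Dual k M :=
  (TensorProduct.lid k (Module.Dual k M)).toLinearMap ∘ₗ
    (Q.evLeft X).rTensor (Module.Dual k M) ∘ₗ
    (a.lTensor (Module.Dual k M)).rTensor (Module.Dual k M) ∘ₗ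
    (Q.associator (Q.leftDual X) (Bicoaction.regular k H) X).rTensor (Module.Dual k M) ∘ₗ
    Q.associatorInv (Q.tensor (Q.leftDual X) (Bicoaction.regular k H)) X (Q.leftDual X) ∘ₗ
    (Q.coevLeft X).lTensor (Module.Dual k M ⊗[k] H) ∘ₗ
    (TensorProduct.rid k (Module.Dual k M ⊗[k] H)).symm.toLinearMap

variable [FiniteDimensional k H]

/-- The bicomodule `*H`, the left dual of the regular bicomodule. -/
def starH (Q : CoquasiHopfAlgebra k H) : Bicoaction k H (Module.Dual k H) :=
  Q.leftDual (Bicoaction.regular k H)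

/-- The right action `f ⊗ x ↦ f · x` of `H` on `*H` induced by left multiplication on `H`. -/
def starHAction (Q : CoquasiHopfAlgebra k H) :
    Module.Dual k H ⊗[k] H →ₗ[k] Module.Dual k H :=
  Q.dualAction (Bicoaction.regular k H) Q.mul.toLinearMap

/-- `e` is an isomorphism `₀V ⊗ H ≅ *H` of Hopf modules. -/
def IsFrobeniusIso {V : Type*} [AddCommGroup V] [Module k V] (Q : CoquasiHopfAlgebra k H)
    (W : RightComodule k H V) (e : V ⊗[k] H ≃ₗ[k] Module.Dual k H) : Prop :=
  CoquasiBialgebra.IsHopfModuleIso (Q.free (Q.trivialLeft W)) (Q.freeAction (Q.trivialLeft W))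
    Q.starH Q.starHAction e

end CoquasiHopfAlgebra

end

set_option maxSynthPendingDepth 3
set_option synthInstance.maxHeartbeats 400000
set_option maxHeartbeats 1000000
set_option linter.unusedSectionVars false

open scoped TensorProduct

noncomputable section

/-! ### Algebra maps between tensor powers of an algebra -/

namespace TensorLegs

variable {k A : Type*} [CommRing k] [Ring A] [Algebra k A]

/-- `D ⊗ id` -/
def onLeft (D : A →ₐ[k] A ⊗[k] A) : A ⊗[k] A →ₐ[k] (A ⊗[k] A) ⊗[k] A :=
  Algebra.TensorProduct.map D (AlgHom.id k A)

/-- `id ⊗ D` -/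
def onRight (D : A →ₐ[k] A ⊗[k] A) : A ⊗[k] A →ₐ[k] (A ⊗[k] A) ⊗[k] A :=
  (Algebra.TensorProduct.assoc k k k A A A).symm.toAlgHom.comp
    (Algebra.TensorProduct.map (AlgHom.id k A) D)

/-- `D ⊗ id ⊗ id` -/
def onFirst (D : A →ₐ[k] A ⊗[k] A) : (A ⊗[k] A) ⊗[k] A →ₐ[k] ((A ⊗[k] A) ⊗[k] A) ⊗[k] A :=
  Algebra.TensorProduct.map (onLeft D) (AlgHom.id k A)

/-- `id ⊗ D ⊗ id` -/
def onSecond (D : A →ₐ[k] A ⊗[k] A) : (A ⊗[k] A) ⊗[k] A →ₐ[k] ((A ⊗[k] A) ⊗[k] A) ⊗[k] A :=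
  Algebra.TensorProduct.map (onRight D) (AlgHom.id k A)

/-- `id ⊗ id ⊗ D` -/
def onThird (D : A →ₐ[k] A ⊗[k] A) : (A ⊗[k] A) ⊗[k] A →ₐ[k] ((A ⊗[k] A) ⊗[k] A) ⊗[k] A :=
  (Algebra.TensorProduct.assoc k k k (A ⊗[k] A) A A).symm.toAlgHom.comp
    (Algebra.TensorProduct.map (AlgHom.id k (A ⊗[k] A)) D)

variable (k A) in
/-- `a ⊗ b ⊗ c ↦ 1 ⊗ a ⊗ b ⊗ c` -/
def shift : (A ⊗[k] A) ⊗[k] A →ₐ[k] ((A ⊗[k] A) ⊗[k] A) ⊗[k] A :=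
  Algebra.TensorProduct.map
    (Algebra.TensorProduct.map Algebra.TensorProduct.includeRight (AlgHom.id k A)) (AlgHom.id k A)

variable (k A) in
/-- `a ⊗ b ↦ 1 ⊗ a ⊗ b` -/
def shiftTwo : A ⊗[k] A →ₐ[k] (A ⊗[k] A) ⊗[k] A :=
  Algebra.TensorProduct.map Algebra.TensorProduct.includeRight (AlgHom.id k A)

/-- `e ⊗ id` -/
def killLeft (e : A →ₐ[k] k) : A ⊗[k] A →ₐ[k] A :=
  (Algebra.TensorProduct.lid k A).toAlgHom.comp (Algebra.TensorProduct.map e (AlgHom.id k A))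

/-- `id ⊗ e` -/
def killRight (e : A →ₐ[k] k) : A ⊗[k] A →ₐ[k] A :=
  (Algebra.TensorProduct.rid k k A).toAlgHom.comp (Algebra.TensorProduct.map (AlgHom.id k A) e)

/-- `e ⊗ id ⊗ id` -/
def killFirst (e : A →ₐ[k] k) : (A ⊗[k] A) ⊗[k] A →ₐ[k] A ⊗[k] A :=
  Algebra.TensorProduct.map (killLeft e) (AlgHom.id k A)

/-- `id ⊗ e ⊗ id` -/
def killSecond (e : A →ₐ[k] k) : (A ⊗[k] A) ⊗[k] A →ₐ[k] A ⊗[k] A :=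
  Algebra.TensorProduct.map (killRight e) (AlgHom.id k A)

/-- `id ⊗ id ⊗ e` -/
def killThird (e : A →ₐ[k] k) : (A ⊗[k] A) ⊗[k] A →ₐ[k] A ⊗[k] A :=
  (Algebra.TensorProduct.rid k k (A ⊗[k] A)).toAlgHom.comp
    (Algebra.TensorProduct.map (AlgHom.id k (A ⊗[k] A)) e)

variable (D : A →ₐ[k] A ⊗[k] A) (e : A →ₐ[k] k) (a b c : A)

@[simp] lemma onLeft_tmul : onLeft D (a ⊗ₜ b) = D a ⊗ₜ b := rfl
@[simp] lemma onRight_tmul : onRight D (a ⊗ₜ b) =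
    (Algebra.TensorProduct.assoc k k k A A A).symm (a ⊗ₜ D b) := rfl
@[simp] lemma onFirst_tmul (t : A ⊗[k] A) : onFirst D (t ⊗ₜ c) = onLeft D t ⊗ₜ c := rfl
@[simp] lemma onSecond_tmul (t : A ⊗[k] A) : onSecond D (t ⊗ₜ c) = onRight D t ⊗ₜ c := rfl
@[simp] lemma onThird_tmul (t : A ⊗[k] A) : onThird D (t ⊗ₜ c) =
    (Algebra.TensorProduct.assoc k k k (A ⊗[k] A) A A).symm (t ⊗ₜ D c) := rfl
@[simp] lemma shift_tmul : shift k A ((a ⊗ₜ b) ⊗ₜ c) = ((1 ⊗ₜ a) ⊗ₜ b) ⊗ₜ c := rfl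
@[simp] lemma shiftTwo_tmul : shiftTwo k A (a ⊗ₜ b) = (1 ⊗ₜ a) ⊗ₜ b := rfl
@[simp] lemma killLeft_tmul : killLeft e (a ⊗ₜ b) = e a • b := rfl
@[simp] lemma killRight_tmul : killRight e (a ⊗ₜ b) = e b • a := rfl
@[simp] lemma killFirst_tmul (t : A ⊗[k] A) : killFirst e (t ⊗ₜ c) = killLeft e t ⊗ₜ c := rfl
@[simp] lemma killSecond_tmul (t : A ⊗[k] A) : killSecond e (t ⊗ₜ c) = killRight e t ⊗ₜ c := rfl
@[simp] lemma killThird_tmul (t : A ⊗[k] A) : killThird e (t ⊗ₜ c) = e c • t := rfl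

/-- `a ⊗ b ↦ f(a) g(b)` -/
def mulMap {M N E : Type*} [AddCommGroup M] [Module k M] [AddCommGroup N] [Module k N] [Ring E]
    [Algebra k E] (f : M →ₗ[k] E) (g : N →ₗ[k] E) : M ⊗[k] N →ₗ[k] E :=
  LinearMap.mul' k E ∘ₗ TensorProduct.map f g

@[simp] lemma mulMap_tmul {M N E : Type*} [AddCommGroup M] [Module k M] [AddCommGroup N]
    [Module k N] [Ring E] [Algebra k E] (f : M →ₗ[k] E) (g : N →ₗ[k] E) (m : M) (n : N) :
    mulMap f g (m ⊗ₜ n) = f m * g n := by simp [mulMap]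

/-- `a ⊗ b ↦ f(a) x g(b)` -/
def sandwich {M N E : Type*} [AddCommGroup M] [Module k M] [AddCommGroup N] [Module k N] [Ring E]
    [Algebra k E] (f : M →ₗ[k] E) (x : E) (g : N →ₗ[k] E) : M ⊗[k] N →ₗ[k] E :=
  mulMap (LinearMap.mulRight k x ∘ₗ f) g

@[simp] lemma sandwich_tmul {M N E : Type*} [AddCommGroup M] [Module k M] [AddCommGroup N]
    [Module k N] [Ring E] [Algebra k E] (f : M →ₗ[k] E) (x : E) (g : N →ₗ[k] E) (m : M) (n : N) :
    sandwich f x g (m ⊗ₜ n) = f m * x * g n := by simp [sandwich]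

end TensorLegs

open TensorLegs

/-! ### Quasi-Hopf algebras -/

/-- A quasi-Hopf algebra `A` with reassociator `Φ`; its inverse is `Ψ`. -/
structure QuasiHopf (k A : Type*) [Field k] [Ring A] [Algebra k A] where
  Δ : A →ₐ[k] A ⊗[k] A
  ε : A →ₐ[k] k
  Φ : (A ⊗[k] A) ⊗[k] A
  Ψ : (A ⊗[k] A) ⊗[k] A
  Φ_mul_Ψ : Φ * Ψ = 1
  Ψ_mul_Φ : Ψ * Φ = 1
  killLeft_Δ : ∀ a, killLeft ε (Δ a) = a
  killRight_Δ : ∀ a, killRight ε (Δ a) = a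
  Δ_Φ : ∀ a, onLeft Δ (Δ a) * Φ = Φ * onRight Δ (Δ a)
  pentagon : onFirst Δ Φ * onThird Δ Φ = Φ ⊗ₜ[k] 1 * (onSecond Δ Φ * shift k A Φ)
  killSecond_Φ : killSecond ε Φ = 1
  s : A →ₗ[k] A
  s_one : s 1 = 1
  s_mul : ∀ a b, s (a * b) = s b * s a
  α : A
  β : A
  s_α : ∀ a, sandwich s α LinearMap.id (Δ a) = ε a • α
  β_s : ∀ a, sandwich LinearMap.id β s (Δ a) = ε a • β
  Φ_s : sandwich (sandwich s α LinearMap.id) β s Φ = 1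
  Ψ_s : sandwich (sandwich LinearMap.id β s) α LinearMap.id Ψ = 1

namespace QuasiHopf

variable {k A : Type*} [Field k] [Ring A] [Algebra k A] (Q : QuasiHopf k A)

attribute [simp] s_one s_mul killLeft_Δ killRight_Δ

lemma map_Φ_mul_map_Ψ {B : Type*} [Ring B] [Algebra k B] (f : (A ⊗[k] A) ⊗[k] A →ₐ[k] B) :
    f Q.Φ * f Q.Ψ = 1 := by rw [← map_mul, Q.Φ_mul_Ψ, map_one]

lemma map_Ψ_mul_map_Φ {B : Type*} [Ring B] [Algebra k B] (f : (A ⊗[k] A) ⊗[k] A →ₐ[k] B) :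
    f Q.Ψ * f Q.Φ = 1 := by rw [← map_mul, Q.Ψ_mul_Φ, map_one]

lemma Ψ_Δ (a : A) : Q.Ψ * onLeft Q.Δ (Q.Δ a) = onRight Q.Δ (Q.Δ a) * Q.Ψ := by
  calc _ = Q.Ψ * (onLeft Q.Δ (Q.Δ a) * Q.Φ) * Q.Ψ := by
        rw [mul_assoc, mul_assoc, Q.Φ_mul_Ψ, mul_one]
    _ = _ := by rw [Q.Δ_Φ, ← mul_assoc, Q.Ψ_mul_Φ, one_mul]

lemma Ψ_pentagon : onThird Q.Δ Q.Ψ * onFirst Q.Δ Q.Ψ =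
    shift k A Q.Ψ * (onSecond Q.Δ Q.Ψ * Q.Ψ ⊗ₜ[k] 1) := by
  have h : (onFirst Q.Δ Q.Φ * onThird Q.Δ Q.Φ) * (onThird Q.Δ Q.Ψ * onFirst Q.Δ Q.Ψ) = 1 := by
    rw [mul_assoc, ← mul_assoc (onThird Q.Δ Q.Φ), map_Φ_mul_map_Ψ, one_mul, map_Φ_mul_map_Ψ]
  have h' : shift k A Q.Ψ * (onSecond Q.Δ Q.Ψ * Q.Ψ ⊗ₜ[k] 1) *
      (Q.Φ ⊗ₜ[k] 1 * (onSecond Q.Δ Q.Φ * shift k A Q.Φ)) = 1 := by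
    have e : Q.Ψ ⊗ₜ[k] (1 : A) * Q.Φ ⊗ₜ[k] 1 = 1 := by
      rw [Algebra.TensorProduct.tmul_mul_tmul, Q.Ψ_mul_Φ, one_mul]; rfl
    calc _ = shift k A Q.Ψ * (onSecond Q.Δ Q.Ψ * (Q.Ψ ⊗ₜ[k] 1 * Q.Φ ⊗ₜ[k] 1) *
          onSecond Q.Δ Q.Φ) * shift k A Q.Φ := by simp only [mul_assoc]
      _ = 1 := by rw [e, mul_one, map_Ψ_mul_map_Φ, mul_one, map_Ψ_mul_map_Φ]
  rw [Q.pentagon] at h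
  exact (left_inv_eq_right_inv h' h).symm

/-- The pentagon, solved so that the counit can be applied to the outer factors. -/
lemma pentagon_solved : onThird Q.Δ Q.Ψ * (onFirst Q.Δ Q.Ψ * Q.Φ ⊗ₜ[k] 1) =
    shift k A Q.Ψ * onSecond Q.Δ Q.Ψ := by
  have e : Q.Ψ ⊗ₜ[k] (1 : A) * Q.Φ ⊗ₜ[k] 1 = 1 := by
    rw [Algebra.TensorProduct.tmul_mul_tmul, Q.Ψ_mul_Φ, one_mul]; rfl
  rw [← mul_assoc, Ψ_pentagon, mul_assoc, mul_assoc, e, mul_one]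

lemma map_Ψ_eq_one {B : Type*} [Ring B] [Algebra k B] (f : (A ⊗[k] A) ⊗[k] A →ₐ[k] B)
    (h : f Q.Φ = 1) : f Q.Ψ = 1 := by
  have := Q.map_Φ_mul_map_Ψ f
  rwa [h, one_mul] at this

lemma killSecond_Ψ : killSecond Q.ε Q.Ψ = 1 := Q.map_Ψ_eq_one _ Q.killSecond_Φ

lemma killFirst_Φ : killFirst Q.ε Q.Φ = 1 := by
  let F : ((A ⊗[k] A) ⊗[k] A) ⊗[k] A →ₐ[k] (A ⊗[k] A) ⊗[k] A :=
    Algebra.TensorProduct.map (killSecond Q.ε) (AlgHom.id k A)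
  have h1 : ∀ T, F (onFirst Q.Δ T) = T := fun T ↦ by
    induction T with
    | zero => simp
    | add x y hx hy => rw [map_add, map_add, hx, hy]
    | tmul t c =>
      induction t with
      | zero => simp
      | add x y hx hy => rw [TensorProduct.add_tmul, map_add, map_add, hx, hy]
      | tmul a b => simp [F]
  have h2 : ∀ T, F (onThird Q.Δ T) = onRight Q.Δ (killSecond Q.ε T) := fun T ↦ by
    induction T with
    | zero => simp
    | add x y hx hy => simp only [map_add, hx, hy]
    | tmul t c =>
      induction t with
      | zero => simp
      | add x y hx hy => simp only [TensorProduct.add_tmul, map_add, hx, hy]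
      | tmul a b =>
        simp only [onThird_tmul, killSecond_tmul, killRight_tmul, onRight_tmul]
        induction Q.Δ c with
        | zero => simp
        | add x y hx hy => simp only [TensorProduct.tmul_add, map_add, hx, hy]
        | tmul c d => simp [F]
  have h3 : ∀ T, F (onSecond Q.Δ T) = T := fun T ↦ by
    induction T with
    | zero => simp
    | add x y hx hy => rw [map_add, map_add, hx, hy]
    | tmul t c =>
      induction t with
      | zero => simp
      | add x y hx hy => rw [TensorProduct.add_tmul, map_add, map_add, hx, hy]
      | tmul a b =>
        have : killSecond Q.ε (onRight Q.Δ (a ⊗ₜ b)) = a ⊗ₜ killLeft Q.ε (Q.Δ b) := by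
          rw [onRight_tmul]
          induction Q.Δ b with
          | zero => simp
          | add x y hx hy => simp only [TensorProduct.tmul_add, map_add, hx, hy]
          | tmul c d => simp [TensorProduct.smul_tmul]
        simp [F, this, -onRight_tmul]
  have h4 : ∀ T, F (shift k A T) = shiftTwo k A (killFirst Q.ε T) := fun T ↦ by
    induction T with
    | zero => simp
    | add x y hx hy => simp only [map_add, hx, hy]
    | tmul t c =>
      induction t with
      | zero => simp
      | add x y hx hy => simp only [TensorProduct.add_tmul, map_add, hx, hy]
      | tmul a b => simp [F, TensorProduct.smul_tmul]
  have h5 : ∀ T, killFirst Q.ε (shiftTwo k A T) = T := fun T ↦ by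
    induction T with
    | zero => simp
    | add x y hx hy => simp only [map_add, hx, hy]
    | tmul a b => simp
  have h := congrArg F Q.pentagon
  have h6 : F (Q.Φ ⊗ₜ[k] 1) = 1 := by
    simp only [F, Algebra.TensorProduct.map_tmul, Q.killSecond_Φ, map_one]; rfl
  rw [map_mul, map_mul, map_mul, h1, h2, h3, h4, h6, Q.killSecond_Φ, map_one, mul_one, one_mul] at h
  have h7 := congrArg (Q.Ψ * ·) h
  simp only [← mul_assoc, Q.Ψ_mul_Φ, one_mul] at h7
  rw [← h5 (killFirst Q.ε Q.Φ), ← h7, map_one]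

lemma killThird_Φ : killThird Q.ε Q.Φ = 1 := by
  let F : ((A ⊗[k] A) ⊗[k] A) ⊗[k] A →ₐ[k] (A ⊗[k] A) ⊗[k] A :=
    Algebra.TensorProduct.map (killThird Q.ε) (AlgHom.id k A)
  have h1 : ∀ T, F (onFirst Q.Δ T) = onLeft Q.Δ (killSecond Q.ε T) := fun T ↦ by
    induction T with
    | zero => simp
    | add x y hx hy => simp only [map_add, hx, hy]
    | tmul t c =>
      induction t with
      | zero => simp
      | add x y hx hy => simp only [TensorProduct.add_tmul, map_add, hx, hy]
      | tmul a b => simp [F]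
  have h2 : ∀ T, F (onThird Q.Δ T) = T := fun T ↦ by
    induction T with
    | zero => simp
    | add x y hx hy => rw [map_add, map_add, hx, hy]
    | tmul t c =>
      have : F (onThird Q.Δ (t ⊗ₜ c)) = t ⊗ₜ killLeft Q.ε (Q.Δ c) := by
        rw [onThird_tmul]
        induction Q.Δ c with
        | zero => simp
        | add x y hx hy => simp only [TensorProduct.tmul_add, map_add, hx, hy]
        | tmul c d => simp [F, TensorProduct.smul_tmul]
      rw [this, killLeft_Δ]
  have h3 : ∀ T, F (onSecond Q.Δ T) = T := fun T ↦ by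
    induction T with
    | zero => simp
    | add x y hx hy => rw [map_add, map_add, hx, hy]
    | tmul t c =>
      induction t with
      | zero => simp
      | add x y hx hy => rw [TensorProduct.add_tmul, map_add, map_add, hx, hy]
      | tmul a b =>
        have : killThird Q.ε (onRight Q.Δ (a ⊗ₜ b)) = a ⊗ₜ killRight Q.ε (Q.Δ b) := by
          rw [onRight_tmul]
          induction Q.Δ b with
          | zero => simp
          | add x y hx hy => simp only [TensorProduct.tmul_add, map_add, hx, hy]
          | tmul c d => simp
        simp [F, this, -onRight_tmul]
  have h4 : ∀ T, F (shift k A T) = shiftTwo k A (killSecond Q.ε T) := fun T ↦ by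
    induction T with
    | zero => simp
    | add x y hx hy => simp only [map_add, hx, hy]
    | tmul t c =>
      induction t with
      | zero => simp
      | add x y hx hy => simp only [TensorProduct.add_tmul, map_add, hx, hy]
      | tmul a b => simp [F]
  have h := congrArg F Q.pentagon
  have h6 : F (Q.Φ ⊗ₜ[k] 1) = killThird Q.ε Q.Φ ⊗ₜ 1 := by
    simp only [F, Algebra.TensorProduct.map_tmul, map_one]
  rw [map_mul, map_mul, map_mul, h1, h2, h3, h4, h6, Q.killSecond_Φ, map_one, map_one, mul_one,
    one_mul] at h
  have h7 := congrArg (· * Q.Ψ) h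
  simp only [mul_assoc, Q.Φ_mul_Ψ, mul_one] at h7
  have h8 := congrArg (killThird Q.ε) h7
  simpa using h8.symm

lemma killFirst_Ψ : killFirst Q.ε Q.Ψ = 1 := Q.map_Ψ_eq_one _ Q.killFirst_Φ

lemma killThird_Ψ : killThird Q.ε Q.Ψ = 1 := Q.map_Ψ_eq_one _ Q.killThird_Φ

end QuasiHopf

namespace TensorLegs

variable {k L M N P : Type*} [CommRing k] [AddCommGroup L] [Module k L] [AddCommGroup M]
  [Module k M] [AddCommGroup N] [Module k N] [AddCommGroup P] [Module k P]

@[elab_as_elim]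
theorem pure_induction₂ {p : L ⊗[k] M → Prop} (t : L ⊗[k] M)
    (tmul : ∀ a b, p (a ⊗ₜ b)) (add : ∀ x y, p x → p y → p (x + y)) : p t := by
  induction t with
  | zero => simpa using tmul 0 0
  | add x y hx hy => exact add x y hx hy
  | tmul a b => exact tmul a b

@[elab_as_elim]
theorem pure_induction₃ {p : (L ⊗[k] M) ⊗[k] N → Prop} (t : (L ⊗[k] M) ⊗[k] N)
    (tmul : ∀ a b c, p ((a ⊗ₜ b) ⊗ₜ c)) (add : ∀ x y, p x → p y → p (x + y)) : p t := by
  induction t using pure_induction₂ with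
  | add x y hx hy => exact add x y hx hy
  | tmul t c =>
    induction t using pure_induction₂ with
    | add x y hx hy => rw [TensorProduct.add_tmul]; exact add _ _ hx hy
    | tmul a b => exact tmul a b c

@[elab_as_elim]
theorem pure_induction₄ {p : ((L ⊗[k] M) ⊗[k] N) ⊗[k] P → Prop}
    (t : ((L ⊗[k] M) ⊗[k] N) ⊗[k] P) (tmul : ∀ a b c d, p (((a ⊗ₜ b) ⊗ₜ c) ⊗ₜ d))
    (add : ∀ x y, p x → p y → p (x + y)) : p t := by
  induction t using pure_induction₂ with
  | add x y hx hy => exact add x y hx hy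
  | tmul t c =>
    induction t using pure_induction₃ with
    | add x y hx hy => rw [TensorProduct.add_tmul]; exact add _ _ hx hy
    | tmul a b d => exact tmul a b d c

end TensorLegs

namespace QuasiHopf

variable {k A : Type*} [Field k] [Ring A] [Algebra k A] (Q : QuasiHopf k A)
variable {E : Type*} [Ring E] [Algebra k E] (f : A →ₗ[k] E) (u v : A →ₐ[k] E)

/-- `a ⊗ b ⊗ c ↦ u(a) u(β) u(s b) v(α) v(c)` -/
def contr₃ : (A ⊗[k] A) ⊗[k] A →ₗ[k] E :=
  sandwich (sandwich u.toLinearMap (u Q.β) (u.toLinearMap ∘ₗ Q.s)) (v Q.α) v.toLinearMap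

/-- `a ⊗ b ⊗ c ⊗ d ↦ f(a) u(b) u(β) u(s c) v(α) v(d)` -/
def contr₄ : ((A ⊗[k] A) ⊗[k] A) ⊗[k] A →ₗ[k] E :=
  sandwich (sandwich (mulMap f u.toLinearMap) (u Q.β) (u.toLinearMap ∘ₗ Q.s)) (v Q.α)
    v.toLinearMap

@[simp] lemma contr₃_tmul (a b c : A) : Q.contr₃ u v ((a ⊗ₜ b) ⊗ₜ c) =
    u a * u Q.β * u (Q.s b) * v Q.α * v c := by simp [contr₃]

@[simp] lemma contr₄_tmul (a b c d : A) : Q.contr₄ f u v (((a ⊗ₜ b) ⊗ₜ c) ⊗ₜ d) =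
    f a * u b * u Q.β * u (Q.s c) * v Q.α * v d := by simp [contr₄]

lemma contr₃_mul_onLeft (T : (A ⊗[k] A) ⊗[k] A) (t : A ⊗[k] A) :
    Q.contr₃ u v (T * onLeft Q.Δ t) = Q.contr₃ u v T * v (killLeft Q.ε t) := by
  induction T using pure_induction₃ with
  | add x y hx hy => simp only [add_mul, map_add, hx, hy]
  | tmul a b c =>
  induction t using pure_induction₂ with
  | add x y hx hy => simp only [mul_add, map_add, hx, hy]
  | tmul x z =>
  have h (d : A ⊗[k] A) : Q.contr₃ u v ((a ⊗ₜ b) ⊗ₜ c * d ⊗ₜ z) =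
      u a * u (sandwich LinearMap.id Q.β Q.s d) * u (Q.s b) * v Q.α * v (c * z) := by
    induction d using pure_induction₂ with
    | add x y hx hy =>
      simp only [TensorProduct.add_tmul, mul_add, add_mul, map_add, hx, hy]
    | tmul p q => simp [mul_assoc]
  rw [onLeft_tmul, h]
  simp [Q.β_s, mul_assoc]

lemma contr₃_onRight_mul (huv : ∀ a, u (Q.s a) = v (Q.s a)) (T : (A ⊗[k] A) ⊗[k] A)
    (t : A ⊗[k] A) :
    Q.contr₃ u v (onRight Q.Δ t * T) = u (killRight Q.ε t) * Q.contr₃ u v T := by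
  induction T using pure_induction₃ with
  | add x y hx hy => simp only [mul_add, map_add, hx, hy]
  | tmul a b c =>
  induction t using pure_induction₂ with
  | add x y hx hy => simp only [add_mul, map_add, hx, hy]
  | tmul x z =>
  have h (d : A ⊗[k] A) : Q.contr₃ u v
      ((Algebra.TensorProduct.assoc k k k A A A).symm (x ⊗ₜ d) * (a ⊗ₜ b) ⊗ₜ c) =
      u x * u a * u Q.β * u (Q.s b) * v (sandwich Q.s Q.α LinearMap.id d) * v c := by
    induction d using pure_induction₂ with
    | add x y hx hy =>
      simp only [TensorProduct.tmul_add, mul_add, add_mul, map_add, hx, hy]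
    | tmul p q => simp [mul_assoc, huv p]
  simp [h, Q.s_α, mul_assoc]

lemma contr₄_onThird_mul (huv : ∀ a, u (Q.s a) = v (Q.s a)) (P : ((A ⊗[k] A) ⊗[k] A) ⊗[k] A)
    (T : (A ⊗[k] A) ⊗[k] A) : Q.contr₄ f u v (onThird Q.Δ T * P) =
      Q.contr₄ f u v ((killThird Q.ε T ⊗ₜ 1) ⊗ₜ 1 * P) := by
  induction P using pure_induction₄ with
  | add x y hx hy => simp only [mul_add, map_add, hx, hy]
  | tmul p q r s =>
  induction T using pure_induction₃ with
  | add x y hx hy => simp only [add_mul, TensorProduct.add_tmul, map_add, hx, hy]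
  | tmul a b c =>
  have h (d : A ⊗[k] A) : Q.contr₄ f u v
      ((Algebra.TensorProduct.assoc k k k (A ⊗[k] A) A A).symm ((a ⊗ₜ b) ⊗ₜ d) *
        ((p ⊗ₜ q) ⊗ₜ r) ⊗ₜ s) =
      f (a * p) * u (b * q) * u Q.β * u (Q.s r) * v (sandwich Q.s Q.α LinearMap.id d) * v s := by
    induction d using pure_induction₂ with
    | add x y hx hy =>
      simp only [TensorProduct.tmul_add, mul_add, add_mul, map_add, hx, hy]
    | tmul c d => simp [mul_assoc, huv c]
  simp [h, Q.s_α, mul_assoc, ← TensorProduct.smul_tmul']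

lemma contr₄_mul_onSecond (P : ((A ⊗[k] A) ⊗[k] A) ⊗[k] A)
    (T : (A ⊗[k] A) ⊗[k] A) : Q.contr₄ f u v (P * onSecond Q.Δ T) =
      Q.contr₄ f u v (P * Algebra.TensorProduct.map
        ((Algebra.TensorProduct.includeLeft (S := k)).comp
          (Algebra.TensorProduct.includeLeft (S := k)))
        (AlgHom.id k A) (killSecond Q.ε T)) := by
  induction P using pure_induction₄ with
  | add x y hx hy => simp only [add_mul, map_add, hx, hy]
  | tmul p q r s =>
  induction T using pure_induction₃ with
  | add x y hx hy => simp only [mul_add, map_add, hx, hy]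
  | tmul a b c =>
  have h (d : A ⊗[k] A) : Q.contr₄ f u v
      (((p ⊗ₜ q) ⊗ₜ r) ⊗ₜ s * (Algebra.TensorProduct.assoc k k k A A A).symm (a ⊗ₜ d) ⊗ₜ c) =
      f (p * a) * u q * u (sandwich LinearMap.id Q.β Q.s d) * u (Q.s r) * v Q.α * v (s * c) := by
    induction d using pure_induction₂ with
    | add x y hx hy =>
      simp only [TensorProduct.tmul_add, TensorProduct.add_tmul, mul_add, add_mul, map_add, hx, hy]
    | tmul c d => simp [mul_assoc]
  rw [onSecond_tmul, onRight_tmul, h]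
  simp [Q.β_s, mul_assoc, ← TensorProduct.smul_tmul']

lemma contr₄_pentagon (huv : ∀ a, u (Q.s a) = v (Q.s a)) :
    Q.contr₄ f u v (onFirst Q.Δ Q.Ψ * Q.Φ ⊗ₜ[k] 1) = Q.contr₄ f u v (shift k A Q.Ψ) := by
  have h := congrArg (Q.contr₄ f u v) Q.pentagon_solved
  rw [contr₄_onThird_mul _ _ _ _ huv, contr₄_mul_onSecond, killThird_Ψ, killSecond_Ψ, map_one,
    mul_one] at h
  rw [← h]
  exact congrArg _ (one_mul _).symm

lemma contr₄_shift (T : (A ⊗[k] A) ⊗[k] A) :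
    Q.contr₄ f u v (shift k A T) = f 1 * Q.contr₃ u v T := by
  induction T using pure_induction₃ with
  | add x y hx hy => simp only [mul_add, map_add, hx, hy]
  | tmul a b c => simp [mul_assoc]

/-! ### The antipode is an epimorphism -/

lemma contr₄_onFirst_mul (P : ((A ⊗[k] A) ⊗[k] A) ⊗[k] A) (T : (A ⊗[k] A) ⊗[k] A) :
    Q.contr₄ (u.toLinearMap ∘ₗ LinearMap.mulRight k Q.α ∘ₗ Q.s) u v (onFirst Q.Δ T * P) =
      Q.contr₄ (u.toLinearMap ∘ₗ LinearMap.mulRight k Q.α ∘ₗ Q.s) u v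
        (Algebra.TensorProduct.map Algebra.TensorProduct.includeRight (AlgHom.id k A)
          (killFirst Q.ε T) * P) := by
  induction P using pure_induction₄ with
  | add x y hx hy => simp only [mul_add, map_add, hx, hy]
  | tmul p q r s =>
  induction T using pure_induction₃ with
  | add x y hx hy => simp only [add_mul, map_add, hx, hy]
  | tmul a b c =>
  have h (d : A ⊗[k] A) :
      Q.contr₄ (u.toLinearMap ∘ₗ LinearMap.mulRight k Q.α ∘ₗ Q.s) u v
        ((d ⊗ₜ b) ⊗ₜ c * ((p ⊗ₜ q) ⊗ₜ r) ⊗ₜ s) =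
      u (Q.s p) * u (sandwich Q.s Q.α LinearMap.id d) * u q * u Q.β * u (Q.s (b * r)) * v Q.α *
        v (c * s) := by
    induction d using pure_induction₂ with
    | add x y hx hy =>
      simp only [TensorProduct.add_tmul, mul_add, add_mul, map_add, hx, hy]
    | tmul c d => simp [mul_assoc]
  rw [onFirst_tmul, onLeft_tmul, h]
  simp [Q.s_α, mul_assoc, ← TensorProduct.smul_tmul']

/-- If two algebra maps agree on the image of the antipode, they are equal. -/
theorem eq_of_comp_s_eq (huv : ∀ a, u (Q.s a) = v (Q.s a)) : u = v := by
  set g := Q.contr₃ u v Q.Ψ with hg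
  have hgv (a : A) : g * v a = u a * g := by
    have h := Q.contr₃_mul_onLeft u v Q.Ψ (Q.Δ a)
    rwa [Ψ_Δ, contr₃_onRight_mul _ _ _ huv, killRight_Δ, killLeft_Δ, eq_comm] at h
  have hα : u Q.α * g = v Q.α := by
    have h := Q.contr₄_pentagon (u.toLinearMap ∘ₗ LinearMap.mulRight k Q.α ∘ₗ Q.s) u v huv
    rw [contr₄_shift, contr₄_onFirst_mul, killFirst_Ψ, map_one, one_mul] at h
    have key (T : (A ⊗[k] A) ⊗[k] A) :
        Q.contr₄ (u.toLinearMap ∘ₗ LinearMap.mulRight k Q.α ∘ₗ Q.s) u v (T ⊗ₜ 1) =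
          u (sandwich (sandwich Q.s Q.α LinearMap.id) Q.β Q.s T) * v Q.α := by
      induction T using pure_induction₃ with
      | add x y hx hy => simp only [TensorProduct.add_tmul, add_mul, map_add, hx, hy]
      | tmul a b c => simp [mul_assoc]
    simpa [key, Q.Φ_s] using h.symm
  have hg1 : g = 1 := by
    have key (T : (A ⊗[k] A) ⊗[k] A) :
        v (sandwich (sandwich Q.s Q.α LinearMap.id) Q.β Q.s T) =
          g * v (sandwich (sandwich Q.s Q.α LinearMap.id) Q.β Q.s T) := by
      induction T using pure_induction₃ with
      | add x y hx hy => simp only [mul_add, map_add]; rw [← hx, ← hy]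
      | tmul a b c =>
        simp only [sandwich_tmul, map_mul, LinearMap.id_apply, ← mul_assoc]
        rw [hgv, huv, mul_assoc (v (Q.s a)) g, hgv, hα]
    simpa [Q.Φ_s] using (key Q.Φ).symm
  ext a
  simpa [hg1] using (hgv a).symm

end QuasiHopf

namespace QuasiHopf

variable {k A : Type*} [Field k] [Ring A] [Algebra k A] (Q : QuasiHopf k A)
variable {E : Type*} [Ring E] [Algebra k E]

/-- The square of the antipode. -/
def sSq : A →ₐ[k] A :=
  AlgHom.ofLinearMap (Q.s ∘ₗ Q.s) (by simp) (by simp)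

@[simp] lemma sSq_apply (a : A) : Q.sSq a = Q.s (Q.s a) := rfl

lemma eq_of_comp_sSq_eq {u v : A →ₐ[k] E} (h : u.comp Q.sSq = v.comp Q.sSq) : u = v := by
  let w (u : A →ₐ[k] E) : A →ₐ[k] Eᵐᵒᵖ :=
    AlgHom.ofLinearMap ((MulOpposite.opLinearEquiv k).toLinearMap ∘ₗ u.toLinearMap ∘ₗ Q.s)
      (by simp) (by simp)
  have hw : w u = w v := Q.eq_of_comp_s_eq _ _ fun a ↦
    congrArg MulOpposite.op (DFunLike.congr_fun h a)
  exact Q.eq_of_comp_s_eq _ _ fun a ↦ MulOpposite.op_injective (DFunLike.congr_fun hw a)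

lemma eq_of_comp_sSq_pow_eq {u v : A →ₐ[k] E} (n : ℕ)
    (h : u.comp (Q.sSq ^ n) = v.comp (Q.sSq ^ n)) : u = v := by
  induction n with
  | zero => exact h
  | succ n ih =>
    refine ih (Q.eq_of_comp_sSq_eq ?_)
    rw [AlgHom.comp_assoc, AlgHom.comp_assoc]
    exact h

theorem s_bijective [FiniteDimensional k A] : Function.Bijective Q.s := by
  obtain ⟨n, hn, hn0⟩ := ((LinearMap.eventually_isCompl_ker_pow_range_pow
    Q.sSq.toLinearMap).and (Filter.eventually_gt_atTop 0)).exists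
  have hpow : (Q.sSq ^ n).toLinearMap = Q.sSq.toLinearMap ^ n := by
    clear hn hn0
    induction n with
    | zero => rfl
    | succ n ih => rw [pow_succ, pow_succ, ← ih]; rfl
  rw [← hpow] at hn
  set T := Q.sSq ^ n
  let r : T.range →ₐ[k] T.range := T.rangeRestrict.comp T.range.val
  have hr : Function.Injective r := by
    rw [injective_iff_map_eq_zero]
    intro a ha
    have h1 : (a : A) ∈ LinearMap.ker T.toLinearMap := by simpa [r] using congrArg Subtype.val ha
    have h2 : (a : A) ∈ LinearMap.range T.toLinearMap := a.2
    exact Subtype.ext ((Submodule.disjoint_def.mp hn.disjoint) _ h1 h2)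
  have hr' : Function.Bijective r :=
    ⟨hr, (LinearMap.injective_iff_surjective (f := r.toLinearMap)).mp hr⟩
  let e := AlgEquiv.ofBijective r hr'
  let π : A →ₐ[k] A := T.range.val.comp (e.symm.toAlgHom.comp T.rangeRestrict)
  have hπ : π = AlgHom.id k A := by
    refine Q.eq_of_comp_sSq_pow_eq n ?_
    ext a
    have : T.rangeRestrict (T a) = e (T.rangeRestrict a) := rfl
    change ((e.symm (T.rangeRestrict (T a)) : T.range) : A) = T a
    rw [this, AlgEquiv.symm_apply_apply]
    rfl
  have hTs : Function.Surjective T := fun a ↦ by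
    have : π a = a := DFunLike.congr_fun hπ a
    rw [← this]
    exact (e.symm (T.rangeRestrict a)).2
  have hT : Function.Injective T := (LinearMap.injective_iff_surjective
    (f := T.toLinearMap)).mpr hTs
  have hs : Function.Injective Q.s := by
    obtain ⟨m, rfl⟩ := Nat.exists_eq_succ_of_ne_zero hn0.ne'
    intro a b h
    refine hT ?_
    simp only [T, pow_succ, AlgHom.mul_apply, sSq_apply, h]
  exact ⟨hs, (LinearMap.injective_iff_surjective (f := Q.s)).mp hs⟩
end QuasiHopf

namespace TensorLegs

variable (k A : Type*) [CommRing k] [Ring A] [Algebra k A]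

/-- `a ↦ a ⊗ 1` -/
abbrev inL : A →ₐ[k] A ⊗[k] A := Algebra.TensorProduct.includeLeft

/-- `a ↦ 1 ⊗ a` -/
abbrev inR : A →ₐ[k] A ⊗[k] A := Algebra.TensorProduct.includeRight

/-- `a ⊗ b ↦ a ⊗ b ⊗ 1` -/
abbrev inL₂ : A ⊗[k] A →ₐ[k] (A ⊗[k] A) ⊗[k] A := Algebra.TensorProduct.includeLeft

end TensorLegs

namespace QuasiHopf

variable {k A : Type*} [Field k] [Ring A] [Algebra k A] (Q : QuasiHopf k A)

/-- `a ⊗ b ⊗ c ↦ Δ(s(a) α) (b ⊗ c)` -/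
def ω : (A ⊗[k] A) ⊗[k] A →ₗ[k] A ⊗[k] A :=
  mulMap (Q.Δ.toLinearMap ∘ₗ LinearMap.mulRight k Q.α ∘ₗ Q.s) LinearMap.id ∘ₗ
    (TensorProduct.assoc k A A A).toLinearMap

@[simp] lemma ω_tmul (a b c : A) :
    Q.ω ((a ⊗ₜ b) ⊗ₜ c) = Q.Δ (Q.s a) * Q.Δ Q.α * b ⊗ₜ c := by simp [ω]

/-- `a ⊗ b ⊗ c ↦ a ⊗ b β s(c)` -/
def foldβ : (A ⊗[k] A) ⊗[k] A →ₗ[k] A ⊗[k] A :=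
  (sandwich LinearMap.id Q.β Q.s).lTensor A ∘ₗ (TensorProduct.assoc k A A A).toLinearMap

@[simp] lemma foldβ_tmul (a b c : A) :
    Q.foldβ ((a ⊗ₜ b) ⊗ₜ c) = a ⊗ₜ (b * Q.β * Q.s c) := by simp [foldβ]

/-- `∑ X¹ ⊗ X² β s(X³)` -/
def p : A ⊗[k] A := Q.foldβ Q.Φ

/-- The element that describes, on the right, the action of `H` on `*H`. -/
def R : A ⊗[k] A := Q.ω (Q.Ψ * onLeft Q.Δ Q.p)

lemma ω_onRight_mul (a : A) (T : (A ⊗[k] A) ⊗[k] A) :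
    Q.ω (onRight Q.Δ (Q.Δ a) * T) = Q.ε a • Q.ω T := by
  induction T using pure_induction₃ with
  | add x y hx hy => simp only [mul_add, map_add, smul_add, hx, hy]
  | tmul x y z =>
  have h (d : A ⊗[k] A) : Q.ω (onRight Q.Δ d * (x ⊗ₜ y) ⊗ₜ z) =
      Q.Δ (Q.s x) * Q.Δ (sandwich Q.s Q.α LinearMap.id d) * y ⊗ₜ z := by
    induction d using pure_induction₂ with
    | add x y hx hy => simp only [add_mul, mul_add, map_add, hx, hy]
    | tmul b c =>
      have h' (d : A ⊗[k] A) : Q.ω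
          ((Algebra.TensorProduct.assoc k k k A A A).symm (b ⊗ₜ d) * (x ⊗ₜ y) ⊗ₜ z) =
          Q.Δ (Q.s x) * Q.Δ (Q.s b) * Q.Δ Q.α * d * y ⊗ₜ z := by
        induction d using pure_induction₂ with
        | add x y hx hy => simp only [TensorProduct.tmul_add, add_mul, mul_add, map_add, hx, hy]
        | tmul e f => simp [mul_assoc]
      simp [h', mul_assoc]
  rw [h, Q.s_α]
  simp

lemma ω_mul_shiftTwo (T : (A ⊗[k] A) ⊗[k] A) (t : A ⊗[k] A) :
    Q.ω (T * shiftTwo k A t) = Q.ω T * t := by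
  induction T using pure_induction₃ with
  | add x y hx hy => simp only [add_mul, map_add, hx, hy]
  | tmul x y z =>
  induction t using pure_induction₂ with
  | add x y hx hy => simp only [mul_add, map_add, hx, hy]
  | tmul a b => simp [mul_assoc]

lemma ω_mul_tmul_one (T : (A ⊗[k] A) ⊗[k] A) (a b : A) :
    Q.ω (T * (a ⊗ₜ b) ⊗ₜ 1) = Q.Δ (Q.s a) * Q.ω T * b ⊗ₜ 1 := by
  induction T using pure_induction₃ with
  | add x y hx hy => simp only [add_mul, mul_add, map_add, hx, hy]
  | tmul x y z => simp [mul_assoc]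

lemma ω_mul_inL₂ (T : (A ⊗[k] A) ⊗[k] A) (t : A ⊗[k] A) :
    Q.ω (T * t ⊗ₜ 1) = sandwich (Q.Δ.toLinearMap ∘ₗ Q.s) (Q.ω T) (inL k A).toLinearMap t := by
  induction t using pure_induction₂ with
  | add x y hx hy => simp only [TensorProduct.add_tmul, mul_add, map_add, hx, hy]
  | tmul a b => simp [ω_mul_tmul_one]

lemma foldβ_mul_onRight (T : (A ⊗[k] A) ⊗[k] A) (t : A ⊗[k] A) :
    Q.foldβ (T * onRight Q.Δ t) = Q.foldβ T * killRight Q.ε t ⊗ₜ 1 := by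
  induction T using pure_induction₃ with
  | add x y hx hy => simp only [add_mul, map_add, hx, hy]
  | tmul x y z =>
  induction t using pure_induction₂ with
  | add x y hx hy => simp only [mul_add, TensorProduct.add_tmul, map_add, hx, hy]
  | tmul a b =>
  have h (d : A ⊗[k] A) : Q.foldβ
      ((x ⊗ₜ y) ⊗ₜ z * (Algebra.TensorProduct.assoc k k k A A A).symm (a ⊗ₜ d)) =
      (x * a) ⊗ₜ (y * sandwich LinearMap.id Q.β Q.s d * Q.s z) := by
    induction d using pure_induction₂ with
    | add x y hx hy =>
      simp only [TensorProduct.tmul_add, add_mul, mul_add, map_add, hx, hy]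
    | tmul e f => simp [mul_assoc]
  rw [onRight_tmul, h, Q.β_s]
  simp [TensorProduct.smul_tmul']

lemma foldβ_onLeft_mul (T : (A ⊗[k] A) ⊗[k] A) (t : A ⊗[k] A) :
    Q.foldβ (onLeft Q.Δ t * T) =
      sandwich Q.Δ.toLinearMap (Q.foldβ T) ((inR k A).toLinearMap ∘ₗ Q.s) t := by
  induction t using pure_induction₂ with
  | add x y hx hy => simp only [add_mul, map_add, hx, hy]
  | tmul a b =>
  induction T using pure_induction₃ with
  | add x y hx hy => simp only [sandwich_tmul, add_mul, mul_add, map_add] at hx hy ⊢; rw [hx, hy]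
  | tmul x y z =>
  have h (d : A ⊗[k] A) : Q.foldβ (d ⊗ₜ b * (x ⊗ₜ y) ⊗ₜ z) =
      d * x ⊗ₜ (y * Q.β * Q.s z) * 1 ⊗ₜ Q.s b := by
    induction d using pure_induction₂ with
    | add x y hx hy =>
      simp only [TensorProduct.add_tmul, add_mul, map_add, hx, hy]
    | tmul e f => simp [mul_assoc]
  rw [onLeft_tmul, h]
  simp

lemma p_mul (a : A) : Q.p * a ⊗ₜ 1 =
    sandwich Q.Δ.toLinearMap Q.p ((inR k A).toLinearMap ∘ₗ Q.s) (Q.Δ a) := by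
  rw [p, ← foldβ_onLeft_mul, Q.Δ_Φ, foldβ_mul_onRight, killRight_Δ]

lemma ω_Ψ_mul_onLeft_sandwich (t : A ⊗[k] A) :
    Q.ω (Q.Ψ * onLeft Q.Δ (sandwich Q.Δ.toLinearMap Q.p ((inR k A).toLinearMap ∘ₗ Q.s) t)) =
      Q.R * 1 ⊗ₜ Q.s (killLeft Q.ε t) := by
  induction t using pure_induction₂ with
  | add x y hx hy => simp only [mul_add, TensorProduct.tmul_add, map_add, hx, hy]
  | tmul a b =>
  have h : onLeft Q.Δ (1 ⊗ₜ Q.s b) = shiftTwo k A (1 ⊗ₜ Q.s b) := by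
    rw [onLeft_tmul, map_one]; rfl
  simp only [sandwich_tmul, map_mul, AlgHom.toLinearMap_apply, LinearMap.comp_apply,
    Algebra.TensorProduct.includeRight_apply, h]
  rw [← mul_assoc, ← mul_assoc, Ψ_Δ, ω_mul_shiftTwo, mul_assoc, ω_onRight_mul]
  simp [R]

/-- Colinearity of the action of `H` on `*H`. -/
theorem R_mul_s (a : A) : Q.R * 1 ⊗ₜ Q.s a =
    sandwich (Q.Δ.toLinearMap ∘ₗ Q.s) Q.R (inL k A).toLinearMap (Q.Δ a) := by
  rw [R, ← ω_mul_inL₂, mul_assoc, ← R, ← onLeft_tmul, ← map_mul, p_mul,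
    ω_Ψ_mul_onLeft_sandwich, killLeft_Δ]

theorem killLeft_R : killLeft Q.ε Q.R = 1 := by
  have h (T : (A ⊗[k] A) ⊗[k] A) : killLeft Q.ε (Q.ω T) =
      sandwich Q.s Q.α LinearMap.id (killSecond Q.ε T) := by
    induction T using pure_induction₃ with
    | add x y hx hy => simp only [map_add, hx, hy]
    | tmul x y z => simp
  have h' (t : A ⊗[k] A) : killSecond Q.ε (onLeft Q.Δ t) = t := by
    induction t using pure_induction₂ with
    | add x y hx hy => simp only [map_add, hx, hy]
    | tmul x y => simp
  have h'' (T : (A ⊗[k] A) ⊗[k] A) : sandwich Q.s Q.α LinearMap.id (Q.foldβ T) =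
      sandwich (sandwich Q.s Q.α LinearMap.id) Q.β Q.s T := by
    induction T using pure_induction₃ with
    | add x y hx hy => simp only [map_add, hx, hy]
    | tmul x y z => simp [mul_assoc]
  rw [R, h, map_mul, killSecond_Ψ, one_mul, h', p, h'', Q.Φ_s]

/-- `∑ Δ(x¹) p (1 ⊗ s(x²) α x³) = 1 ⊗ 1` -/
theorem p_triangle : sandwich (sandwich Q.Δ.toLinearMap Q.p ((inR k A).toLinearMap ∘ₗ Q.s))
    (1 ⊗ₜ Q.α) (inR k A).toLinearMap Q.Ψ = 1 := by
  have h (T F : (A ⊗[k] A) ⊗[k] A) :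
      Q.contr₄ (inL k A).toLinearMap (inR k A) (inR k A) (onFirst Q.Δ T * F ⊗ₜ 1) =
      sandwich (sandwich Q.Δ.toLinearMap (Q.foldβ F) ((inR k A).toLinearMap ∘ₗ Q.s))
        (1 ⊗ₜ Q.α) (inR k A).toLinearMap T := by
    induction T using pure_induction₃ with
    | add x y hx hy => simp only [add_mul, map_add, hx, hy]
    | tmul x y z =>
    induction F using pure_induction₃ with
    | add x y hx hy =>
      simp only [sandwich_tmul, TensorProduct.add_tmul, add_mul, mul_add, map_add] at hx hy ⊢
      rw [hx, hy]
    | tmul a b c =>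
    have h (d : A ⊗[k] A) :
        Q.contr₄ (inL k A).toLinearMap (inR k A) (inR k A)
          ((d ⊗ₜ y) ⊗ₜ z * ((a ⊗ₜ b) ⊗ₜ c) ⊗ₜ 1) =
        d * a ⊗ₜ (b * Q.β * Q.s c) * 1 ⊗ₜ Q.s y * 1 ⊗ₜ Q.α * 1 ⊗ₜ z := by
      induction d using pure_induction₂ with
      | add x y hx hy =>
        simp only [TensorProduct.add_tmul, add_mul, map_add, hx, hy]
      | tmul e f => simp [mul_assoc]
    rw [onFirst_tmul, onLeft_tmul, h]
    simp
  have h' (T : (A ⊗[k] A) ⊗[k] A) : Q.contr₃ (inR k A) (inR k A) T =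
      inR k A (sandwich (sandwich LinearMap.id Q.β Q.s) Q.α LinearMap.id T) := by
    induction T using pure_induction₃ with
    | add x y hx hy => simp only [map_add, hx, hy]
    | tmul x y z => simp
  rw [p, ← h, contr₄_pentagon _ _ _ _ fun _ ↦ rfl, contr₄_shift, h', Q.Ψ_s]
  simp [Algebra.TensorProduct.one_def]

/-- Compatibility of the action of `H` on `*H` with the evaluation. -/
theorem R_mul_α : Q.R * 1 ⊗ₜ Q.α = Q.ω Q.Ψ := by
  have h (T : (A ⊗[k] A) ⊗[k] A) :
      Q.ω (Q.Ψ * onLeft Q.Δ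
        (sandwich (sandwich Q.Δ.toLinearMap Q.p ((inR k A).toLinearMap ∘ₗ Q.s))
          (1 ⊗ₜ Q.α) (inR k A).toLinearMap T)) =
      Q.R * 1 ⊗ₜ sandwich Q.s Q.α LinearMap.id (killFirst Q.ε T) := by
    induction T using pure_induction₃ with
    | add x y hx hy => simp only [map_add, mul_add, TensorProduct.tmul_add, hx, hy]
    | tmul x y z =>
    have h (a : A) : onLeft Q.Δ (1 ⊗ₜ a) = shiftTwo k A (1 ⊗ₜ a) := by
      rw [onLeft_tmul, map_one]; rfl
    have h' := Q.ω_Ψ_mul_onLeft_sandwich (x ⊗ₜ y)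
    rw [sandwich_tmul, map_mul (onLeft Q.Δ), map_mul (onLeft Q.Δ), AlgHom.toLinearMap_apply,
      Algebra.TensorProduct.includeRight_apply, h, h, ← mul_assoc, ← mul_assoc,
      ω_mul_shiftTwo, ω_mul_shiftTwo, h']
    simp [mul_assoc]
  have h1 := h Q.Ψ
  rw [p_triangle, map_one, mul_one, killFirst_Ψ, Algebra.TensorProduct.one_def] at h1
  simpa using h1.symm

end QuasiHopf

namespace QuasiHopf

variable {k A : Type*} [Field k] [Ring A] [Algebra k A] (Q : QuasiHopf k A)

/-- An element of `E ⊗ A` that intertwines right multiplication by `s(a)` is determined by its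
product with `α`. -/
theorem eq_of_mul_α_eq {E : Type*} [Ring E] [Algebra k E] (J : A → E ⊗[k] A → E ⊗[k] A)
    (hJ : ∀ a X b, J a (X * 1 ⊗ₜ b) = J a X * 1 ⊗ₜ b) {T U : E ⊗[k] A}
    (hT : ∀ a, T * 1 ⊗ₜ Q.s a = J a T) (hU : ∀ a, U * 1 ⊗ₜ Q.s a = J a U)
    (h : T * 1 ⊗ₜ Q.α = U * 1 ⊗ₜ Q.α) : T = U := by
  have key {T : E ⊗[k] A} (hT : ∀ a, T * 1 ⊗ₜ Q.s a = J a T) (a b c : A) :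
      T * 1 ⊗ₜ (Q.s a * Q.α * b * Q.β * Q.s c) =
        J a (T * 1 ⊗ₜ Q.α) * 1 ⊗ₜ (b * Q.β * Q.s c) := by
    rw [hJ, ← hT]
    simp [mul_assoc]
  have h' (X : (A ⊗[k] A) ⊗[k] A) :
      T * 1 ⊗ₜ sandwich (sandwich Q.s Q.α LinearMap.id) Q.β Q.s X =
      U * 1 ⊗ₜ sandwich (sandwich Q.s Q.α LinearMap.id) Q.β Q.s X := by
    induction X using pure_induction₃ with
    | add x y hx hy => simp only [map_add, TensorProduct.tmul_add, mul_add, hx, hy]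
    | tmul a b c =>
      simp only [sandwich_tmul, LinearMap.id_apply]
      rw [key hT, key hU, h]
  have h1 := h' Q.Φ
  rw [Q.Φ_s] at h1
  simpa [← Algebra.TensorProduct.one_def] using h1

lemma inL₂_inL_mul_shiftTwo (a : A) (t : A ⊗[k] A) :
    (a ⊗ₜ[k] (1 : A)) ⊗ₜ[k] (1 : A) * shiftTwo k A t =
      shiftTwo k A t * (a ⊗ₜ[k] (1 : A)) ⊗ₜ[k] (1 : A) := by
  induction t using pure_induction₂ with
  | add x y hx hy => simp only [map_add, mul_add, add_mul, hx, hy]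
  | tmul b c => simp

lemma onRight_one_tmul (a : A) : onRight Q.Δ (1 ⊗ₜ a) = shiftTwo k A (Q.Δ a) := by
  rw [onRight_tmul]
  induction Q.Δ a using pure_induction₂ with
  | add x y hx hy => simp only [map_add, TensorProduct.tmul_add, hx, hy]
  | tmul b c => simp

/-- `a ⊗ b ⊗ c, X ↦ (id ⊗ Δ)Δ(s a) X (b ⊗ c ⊗ 1)` -/
def conjS (X t : (A ⊗[k] A) ⊗[k] A) : (A ⊗[k] A) ⊗[k] A :=
  sandwich ((onRight Q.Δ).toLinearMap ∘ₗ Q.Δ.toLinearMap ∘ₗ Q.s) X (inL₂ k A).toLinearMap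
    (TensorProduct.assoc k A A A t)

lemma conjS_tmul (X : (A ⊗[k] A) ⊗[k] A) (a b c : A) :
    Q.conjS X ((a ⊗ₜ b) ⊗ₜ c) = onRight Q.Δ (Q.Δ (Q.s a)) * X * (b ⊗ₜ c) ⊗ₜ 1 := by
  simp [conjS]

lemma conjS_add (X t t' : (A ⊗[k] A) ⊗[k] A) :
    Q.conjS X (t + t') = Q.conjS X t + Q.conjS X t' := by simp [conjS]

lemma conjS_mul (X t : (A ⊗[k] A) ⊗[k] A) (a : A) :
    Q.conjS (X * 1 ⊗ₜ a) t = Q.conjS X t * 1 ⊗ₜ a := by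
  induction t using pure_induction₃ with
  | add x y hx hy => simp only [conjS_add, add_mul, hx, hy]
  | tmul x y z => simp [conjS_tmul, mul_assoc]

/-- `a ⊗ b ⊗ c ↦ (Δ ⊗ id)(Δ(s a) R) (b ⊗ c ⊗ 1)` -/
def υ : (A ⊗[k] A) ⊗[k] A →ₗ[k] (A ⊗[k] A) ⊗[k] A :=
  sandwich ((onLeft Q.Δ).toLinearMap ∘ₗ Q.Δ.toLinearMap ∘ₗ Q.s) (onLeft Q.Δ Q.R)
    (inL₂ k A).toLinearMap ∘ₗ (TensorProduct.assoc k A A A).toLinearMap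

@[simp] lemma υ_tmul (a b c : A) : Q.υ ((a ⊗ₜ b) ⊗ₜ c) =
    onLeft Q.Δ (Q.Δ (Q.s a)) * onLeft Q.Δ Q.R * (b ⊗ₜ c) ⊗ₜ 1 := by simp [υ]

/-- `a ⊗ b ⊗ c ⊗ d ↦ (id ⊗ Δ)Δ(s(a) α) (b ⊗ c ⊗ d)` -/
def ω₄ : ((A ⊗[k] A) ⊗[k] A) ⊗[k] A →ₗ[k] (A ⊗[k] A) ⊗[k] A :=
  mulMap ((onRight Q.Δ).toLinearMap ∘ₗ Q.Δ.toLinearMap ∘ₗ LinearMap.mulRight k Q.α ∘ₗ Q.s)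
    LinearMap.id ∘ₗ (TensorProduct.assoc k A (A ⊗[k] A) A).toLinearMap ∘ₗ
      (TensorProduct.assoc k A A A).toLinearMap.rTensor A

@[simp] lemma ω₄_tmul (a b c d : A) : Q.ω₄ (((a ⊗ₜ b) ⊗ₜ c) ⊗ₜ d) =
    onRight Q.Δ (Q.Δ (Q.s a)) * onRight Q.Δ (Q.Δ Q.α) * (b ⊗ₜ c) ⊗ₜ d := by simp [ω₄]

lemma onRight_mul_shiftTwo_mul_s (a : A) :
    onRight Q.Δ Q.R * shiftTwo k A Q.R * 1 ⊗ₜ Q.s a =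
      Q.conjS (onRight Q.Δ Q.R * shiftTwo k A Q.R) (onLeft Q.Δ (Q.Δ a)) := by
  have h1 (t : A ⊗[k] A) (y : A) :
      onRight Q.Δ (sandwich (Q.Δ.toLinearMap ∘ₗ Q.s) Q.R (inL k A).toLinearMap t) *
        shiftTwo k A Q.R * (1 ⊗ₜ y) ⊗ₜ 1 =
      Q.conjS (onRight Q.Δ Q.R * shiftTwo k A Q.R) (t ⊗ₜ y) := by
    induction t using pure_induction₂ with
    | add x y hx hy => simp only [map_add, TensorProduct.add_tmul, add_mul, conjS_add, hx, hy]
    | tmul b c =>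
      have e : onRight Q.Δ (c ⊗ₜ 1) = (c ⊗ₜ 1) ⊗ₜ 1 := by
        rw [onRight_tmul, map_one]; rfl
      simp only [sandwich_tmul, map_mul, conjS_tmul, AlgHom.toLinearMap_apply,
        LinearMap.comp_apply, Algebra.TensorProduct.includeLeft_apply, e]
      rw [mul_assoc _ ((c ⊗ₜ[k] (1 : A)) ⊗ₜ[k] (1 : A)), inL₂_inL_mul_shiftTwo]
      simp [mul_assoc]
  have h2 (t : A ⊗[k] A) :
      onRight Q.Δ Q.R * shiftTwo k A
        (sandwich (Q.Δ.toLinearMap ∘ₗ Q.s) Q.R (inL k A).toLinearMap t) =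
      Q.conjS (onRight Q.Δ Q.R * shiftTwo k A Q.R) (onLeft Q.Δ t) := by
    induction t using pure_induction₂ with
    | add x y hx hy => simp only [map_add, mul_add, conjS_add, hx, hy]
    | tmul x y =>
      rw [onLeft_tmul, ← h1, ← R_mul_s, map_mul (onRight Q.Δ), onRight_one_tmul]
      simp [mul_assoc]
  rw [← h2, ← R_mul_s, map_mul, mul_assoc]
  rfl

lemma υ_mul_s (T : (A ⊗[k] A) ⊗[k] A) (a : A) :
    Q.υ T * 1 ⊗ₜ Q.s a = Q.υ (onRight Q.Δ (Q.Δ a) * T) := by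
  induction T using pure_induction₃ with
  | add x y hx hy => simp only [map_add, mul_add, add_mul, hx, hy]
  | tmul x y z =>
    have h (t : A ⊗[k] A) :
        onLeft Q.Δ (Q.Δ (Q.s x)) *
          onLeft Q.Δ (sandwich (Q.Δ.toLinearMap ∘ₗ Q.s) Q.R (inL k A).toLinearMap t) *
            (y ⊗ₜ z) ⊗ₜ 1 = Q.υ (onRight Q.Δ t * (x ⊗ₜ y) ⊗ₜ z) := by
      induction t using pure_induction₂ with
      | add x y hx hy => simp only [map_add, mul_add, add_mul, hx, hy]
      | tmul b c =>
        have h' (d : A ⊗[k] A) : Q.υ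
            ((Algebra.TensorProduct.assoc k k k A A A).symm (b ⊗ₜ d) * (x ⊗ₜ y) ⊗ₜ z) =
            onLeft Q.Δ (Q.Δ (Q.s x)) * (onLeft Q.Δ (Q.Δ (Q.s b)) * onLeft Q.Δ Q.R * d ⊗ₜ 1) *
              (y ⊗ₜ z) ⊗ₜ 1 := by
          induction d using pure_induction₂ with
          | add x y hx hy =>
            simp only [TensorProduct.tmul_add, TensorProduct.add_tmul, add_mul, mul_add, map_add,
              hx, hy]
          | tmul e f => simp [mul_assoc]
        simp [h']
    rw [← h, ← R_mul_s, map_mul (onLeft Q.Δ)]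
    simp [mul_assoc]

lemma Ψ_mul_υ_mul_s (a : A) :
    Q.Ψ * Q.υ Q.Ψ * 1 ⊗ₜ Q.s a = Q.conjS (Q.Ψ * Q.υ Q.Ψ) (onLeft Q.Δ (Q.Δ a)) := by
  have h (T t : (A ⊗[k] A) ⊗[k] A) : Q.Ψ * Q.υ (T * t) = Q.conjS (Q.Ψ * Q.υ T) t := by
    induction t using pure_induction₃ with
    | add x y hx hy => simp only [map_add, mul_add, conjS_add, hx, hy]
    | tmul x y z =>
    have : Q.υ (T * (x ⊗ₜ y) ⊗ₜ z) =
        onLeft Q.Δ (Q.Δ (Q.s x)) * Q.υ T * (y ⊗ₜ z) ⊗ₜ 1 := by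
      induction T using pure_induction₃ with
      | add x y hx hy => simp only [map_add, mul_add, add_mul, hx, hy]
      | tmul a b c => simp [mul_assoc]
    rw [this, conjS_tmul, ← mul_assoc, ← mul_assoc, ← mul_assoc, Ψ_Δ]
  rw [mul_assoc, υ_mul_s, ← Ψ_Δ, h]

lemma onRight_ω (T : (A ⊗[k] A) ⊗[k] A) : onRight Q.Δ (Q.ω T) = Q.ω₄ (onThird Q.Δ T) := by
  induction T using pure_induction₃ with
  | add x y hx hy => simp only [map_add, hx, hy]
  | tmul a b c =>
    rw [ω_tmul, onThird_tmul, map_mul, map_mul, onRight_tmul]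
    induction Q.Δ c using pure_induction₂ with
    | add x y hx hy => simp only [map_add, mul_add, TensorProduct.tmul_add, hx, hy]
    | tmul x y => simp

lemma ω₄_mul (P : ((A ⊗[k] A) ⊗[k] A) ⊗[k] A) (T : (A ⊗[k] A) ⊗[k] A) :
    Q.ω₄ (P * shift k A T) = Q.ω₄ P * T := by
  induction P using pure_induction₄ with
  | add x y hx hy => simp only [map_add, add_mul, hx, hy]
  | tmul x y z w =>
  induction T using pure_induction₃ with
  | add x y hx hy => simp only [map_add, mul_add, hx, hy]
  | tmul a b c => simp [mul_assoc]

lemma onRight_mul_shiftTwo_mul_α :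
    onRight Q.Δ Q.R * shiftTwo k A Q.R * 1 ⊗ₜ Q.α = Q.ω₄ (onThird Q.Δ Q.Ψ * onFirst Q.Δ Q.Ψ) := by
  have h (T : (A ⊗[k] A) ⊗[k] A) : onRight Q.Δ Q.R * shiftTwo k A (Q.ω T) =
      Q.ω₄ (onThird Q.Δ Q.Ψ * onFirst Q.Δ T) := by
    induction T using pure_induction₃ with
    | add x y hx hy => simp only [map_add, mul_add, hx, hy]
    | tmul a b c =>
    have e : sandwich (Q.Δ.toLinearMap ∘ₗ Q.s) Q.R (inL k A).toLinearMap (Q.Δ a) * 1 ⊗ₜ Q.α =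
        Q.ω (Q.Ψ * Q.Δ a ⊗ₜ 1) := by
      rw [ω_mul_inL₂, ← R_mul_α]
      induction Q.Δ a using pure_induction₂ with
      | add x y hx hy => simp only [map_add, add_mul, hx, hy]
      | tmul x y => simp [mul_assoc]
    have e' : onThird Q.Δ (Q.Δ a ⊗ₜ 1) = (Q.Δ a ⊗ₜ 1) ⊗ₜ 1 := by
      rw [onThird_tmul, map_one]; rfl
    have e'' : onFirst Q.Δ ((a ⊗ₜ b) ⊗ₜ c) =
        (Q.Δ a ⊗ₜ 1) ⊗ₜ 1 * shift k A (((1 : A) ⊗ₜ b) ⊗ₜ c) := by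
      simp [← Algebra.TensorProduct.one_def]
    have e3 : Q.ω ((a ⊗ₜ b) ⊗ₜ c) = Q.Δ (Q.s a) * Q.Δ Q.α * b ⊗ₜ c := Q.ω_tmul a b c
    rw [e3, e'', ← mul_assoc, ← e', ← map_mul (onThird Q.Δ), ω₄_mul, ← onRight_ω, ← e, ← R_mul_s]
    simp only [map_mul, onRight_one_tmul, mul_assoc]
    rfl
  have e : (1 : A ⊗[k] A) ⊗ₜ[k] Q.α = shiftTwo k A (1 ⊗ₜ Q.α) := rfl
  rw [← h, mul_assoc, e, ← map_mul, R_mul_α]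

lemma Ψ_mul_υ_mul_α : Q.Ψ * Q.υ Q.Ψ * 1 ⊗ₜ Q.α =
    Q.ω₄ (shift k A Q.Ψ * (onSecond Q.Δ Q.Ψ * Q.Ψ ⊗ₜ[k] 1)) := by
  have h1 (T : (A ⊗[k] A) ⊗[k] A) (y z : A) (d : A ⊗[k] A) :
      Q.ω₄ (shift k A T * ((Algebra.TensorProduct.assoc k k k A A A).symm (y ⊗ₜ d)) ⊗ₜ z) =
        onRight Q.Δ (Q.Δ (Q.s y)) * onRight Q.Δ (Q.Δ Q.α) * T * d ⊗ₜ z := by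
    induction T using pure_induction₃ with
    | add x y hx hy => simp only [map_add, add_mul, mul_add, hx, hy]
    | tmul a b c =>
    induction d using pure_induction₂ with
    | add x y hx hy =>
      simp only [map_add, mul_add, TensorProduct.tmul_add, TensorProduct.add_tmul, hx, hy]
    | tmul e f => simp [mul_assoc]
  have h2 (T : (A ⊗[k] A) ⊗[k] A) :
      Q.Ψ * onLeft Q.Δ (Q.ω T) = Q.ω₄ (shift k A Q.Ψ * onSecond Q.Δ T) := by
    induction T using pure_induction₃ with
    | add x y hx hy => simp only [map_add, mul_add, hx, hy]
    | tmul a b c =>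
      rw [onSecond_tmul, onRight_tmul, h1, ω_tmul]
      simp only [map_mul (onLeft Q.Δ)]
      rw [← mul_assoc, ← mul_assoc, Ψ_Δ, mul_assoc _ Q.Ψ, Ψ_Δ, ← mul_assoc, onLeft_tmul]
  have h3 (T : (A ⊗[k] A) ⊗[k] A) : Q.Ψ * Q.υ T * 1 ⊗ₜ Q.α =
      Q.ω₄ (shift k A Q.Ψ * (onSecond Q.Δ Q.Ψ * T ⊗ₜ[k] 1)) := by
    induction T using pure_induction₃ with
    | add x y hx hy => simp only [map_add, TensorProduct.add_tmul, add_mul, mul_add, hx, hy]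
    | tmul a b c =>
    have e : onLeft Q.Δ (1 ⊗ₜ Q.α) = (1 : A ⊗[k] A) ⊗ₜ[k] Q.α := by
      rw [onLeft_tmul, map_one]
    have e' : onSecond Q.Δ ((a ⊗ₜ 1) ⊗ₜ 1) = ((a ⊗ₜ 1) ⊗ₜ 1) ⊗ₜ 1 := by
      rw [onSecond_tmul, onRight_tmul, map_one]; rfl
    have e'' : ((a ⊗ₜ[k] b) ⊗ₜ[k] c) ⊗ₜ[k] (1 : A) =
        onSecond Q.Δ ((a ⊗ₜ 1) ⊗ₜ 1) * shift k A ((b ⊗ₜ c) ⊗ₜ 1) := by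
      simp [e']
    have e3 : Q.υ ((a ⊗ₜ b) ⊗ₜ c) * 1 ⊗ₜ Q.α =
        onLeft Q.Δ (Q.Δ (Q.s a) * (Q.R * 1 ⊗ₜ Q.α)) * (b ⊗ₜ c) ⊗ₜ 1 := by
      rw [map_mul, map_mul, e]
      simp [mul_assoc]
    have e4 : Q.Δ (Q.s a) * Q.ω Q.Ψ = Q.ω (Q.Ψ * (a ⊗ₜ 1) ⊗ₜ 1) := by
      rw [ω_mul_tmul_one, ← Algebra.TensorProduct.one_def, mul_one]
    rw [mul_assoc, e3, R_mul_α, e4, ← mul_assoc, h2, ← ω₄_mul, e'', map_mul (onSecond Q.Δ)]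
    simp only [mul_assoc]
  exact h3 Q.Ψ

/-- Associativity of the action of `H` on `*H`. -/
theorem onRight_R_mul : onRight Q.Δ Q.R * shiftTwo k A Q.R = Q.Ψ * Q.υ Q.Ψ :=
  Q.eq_of_mul_α_eq (fun a X ↦ Q.conjS X (onLeft Q.Δ (Q.Δ a))) (fun _ _ _ ↦ Q.conjS_mul _ _ _)
    Q.onRight_mul_shiftTwo_mul_s Q.Ψ_mul_υ_mul_s
    (by rw [onRight_mul_shiftTwo_mul_α, Ψ_mul_υ_mul_α, Ψ_pentagon])

end QuasiHopf

namespace TensorLegs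

variable (k A : Type*) [CommRing k] [Ring A] [Algebra k A]

/-- `A ⊗ A → Aᵐᵒᵖ ⊗ Aᵐᵒᵖ` -/
def op₂ : A ⊗[k] A ≃ₗ[k] Aᵐᵒᵖ ⊗[k] Aᵐᵒᵖ :=
  TensorProduct.congr (MulOpposite.opLinearEquiv k) (MulOpposite.opLinearEquiv k)

/-- `A ⊗ A ⊗ A → Aᵐᵒᵖ ⊗ Aᵐᵒᵖ ⊗ Aᵐᵒᵖ` -/
def op₃ : (A ⊗[k] A) ⊗[k] A ≃ₗ[k] (Aᵐᵒᵖ ⊗[k] Aᵐᵒᵖ) ⊗[k] Aᵐᵒᵖ :=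
  TensorProduct.congr (op₂ k A) (MulOpposite.opLinearEquiv k)

/-- `A ⊗ A ⊗ A ⊗ A → Aᵐᵒᵖ ⊗ Aᵐᵒᵖ ⊗ Aᵐᵒᵖ ⊗ Aᵐᵒᵖ` -/
def op₄ : ((A ⊗[k] A) ⊗[k] A) ⊗[k] A ≃ₗ[k] ((Aᵐᵒᵖ ⊗[k] Aᵐᵒᵖ) ⊗[k] Aᵐᵒᵖ) ⊗[k] Aᵐᵒᵖ :=
  TensorProduct.congr (op₃ k A) (MulOpposite.opLinearEquiv k)

variable {k A}

@[simp] lemma op₂_tmul (a b : A) : op₂ k A (a ⊗ₜ b) = MulOpposite.op a ⊗ₜ MulOpposite.op b := rfl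
@[simp] lemma op₃_tmul (t : A ⊗[k] A) (b : A) :
    op₃ k A (t ⊗ₜ b) = op₂ k A t ⊗ₜ MulOpposite.op b := rfl
@[simp] lemma op₄_tmul (t : (A ⊗[k] A) ⊗[k] A) (b : A) :
    op₄ k A (t ⊗ₜ b) = op₃ k A t ⊗ₜ MulOpposite.op b := rfl

@[simp] lemma op₂_one : op₂ k A 1 = 1 := rfl
@[simp] lemma op₃_one : op₃ k A 1 = 1 := rfl

lemma op₂_mul (x y : A ⊗[k] A) : op₂ k A (x * y) = op₂ k A y * op₂ k A x := by
  induction x using pure_induction₂ with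
  | add x y hx hy => simp only [add_mul, mul_add, map_add, hx, hy]
  | tmul a b =>
  induction y using pure_induction₂ with
  | add x y hx hy => simp only [add_mul, mul_add, map_add, hx, hy]
  | tmul c d => simp

lemma op₃_mul (x y : (A ⊗[k] A) ⊗[k] A) : op₃ k A (x * y) = op₃ k A y * op₃ k A x := by
  induction x using pure_induction₂ with
  | add x y hx hy => simp only [add_mul, mul_add, map_add, hx, hy]
  | tmul a b =>
  induction y using pure_induction₂ with
  | add x y hx hy => simp only [add_mul, mul_add, map_add, hx, hy]
  | tmul c d => simp [op₂_mul]

lemma op₄_mul (x y : ((A ⊗[k] A) ⊗[k] A) ⊗[k] A) :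
    op₄ k A (x * y) = op₄ k A y * op₄ k A x := by
  induction x using pure_induction₂ with
  | add x y hx hy => simp only [add_mul, mul_add, map_add, hx, hy]
  | tmul a b =>
  induction y using pure_induction₂ with
  | add x y hx hy => simp only [add_mul, mul_add, map_add, hx, hy]
  | tmul c d => simp [op₃_mul]

/-- The map `Aᵐᵒᵖ → Aᵐᵒᵖ ⊗ Aᵐᵒᵖ` given by `D`. -/
def opComul (D : A →ₐ[k] A ⊗[k] A) : Aᵐᵒᵖ →ₐ[k] Aᵐᵒᵖ ⊗[k] Aᵐᵒᵖ :=
  AlgHom.ofLinearMap ((op₂ k A).toLinearMap ∘ₗ D.toLinearMap ∘ₗ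
    (MulOpposite.opLinearEquiv k).symm.toLinearMap) (by simp) (by simp [op₂_mul])

/-- The map `Aᵐᵒᵖ → k` given by `e`. -/
def opCounit (e : A →ₐ[k] k) : Aᵐᵒᵖ →ₐ[k] k :=
  AlgHom.ofLinearMap (e.toLinearMap ∘ₗ (MulOpposite.opLinearEquiv k).symm.toLinearMap)
    (by simp) (by simp [mul_comm])

/-- The map `Aᵐᵒᵖ → Aᵐᵒᵖ` given by `s`. -/
def opMap (s : A →ₗ[k] A) : Aᵐᵒᵖ →ₗ[k] Aᵐᵒᵖ :=
  (MulOpposite.opLinearEquiv k).toLinearMap ∘ₗ s ∘ₗ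
    (MulOpposite.opLinearEquiv k).symm.toLinearMap

variable (D : A →ₐ[k] A ⊗[k] A) (e : A →ₐ[k] k) (s : A →ₗ[k] A)

@[simp] lemma opComul_op (a : A) : opComul D (MulOpposite.op a) = op₂ k A (D a) := rfl
@[simp] lemma opCounit_op (a : A) : opCounit e (MulOpposite.op a) = e a := rfl
@[simp] lemma opMap_op (a : A) : opMap s (MulOpposite.op a) = MulOpposite.op (s a) := rfl

lemma op₃_assoc_symm (a : A) (t : A ⊗[k] A) :
    op₃ k A ((Algebra.TensorProduct.assoc k k k A A A).symm (a ⊗ₜ t)) =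
      (Algebra.TensorProduct.assoc k k k _ _ _).symm (MulOpposite.op a ⊗ₜ op₂ k A t) := by
  induction t using pure_induction₂ with
  | add x y hx hy => simp only [TensorProduct.tmul_add, map_add, hx, hy]
  | tmul a b => simp

lemma op₄_assoc_symm (a t : A ⊗[k] A) :
    op₄ k A ((Algebra.TensorProduct.assoc k k k (A ⊗[k] A) A A).symm (a ⊗ₜ t)) =
      (Algebra.TensorProduct.assoc k k k (Aᵐᵒᵖ ⊗[k] Aᵐᵒᵖ) _ _).symm (op₂ k A a ⊗ₜ op₂ k A t) := by
  induction t using pure_induction₂ with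
  | add x y hx hy => simp only [TensorProduct.tmul_add, map_add, hx, hy]
  | tmul a b => simp

lemma onLeft_op₂ (t : A ⊗[k] A) : onLeft (opComul D) (op₂ k A t) = op₃ k A (onLeft D t) := by
  induction t using pure_induction₂ with
  | add x y hx hy => simp only [map_add, hx, hy]
  | tmul a b => simp

lemma onRight_op₂ (t : A ⊗[k] A) : onRight (opComul D) (op₂ k A t) = op₃ k A (onRight D t) := by
  induction t using pure_induction₂ with
  | add x y hx hy => simp only [map_add, hx, hy]
  | tmul a b => simp [op₃_assoc_symm]

lemma onFirst_op₃ (t : (A ⊗[k] A) ⊗[k] A) :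
    onFirst (opComul D) (op₃ k A t) = op₄ k A (onFirst D t) := by
  induction t using pure_induction₂ with
  | add x y hx hy => simp only [map_add, hx, hy]
  | tmul a b => simp [onLeft_op₂]

lemma onSecond_op₃ (t : (A ⊗[k] A) ⊗[k] A) :
    onSecond (opComul D) (op₃ k A t) = op₄ k A (onSecond D t) := by
  induction t using pure_induction₂ with
  | add x y hx hy => simp only [map_add, hx, hy]
  | tmul a b => simp [onRight_op₂]

lemma onThird_op₃ (t : (A ⊗[k] A) ⊗[k] A) :
    onThird (opComul D) (op₃ k A t) = op₄ k A (onThird D t) := by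
  induction t using pure_induction₂ with
  | add x y hx hy => simp only [map_add, hx, hy]
  | tmul a b => simp [op₄_assoc_symm]

lemma shift_op₃ (t : (A ⊗[k] A) ⊗[k] A) : shift k Aᵐᵒᵖ (op₃ k A t) = op₄ k A (shift k A t) := by
  induction t using pure_induction₃ with
  | add x y hx hy => simp only [map_add, hx, hy]
  | tmul a b => simp

lemma shiftTwo_op₂ (t : A ⊗[k] A) :
    shiftTwo k Aᵐᵒᵖ (op₂ k A t) = op₃ k A (shiftTwo k A t) := by
  induction t using pure_induction₂ with
  | add x y hx hy => simp only [map_add, hx, hy]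
  | tmul a b => simp

lemma killLeft_op₂ (t : A ⊗[k] A) :
    killLeft (opCounit e) (op₂ k A t) = MulOpposite.op (killLeft e t) := by
  induction t using pure_induction₂ with
  | add x y hx hy => simp only [map_add, hx, hy, MulOpposite.op_add]
  | tmul a b => simp

lemma killRight_op₂ (t : A ⊗[k] A) :
    killRight (opCounit e) (op₂ k A t) = MulOpposite.op (killRight e t) := by
  induction t using pure_induction₂ with
  | add x y hx hy => simp only [map_add, hx, hy, MulOpposite.op_add]
  | tmul a b => simp

lemma killSecond_op₃ (t : (A ⊗[k] A) ⊗[k] A) :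
    killSecond (opCounit e) (op₃ k A t) = op₂ k A (killSecond e t) := by
  induction t using pure_induction₂ with
  | add x y hx hy => simp only [map_add, hx, hy]
  | tmul a b => simp [killRight_op₂]

end TensorLegs

namespace QuasiHopf

variable {k A : Type*} [Field k] [Ring A] [Algebra k A] (Q : QuasiHopf k A)
  (s' : A →ₗ[k] A) (h : ∀ a, s' (Q.s a) = a) (h' : ∀ a, Q.s (s' a) = a)

lemma inv_s_mul (h : ∀ a, s' (Q.s a) = a) (h' : ∀ a, Q.s (s' a) = a) (a b : A) : s' (a * b) = s' b * s' a := by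
  rw [← h (s' b * s' a), Q.s_mul, h', h']

/-- The opposite of a quasi-Hopf algebra with invertible antipode. -/
def op : QuasiHopf k Aᵐᵒᵖ where
  Δ := opComul Q.Δ
  ε := opCounit Q.ε
  Φ := op₃ k A Q.Ψ
  Ψ := op₃ k A Q.Φ
  Φ_mul_Ψ := by rw [← op₃_mul, Q.Φ_mul_Ψ, op₃_one]
  Ψ_mul_Φ := by rw [← op₃_mul, Q.Ψ_mul_Φ, op₃_one]
  killLeft_Δ a := by
    obtain ⟨a, rfl⟩ := MulOpposite.op_surjective a
    simp [killLeft_op₂]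
  killRight_Δ a := by
    obtain ⟨a, rfl⟩ := MulOpposite.op_surjective a
    simp [killRight_op₂]
  Δ_Φ a := by
    obtain ⟨a, rfl⟩ := MulOpposite.op_surjective a
    rw [opComul_op, onLeft_op₂, onRight_op₂, ← op₃_mul, ← op₃_mul, Ψ_Δ]
  pentagon := by
    have : op₃ k A Q.Ψ ⊗ₜ[k] (1 : Aᵐᵒᵖ) = op₄ k A (Q.Ψ ⊗ₜ 1) := rfl
    rw [onFirst_op₃, onThird_op₃, onSecond_op₃, shift_op₃, this, ← op₄_mul, ← op₄_mul,
      ← op₄_mul, Ψ_pentagon, mul_assoc]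
  killSecond_Φ := by rw [killSecond_op₃, killSecond_Ψ, op₂_one]
  s := opMap s'
  s_one := by
    have := h 1
    rw [Q.s_one] at this
    rw [← MulOpposite.op_one, opMap_op, this]
  s_mul a b := by
    obtain ⟨a, rfl⟩ := MulOpposite.op_surjective a
    obtain ⟨b, rfl⟩ := MulOpposite.op_surjective b
    simp [← MulOpposite.op_mul, Q.inv_s_mul s' h h']
  α := MulOpposite.op (s' Q.β)
  β := MulOpposite.op (s' Q.α)
  s_α a := by
    obtain ⟨a, rfl⟩ := MulOpposite.op_surjective a
    have key (t : A ⊗[k] A) : sandwich (opMap s') (MulOpposite.op (s' Q.β)) LinearMap.id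
        (op₂ k A t) = MulOpposite.op (s' (sandwich LinearMap.id Q.β Q.s t)) := by
      induction t using pure_induction₂ with
      | add x y hx hy => simp only [map_add, hx, hy, MulOpposite.op_add]
      | tmul a b => simp [Q.inv_s_mul s' h h', h, ← MulOpposite.op_mul]
    rw [opComul_op, key, Q.β_s]
    simp
  β_s a := by
    obtain ⟨a, rfl⟩ := MulOpposite.op_surjective a
    have key (t : A ⊗[k] A) : sandwich LinearMap.id (MulOpposite.op (s' Q.α)) (opMap s')
        (op₂ k A t) = MulOpposite.op (s' (sandwich Q.s Q.α LinearMap.id t)) := by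
      induction t using pure_induction₂ with
      | add x y hx hy => simp only [map_add, hx, hy, MulOpposite.op_add]
      | tmul a b => simp [Q.inv_s_mul s' h h', h, ← MulOpposite.op_mul]
    rw [opComul_op, key, Q.s_α]
    simp
  Φ_s := by
    have key (t : (A ⊗[k] A) ⊗[k] A) : sandwich
        (sandwich (opMap s') (MulOpposite.op (s' Q.β)) LinearMap.id)
        (MulOpposite.op (s' Q.α)) (opMap s') (op₃ k A t) =
        MulOpposite.op (s' (sandwich (sandwich LinearMap.id Q.β Q.s) Q.α LinearMap.id t)) := by
      induction t using pure_induction₃ with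
      | add x y hx hy => simp only [map_add, hx, hy, MulOpposite.op_add]
      | tmul a b c => simp [Q.inv_s_mul s' h h', h, ← MulOpposite.op_mul, mul_assoc]
    have h1 := h 1
    rw [Q.s_one] at h1
    rw [key, Q.Ψ_s, h1, MulOpposite.op_one]
  Ψ_s := by
    have key (t : (A ⊗[k] A) ⊗[k] A) : sandwich
        (sandwich LinearMap.id (MulOpposite.op (s' Q.α)) (opMap s'))
        (MulOpposite.op (s' Q.β)) LinearMap.id (op₃ k A t) =
        MulOpposite.op (s' (sandwich (sandwich Q.s Q.α LinearMap.id) Q.β Q.s t)) := by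
      induction t using pure_induction₃ with
      | add x y hx hy => simp only [map_add, hx, hy, MulOpposite.op_add]
      | tmul a b c => simp [Q.inv_s_mul s' h h', h, ← MulOpposite.op_mul, mul_assoc]
    have h1 := h 1
    rw [Q.s_one] at h1
    rw [key, Q.Φ_s, h1, MulOpposite.op_one]

end QuasiHopf

/-! ### The convolution algebra of functionals -/

/-- The convolution algebra of functionals on a coalgebra. -/
abbrev ConvDual (k C : Type*) [Field k] [AddCommGroup C] [Module k C] : Type _ :=
  WithConv (C →ₗ[k] k)

namespace ConvDual

open WithConv Coalgebra

variable {k C D : Type*} [Field k] [AddCommGroup C] [Module k C] [Coalgebra k C]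
  [AddCommGroup D] [Module k D] [Coalgebra k D]

lemma toConv_mul_toConv_eq_convLeft (f g : C →ₗ[k] k) :
    toConv f * toConv g = toConv (convLeft f g) := by
  rw [LinearMap.convMul_def]
  congr 1

lemma toConv_mul_toConv_eq_convRight (f g : C →ₗ[k] k) :
    toConv f * toConv g = toConv (convRight f g) := by
  rw [LinearMap.convMul_def]
  congr 1
  ext c
  simp only [convRight, LinearMap.comp_apply]
  induction comul (R := k) c using pure_induction₂ with
  | add x y hx hy => simp only [map_add, hx, hy]
  | tmul a b => simp [mul_comm]

lemma comp_convLeft {V W : Type*} [AddCommGroup V] [Module k V] [AddCommGroup W] [Module k W]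
    (h : V →ₗ[k] W) (g : C →ₗ[k] k) (f : C →ₗ[k] V) :
    h ∘ₗ convLeft g f = convLeft g (h ∘ₗ f) := by
  ext c
  simp only [convLeft, LinearMap.comp_apply, LinearEquiv.coe_coe]
  induction comul (R := k) c using pure_induction₂ with
  | add x y hx hy => simp only [map_add, hx, hy]
  | tmul a b => simp

lemma comp_convRight {V W : Type*} [AddCommGroup V] [Module k V] [AddCommGroup W] [Module k W]
    (h : V →ₗ[k] W) (f : C →ₗ[k] V) (g : C →ₗ[k] k) :
    h ∘ₗ convRight f g = convRight (h ∘ₗ f) g := by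
  ext c
  simp only [convRight, LinearMap.comp_apply, LinearEquiv.coe_coe]
  induction comul (R := k) c using pure_induction₂ with
  | add x y hx hy => simp only [map_add, hx, hy]
  | tmul a b => simp

lemma mul_apply_eq (f g : ConvDual k C) (c : C) :
    (f * g) c = LinearMap.mul' k k (TensorProduct.map f.ofConv g.ofConv (comul c)) := rfl

/-- Precomposition with a coalgebra morphism. -/
def comap (F : C →ₗc[k] D) : ConvDual k D →ₐ[k] ConvDual k C :=
  AlgHom.ofLinearMap
    ((WithConv.linearEquiv k (C →ₗ[k] k)).symm.toLinearMap ∘ₗ LinearMap.lcomp k k F.toLinearMap ∘ₗ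
      (WithConv.linearEquiv k (D →ₗ[k] k)).toLinearMap)
    (by
      ext c
      simp [LinearMap.convOne_def])
    (fun f g ↦ by
      have := LinearMap.convMul_comp_coalgHom_distrib f g F
      exact congrArg toConv this)

@[simp] lemma comap_apply (F : C →ₗc[k] D) (f : ConvDual k D) (c : C) :
    comap F f c = f (F c) := rfl

/-- `C^* ⊗ D^* ≅ (C ⊗ D)^*` as linear spaces. -/
def pairLinear {k C D : Type*} [Field k] [AddCommGroup C] [Module k C] [AddCommGroup D]
    [Module k D] [FiniteDimensional k C] [FiniteDimensional k D] : ConvDual k C ⊗[k] ConvDual k D ≃ₗ[k] ConvDual k (C ⊗[k] D) :=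
  (TensorProduct.congr (WithConv.linearEquiv k (C →ₗ[k] k))
      (WithConv.linearEquiv k (D →ₗ[k] k))).trans
    ((TensorProduct.dualDistribEquiv k C D).trans
      (WithConv.linearEquiv k (C ⊗[k] D →ₗ[k] k)).symm)

lemma pairLinear_tmul {k C D : Type*} [Field k] [AddCommGroup C] [Module k C] [AddCommGroup D]
    [Module k D] [FiniteDimensional k C] [FiniteDimensional k D] (f : ConvDual k C) (g : ConvDual k D) (c : C) (d : D) :
    pairLinear (f ⊗ₜ g) (c ⊗ₜ d) = f c * g d := rfl

variable [FiniteDimensional k C] [FiniteDimensional k D]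

variable (k C D) in
/-- `C^* ⊗ D^* ≅ (C ⊗ D)^*` as convolution algebras. -/
def pair : ConvDual k C ⊗[k] ConvDual k D ≃ₐ[k] ConvDual k (C ⊗[k] D) :=
  Algebra.TensorProduct.algEquivOfLinearEquivTensorProduct pairLinear
    (fun f f' g g' ↦ by
      refine ofConv_injective (TensorProduct.ext' fun c d ↦ ?_)
      rw [pairLinear_tmul, mul_apply_eq, mul_apply_eq, mul_apply_eq, TensorProduct.comul_tmul]
      induction comul (R := k) c using pure_induction₂ with
      | add x y hx hy => simp only [TensorProduct.add_tmul, map_add, add_mul, hx, hy]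
      | tmul x y =>
      induction comul (R := k) d using pure_induction₂ with
      | add x y hx hy => simp only [TensorProduct.tmul_add, map_add, mul_add, hx, hy]
      | tmul z w =>
        simp only [TensorProduct.AlgebraTensorModule.tensorTensorTensorComm_tmul,
          TensorProduct.map_tmul, LinearMap.mul'_apply]
        erw [pairLinear_tmul, pairLinear_tmul]
        ring)
    (by
      refine ofConv_injective (TensorProduct.ext' fun c d ↦ ?_)
      rw [pairLinear_tmul]
      simp [mul_comm])

@[simp] lemma pair_tmul (f : ConvDual k C) (g : ConvDual k D) (c : C) (d : D) :
    pair k C D (f ⊗ₜ g) (c ⊗ₜ d) = f c * g d := rfl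

variable (k C) in
/-- `C^* ⊗ C^* ⊗ C^* ≅ (C ⊗ C ⊗ C)^*` as convolution algebras. -/
def pair₃ : (ConvDual k C ⊗[k] ConvDual k C) ⊗[k] ConvDual k C ≃ₐ[k]
    ConvDual k ((C ⊗[k] C) ⊗[k] C) :=
  (Algebra.TensorProduct.congr (pair k C C) AlgEquiv.refl).trans (pair k _ C)

variable (k C) in
/-- `C^* ⊗ C^* ⊗ C^* ⊗ C^* ≅ (C ⊗ C ⊗ C ⊗ C)^*` as convolution algebras. -/
def pair₄ : ((ConvDual k C ⊗[k] ConvDual k C) ⊗[k] ConvDual k C) ⊗[k] ConvDual k C ≃ₐ[k]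
    ConvDual k (((C ⊗[k] C) ⊗[k] C) ⊗[k] C) :=
  (Algebra.TensorProduct.congr (pair₃ k C) AlgEquiv.refl).trans (pair k _ C)

@[simp] lemma pair₃_tmul (t : ConvDual k C ⊗[k] ConvDual k C) (g : ConvDual k C)
    (u : C ⊗[k] C) (c : C) : pair₃ k C (t ⊗ₜ g) (u ⊗ₜ c) = pair k C C t u * g c := rfl

@[simp] lemma pair₄_tmul (t : (ConvDual k C ⊗[k] ConvDual k C) ⊗[k] ConvDual k C)
    (g : ConvDual k C) (u : (C ⊗[k] C) ⊗[k] C) (c : C) :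
    pair₄ k C (t ⊗ₜ g) (u ⊗ₜ c) = pair₃ k C t u * g c := rfl

lemma pair₄_mul (x y : ((ConvDual k C ⊗[k] ConvDual k C) ⊗[k] ConvDual k C) ⊗[k] ConvDual k C) :
    pair₄ k C (x * y) = pair₄ k C x * pair₄ k C y :=
  (pair₄ k C).map_mul' x y

end ConvDual

open ConvDual

namespace CoquasiBialgebra

open WithConv Coalgebra

variable {k H : Type*} [Field k] [AddCommGroup H] [Module k H] [Coalgebra k H]
  (B : CoquasiBialgebra k H)

/-- Evaluation of functionals at `1`. -/
def dualCounit : ConvDual k H →ₐ[k] k :=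
  AlgHom.ofLinearMap (LinearMap.applyₗ (B.unit 1) ∘ₗ
      (WithConv.linearEquiv k (H →ₗ[k] k)).toLinearMap)
    (by
      simp)
    (fun f g ↦ by
      have : comul (R := k) (B.unit 1) = B.unit 1 ⊗ₜ[k] B.unit 1 := by
        rw [← CoalgHomClass.map_comp_comul_apply]
        simp
      simp [this])

@[simp] lemma dualCounit_apply (f : ConvDual k H) : B.dualCounit f = f (B.unit 1) := rfl

variable [FiniteDimensional k H]

/-- The map `f ↦ f ∘ p` into `H^* ⊗ H^*`. -/
def dualComul : ConvDual k H →ₐ[k] ConvDual k H ⊗[k] ConvDual k H :=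
  (pair k H H).symm.toAlgHom.comp (comap B.mul)

lemma pair_dualComul (f : ConvDual k H) (t : H ⊗[k] H) :
    pair k H H (B.dualComul f) t = f (B.mul t) := by
  have : pair k H H (B.dualComul f) = comap B.mul f := (pair k H H).apply_symm_apply _
  rw [this, comap_apply]

@[ext] lemma _root_.ConvDual.ext {k C : Type*} [Field k] [AddCommGroup C] [Module k C]
    {f g : ConvDual k C} (h : ∀ c, f c = g c) : f = g :=
  ofConv_injective (LinearMap.ext h)

lemma pair_killLeft (t : ConvDual k H ⊗[k] ConvDual k H) (x : H) :
    killLeft B.dualCounit t x = pair k H H t (B.unit 1 ⊗ₜ x) := by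
  induction t using pure_induction₂ with
  | add x y hx hy => simp only [map_add, WithConv.ofConv_add, LinearMap.add_apply, hx, hy]
  | tmul f g => simp

lemma pair_killRight (t : ConvDual k H ⊗[k] ConvDual k H) (x : H) :
    killRight B.dualCounit t x = pair k H H t (x ⊗ₜ B.unit 1) := by
  induction t using pure_induction₂ with
  | add x y hx hy => simp only [map_add, WithConv.ofConv_add, LinearMap.add_apply, hx, hy]
  | tmul f g => simp [mul_comm]

lemma pair₃_assoc_symm (f : ConvDual k H) (t : ConvDual k H ⊗[k] ConvDual k H) (x y z : H) :
    pair₃ k H ((Algebra.TensorProduct.assoc k k k _ _ _).symm (f ⊗ₜ t)) ((x ⊗ₜ y) ⊗ₜ z) =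
      f x * pair k H H t (y ⊗ₜ z) := by
  induction t using pure_induction₂ with
  | add x y hx hy =>
    simp only [TensorProduct.tmul_add, map_add, WithConv.ofConv_add, LinearMap.add_apply, hx, hy,
      mul_add]
  | tmul f g => simp [mul_assoc]

lemma pair₄_assoc_symm (s t : ConvDual k H ⊗[k] ConvDual k H) (u : H ⊗[k] H) (y z : H) :
    pair₄ k H ((Algebra.TensorProduct.assoc k k k (ConvDual k H ⊗[k] ConvDual k H) _ _).symm
      (s ⊗ₜ t)) ((u ⊗ₜ y) ⊗ₜ z) = pair k H H s u * pair k H H t (y ⊗ₜ z) := by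
  induction t using pure_induction₂ with
  | add x y hx hy =>
    simp only [TensorProduct.tmul_add, map_add, WithConv.ofConv_add, LinearMap.add_apply,
      hx, hy,
      mul_add]
  | tmul f g => simp [mul_assoc]

lemma pair₃_onLeft (t : ConvDual k H ⊗[k] ConvDual k H) (u : H ⊗[k] H) (z : H) :
    pair₃ k H (onLeft B.dualComul t) (u ⊗ₜ z) = pair k H H t (B.mul u ⊗ₜ z) := by
  induction t using pure_induction₂ with
  | add x y hx hy => simp only [map_add, WithConv.ofConv_add, LinearMap.add_apply, hx, hy]
  | tmul f g => simp [pair_dualComul]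

lemma pair₃_onRight (t : ConvDual k H ⊗[k] ConvDual k H) (x y z : H) :
    pair₃ k H (onRight B.dualComul t) ((x ⊗ₜ y) ⊗ₜ z) =
      pair k H H t (x ⊗ₜ B.mul (y ⊗ₜ z)) := by
  induction t using pure_induction₂ with
  | add x y hx hy => simp only [map_add, WithConv.ofConv_add, LinearMap.add_apply, hx, hy]
  | tmul f g => simp [pair_dualComul, pair₃_assoc_symm]

lemma pair₄_onFirst (t : (ConvDual k H ⊗[k] ConvDual k H) ⊗[k] ConvDual k H)
    (u : H ⊗[k] H) (y z : H) :
    pair₄ k H (onFirst B.dualComul t) ((u ⊗ₜ y) ⊗ₜ z) =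
      pair₃ k H t ((B.mul u ⊗ₜ y) ⊗ₜ z) := by
  induction t using pure_induction₂ with
  | add x y hx hy => simp only [map_add, WithConv.ofConv_add, LinearMap.add_apply, hx, hy]
  | tmul f g => simp [pair₃_onLeft]

lemma pair₄_onSecond (t : (ConvDual k H ⊗[k] ConvDual k H) ⊗[k] ConvDual k H)
    (w x y z : H) :
    pair₄ k H (onSecond B.dualComul t) (((w ⊗ₜ x) ⊗ₜ y) ⊗ₜ z) =
      pair₃ k H t ((w ⊗ₜ B.mul (x ⊗ₜ y)) ⊗ₜ z) := by
  induction t using pure_induction₂ with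
  | add x y hx hy => simp only [map_add, WithConv.ofConv_add, LinearMap.add_apply, hx, hy]
  | tmul f g => simp [pair₃_onRight, -onRight_tmul]

lemma pair₄_onThird (t : (ConvDual k H ⊗[k] ConvDual k H) ⊗[k] ConvDual k H)
    (u : H ⊗[k] H) (y z : H) :
    pair₄ k H (onThird B.dualComul t) ((u ⊗ₜ y) ⊗ₜ z) =
      pair₃ k H t (u ⊗ₜ B.mul (y ⊗ₜ z)) := by
  induction t using pure_induction₂ with
  | add x y hx hy => simp only [map_add, WithConv.ofConv_add, LinearMap.add_apply, hx, hy]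
  | tmul f g => simp [pair_dualComul, pair₄_assoc_symm]

lemma pair₄_shift (t : (ConvDual k H ⊗[k] ConvDual k H) ⊗[k] ConvDual k H)
    (w x y z : H) :
    pair₄ k H (shift k _ t) (((w ⊗ₜ x) ⊗ₜ y) ⊗ₜ z) =
      counit (R := k) w * pair₃ k H t ((x ⊗ₜ y) ⊗ₜ z) := by
  induction t using pure_induction₃ with
  | add x y hx hy => simp only [map_add, WithConv.ofConv_add, LinearMap.add_apply, hx, hy, mul_add]
  | tmul f g h => simp [mul_assoc]

lemma pair_killSecond (t : (ConvDual k H ⊗[k] ConvDual k H) ⊗[k] ConvDual k H) (x y : H) :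
    pair k H H (killSecond B.dualCounit t) (x ⊗ₜ y) =
      pair₃ k H t ((x ⊗ₜ B.unit 1) ⊗ₜ y) := by
  induction t using pure_induction₂ with
  | add x y hx hy => simp only [map_add, WithConv.ofConv_add, LinearMap.add_apply, hx, hy]
  | tmul f g => simp [pair_killRight]

/-- The associator as an element of `H^* ⊗ H^* ⊗ H^*`. -/
def dualPhi : (ConvDual k H ⊗[k] ConvDual k H) ⊗[k] ConvDual k H :=
  (pair₃ k H).symm (toConv B.phi)

/-- The inverse associator as an element of `H^* ⊗ H^* ⊗ H^*`. -/
def dualPhiInv : (ConvDual k H ⊗[k] ConvDual k H) ⊗[k] ConvDual k H :=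
  (pair₃ k H).symm (toConv B.phiInv)

@[simp] lemma pair₃_dualPhi : pair₃ k H B.dualPhi = toConv B.phi :=
  (pair₃ k H).apply_symm_apply _

@[simp] lemma pair₃_dualPhiInv : pair₃ k H B.dualPhiInv = toConv B.phiInv :=
  (pair₃ k H).apply_symm_apply _

lemma dualPhi_mul_dualPhiInv : B.dualPhi * B.dualPhiInv = 1 := by
  apply (pair₃ k H).injective
  rw [map_mul, pair₃_dualPhi, pair₃_dualPhiInv, toConv_mul_toConv_eq_convLeft, B.phi_conv_phiInv,
    map_one]
  rfl

lemma dualPhiInv_mul_dualPhi : B.dualPhiInv * B.dualPhi = 1 := by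
  apply (pair₃ k H).injective
  rw [map_mul, pair₃_dualPhi, pair₃_dualPhiInv, toConv_mul_toConv_eq_convLeft, B.phiInv_conv_phi,
    map_one]
  rfl

lemma dualComul_dualPhi (a : ConvDual k H) :
    onLeft B.dualComul (B.dualComul a) * B.dualPhi =
      B.dualPhi * onRight B.dualComul (B.dualComul a) := by
  apply (pair₃ k H).injective
  have h1 : pair₃ k H (onLeft B.dualComul (B.dualComul a)) =
      toConv (a.ofConv ∘ₗ (B.mul.toLinearMap ∘ₗ B.mul.toLinearMap.rTensor H)) := by
    refine ofConv_injective (TensorProduct.ext_threefold fun x y z ↦ ?_)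
    rw [pair₃_onLeft, pair_dualComul]
    rfl
  have h2 : pair₃ k H (onRight B.dualComul (B.dualComul a)) =
      toConv (a.ofConv ∘ₗ (B.mul.toLinearMap ∘ₗ B.mul.toLinearMap.lTensor H ∘ₗ
        (TensorProduct.assoc k H H H).toLinearMap)) := by
    refine ofConv_injective (TensorProduct.ext_threefold fun x y z ↦ ?_)
    rw [pair₃_onRight, pair_dualComul]
    rfl
  rw [map_mul, map_mul, h1, h2, pair₃_dualPhi, toConv_mul_toConv_eq_convRight,
    toConv_mul_toConv_eq_convLeft, ← comp_convLeft, ← comp_convRight, B.mul_assoc_phi]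

lemma dual_pentagon : onFirst B.dualComul B.dualPhi * onThird B.dualComul B.dualPhi =
    B.dualPhi ⊗ₜ[k] (1 : ConvDual k H) * (onSecond B.dualComul B.dualPhi * shift k _ B.dualPhi) := by
  apply (pair₄ k H).injective
  have h1 : pair₄ k H (onFirst B.dualComul B.dualPhi) =
      toConv (B.phi ∘ₗ (B.mul.toLinearMap.rTensor H).rTensor H) := by
    refine ofConv_injective (TensorProduct.ext_fourfold fun w x y z ↦ ?_)
    rw [pair₄_onFirst, pair₃_dualPhi]
    rfl
  have h2 : pair₄ k H (onThird B.dualComul B.dualPhi) =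
      toConv (B.phi ∘ₗ B.mul.toLinearMap.lTensor (H ⊗[k] H) ∘ₗ
          (TensorProduct.assoc k (H ⊗[k] H) H H).toLinearMap) := by
    refine ofConv_injective (TensorProduct.ext_fourfold fun w x y z ↦ ?_)
    rw [pair₄_onThird, pair₃_dualPhi]
    rfl
  have h3 : pair₄ k H (B.dualPhi ⊗ₜ[k] (1 : ConvDual k H)) = toConv (tensorCounit B.phi) := by
    refine ofConv_injective (TensorProduct.ext_fourfold fun w x y z ↦ ?_)
    rw [pair₄_tmul, pair₃_dualPhi]
    rfl
  have h4 : pair₄ k H (onSecond B.dualComul B.dualPhi) =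
      toConv (B.phi ∘ₗ (B.mul.toLinearMap.lTensor H ∘ₗ
            (TensorProduct.assoc k H H H).toLinearMap).rTensor H) := by
    refine ofConv_injective (TensorProduct.ext_fourfold fun w x y z ↦ ?_)
    rw [pair₄_onSecond, pair₃_dualPhi]
    rfl
  have h5 : pair₄ k H (shift k _ B.dualPhi) =
      toConv (counitTensor B.phi ∘ₗ (TensorProduct.assoc k H (H ⊗[k] H) H).toLinearMap ∘ₗ
            TensorProduct.map (TensorProduct.assoc k H H H).toLinearMap LinearMap.id) := by
    refine ofConv_injective (TensorProduct.ext_fourfold fun w x y z ↦ ?_)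
    rw [pair₄_shift, pair₃_dualPhi]
    rfl
  rw [pair₄_mul, pair₄_mul, pair₄_mul, h1, h2, h3, h4, h5]
  simp only [toConv_mul_toConv_eq_convLeft, B.pentagon]

lemma killSecond_dualPhi : killSecond B.dualCounit B.dualPhi = 1 := by
  apply (pair k H H).injective
  refine ofConv_injective (TensorProduct.ext' fun x y ↦ ?_)
  rw [pair_killSecond, pair₃_dualPhi, map_one (pair k H H)]
  exact (B.phi_one x y).trans (mul_comm _ _)

end CoquasiBialgebra

namespace ConvDual

open WithConv Coalgebra

variable {k H : Type*} [Field k] [AddCommGroup H] [Module k H]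

/-- Precomposition with a linear map. -/
def precomp (F : H →ₗ[k] H) : ConvDual k H →ₗ[k] ConvDual k H :=
  (WithConv.linearEquiv k (H →ₗ[k] k)).symm.toLinearMap ∘ₗ LinearMap.lcomp k k F ∘ₗ
    (WithConv.linearEquiv k (H →ₗ[k] k)).toLinearMap

@[simp] lemma precomp_apply (F : H →ₗ[k] H) (f : ConvDual k H) (x : H) :
    precomp F f x = f (F x) := rfl

lemma precomp_id : precomp (LinearMap.id : H →ₗ[k] H) = LinearMap.id := rfl

variable [Coalgebra k H]

lemma mulRight_comp_precomp (F : H →ₗ[k] H) (g : ConvDual k H) :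
    LinearMap.mulRight k g ∘ₗ precomp F = precomp (convRight F g.ofConv) := by
  refine LinearMap.ext fun f ↦ ?_
  refine (toConv_mul_toConv_eq_convRight (f.ofConv ∘ₗ F) g.ofConv).trans ?_
  rw [← comp_convRight]
  rfl

lemma mul_apply_of_comul (f g : ConvDual k H) (h : H) [FiniteDimensional k H] :
    (f * g) h = pair k H H (f ⊗ₜ g) (comul h) := by
  rw [mul_apply_eq]
  induction comul (R := k) h using pure_induction₂ with
  | add x y hx hy => simp only [map_add, hx, hy]
  | tmul a b => simp

variable [FiniteDimensional k H]

lemma mulMap_precomp_apply (F G : H →ₗ[k] H) (t : ConvDual k H ⊗[k] ConvDual k H) (h : H) :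
    mulMap (precomp F) (precomp G) t h =
      pair k H H t (TensorProduct.map F G (comul h)) := by
  induction t using pure_induction₂ with
  | add x y hx hy => simp only [map_add, WithConv.ofConv_add, LinearMap.add_apply, hx, hy]
  | tmul f g =>
    rw [mulMap_tmul, mul_apply_of_comul]
    induction comul (R := k) h using pure_induction₂ with
    | add x y hx hy => simp only [map_add, hx, hy]
    | tmul a b => simp

lemma sandwich_precomp_apply (F G : H →ₗ[k] H) (g : ConvDual k H)
    (t : ConvDual k H ⊗[k] ConvDual k H) (h : H) :
    sandwich (precomp F) g (precomp G) t h =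
      pair k H H t (TensorProduct.map (convRight F g.ofConv) G (comul h)) := by
  rw [sandwich, mulRight_comp_precomp, mulMap_precomp_apply]

lemma mulMap_mulMap_precomp_apply (F G K : H →ₗ[k] H)
    (t : (ConvDual k H ⊗[k] ConvDual k H) ⊗[k] ConvDual k H) (h : H) :
    mulMap (mulMap (precomp F) (precomp G)) (precomp K) t h =
      pair₃ k H t (TensorProduct.map (TensorProduct.map F G) K
        (comul.rTensor H (comul (R := k) h))) := by
  induction t using pure_induction₂ with
  | add x y hx hy => simp only [map_add, WithConv.ofConv_add, LinearMap.add_apply, hx, hy]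
  | tmul t g =>
    rw [mulMap_tmul, mul_apply_of_comul]
    induction comul (R := k) h using pure_induction₂ with
    | add x y hx hy => simp only [map_add, hx, hy]
    | tmul a b => simp [mulMap_precomp_apply]

lemma sandwich_sandwich_precomp_apply (F G K : H →ₗ[k] H) (f g : ConvDual k H)
    (t : (ConvDual k H ⊗[k] ConvDual k H) ⊗[k] ConvDual k H) (h : H) :
    sandwich (sandwich (precomp F) f (precomp G)) g (precomp K) t h =
      pair₃ k H t (TensorProduct.map
        (TensorProduct.map (convRight F f.ofConv) (convRight G g.ofConv)) K
        (comul.rTensor H (comul (R := k) h))) := by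
  rw [← mulMap_mulMap_precomp_apply, ← mulRight_comp_precomp, ← mulRight_comp_precomp]
  induction t using pure_induction₃ with
  | add x y hx hy => simp only [map_add, WithConv.ofConv_add, LinearMap.add_apply, hx, hy]
  | tmul a b c => simp [mul_assoc]

end ConvDual

namespace CoquasiHopfAlgebra

open WithConv Coalgebra

variable {k H : Type*} [Field k] [AddCommGroup H] [Module k H] [Coalgebra k H]
  [FiniteDimensional k H] (Q : CoquasiHopfAlgebra k H)

lemma _root_.CoquasiBialgebra.comul_unit {H : Type*} [AddCommGroup H] [Module k H] [Coalgebra k H]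
    (B : CoquasiBialgebra k H) : comul (R := k) (B.unit 1) = B.unit 1 ⊗ₜ[k] B.unit 1 := by
  rw [← CoalgHomClass.map_comp_comul_apply]
  simp

lemma S_unit : Q.S (Q.unit 1) = Q.unit 1 := by
  have h1 := Q.S_alpha (Q.unit 1)
  have h2 := LinearMap.congr_fun Q.phi_S (Q.unit 1)
  simp [convRight, Q.comul_unit, Q.mul_one] at h1 h2
  have h3 : Q.alpha (Q.unit 1) ≠ 0 := fun h ↦ by simp [h] at h2
  exact smul_right_injective H h3 h1

/-- The dual of a finite dimensional coquasi Hopf algebra is a quasi-Hopf algebra. -/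
def dual : QuasiHopf k (ConvDual k H) where
  Δ := Q.dualComul
  ε := Q.dualCounit
  Φ := Q.dualPhi
  Ψ := Q.dualPhiInv
  Φ_mul_Ψ := Q.dualPhi_mul_dualPhiInv
  Ψ_mul_Φ := Q.dualPhiInv_mul_dualPhi
  killLeft_Δ a := by
    ext x
    rw [Q.pair_killLeft, Q.pair_dualComul, Q.one_mul]
  killRight_Δ a := by
    ext x
    rw [Q.pair_killRight, Q.pair_dualComul, Q.mul_one]
  Δ_Φ := Q.dualComul_dualPhi
  pentagon := Q.dual_pentagon
  killSecond_Φ := Q.killSecond_dualPhi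
  s := precomp Q.S
  s_one := by
    ext x
    exact LinearMap.congr_fun Q.counit_S x
  s_mul a b := by
    ext x
    rw [precomp_apply, mul_apply_of_comul, mul_apply_of_comul]
    have h : comul (R := k) (Q.S x) = _ := LinearMap.congr_fun Q.comul_S x
    simp only [LinearMap.comp_apply] at h
    rw [h]
    induction comul (R := k) x using pure_induction₂ with
    | add x y hx hy => simp only [map_add, hx, hy]
    | tmul a b => simp [mul_comm]
  α := toConv Q.alpha
  β := toConv Q.beta
  s_α a := by
    ext x
    rw [← precomp_id, sandwich_precomp_apply, Q.pair_dualComul]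
    exact (congrArg a.ofConv (Q.S_alpha x)).trans (by simp [mul_comm])
  β_s a := by
    ext x
    rw [← precomp_id, sandwich_precomp_apply, Q.pair_dualComul]
    exact (congrArg a.ofConv (Q.beta_S x)).trans (by simp [mul_comm])
  Φ_s := by
    ext x
    rw [← precomp_id, sandwich_sandwich_precomp_apply, Q.pair₃_dualPhi]
    exact LinearMap.congr_fun Q.phi_S x
  Ψ_s := by
    ext x
    rw [← precomp_id, sandwich_sandwich_precomp_apply, Q.pair₃_dualPhiInv]
    exact LinearMap.congr_fun Q.phiInv_S x

theorem S_bijective : Function.Bijective Q.S := by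
  have h : Function.Surjective Q.S := by
    rw [← LinearMap.range_eq_top]
    by_contra hne
    obtain ⟨f, hf, hf'⟩ := Submodule.exists_dual_map_eq_bot_of_lt_top (lt_top_iff_ne_top.mpr hne)
      inferInstance
    refine hf ?_
    have h1 : Q.dual.s (toConv f) = Q.dual.s 0 := by
      rw [map_zero]
      ext x
      have : f (Q.S x) ∈ (LinearMap.range Q.S).map f :=
        Submodule.mem_map_of_mem (LinearMap.mem_range_self _ _)
      rw [hf'] at this
      exact this
    have : FiniteDimensional k (ConvDual k H) :=
      Module.Finite.equiv (WithConv.linearEquiv k (H →ₗ[k] k)).symm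
    exact congrArg ofConv (Q.dual.s_bijective.1 h1)
  exact ⟨LinearMap.injective_iff_surjective.mpr h, h⟩

lemma S_SInv (x : H) : Q.S (Q.SInv x) = x := by
  have hu : IsUnit (M := Module.End k H) Q.S := (Module.End.isUnit_iff _).mpr Q.S_bijective
  exact LinearMap.congr_fun (Ring.mul_inverse_cancel _ hu) x

lemma SInv_S (x : H) : Q.SInv (Q.S x) = x := by
  have hu : IsUnit (M := Module.End k H) Q.S := (Module.End.isUnit_iff _).mpr Q.S_bijective
  exact LinearMap.congr_fun (Ring.inverse_mul_cancel _ hu) x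

/-- The inverse of the antipode of `Q.dual`. -/
abbrev dualSInv : ConvDual k H →ₗ[k] ConvDual k H := precomp Q.SInv

lemma dualSInv_s (a : ConvDual k H) : Q.dualSInv (Q.dual.s a) = a := by
  ext x
  exact congrArg a.ofConv (Q.S_SInv x)

lemma s_dualSInv (a : ConvDual k H) : Q.dual.s (Q.dualSInv a) = a := by
  ext x
  exact congrArg a.ofConv (Q.SInv_S x)

end CoquasiHopfAlgebra

/-! ### The operators given by functionals on a bicomodule -/

namespace Bicoaction

open WithConv Coalgebra

variable {k C M N : Type*} [Field k] [AddCommGroup C] [Module k C]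
  [AddCommGroup M] [Module k M] [AddCommGroup N] [Module k N]

/-- The operators `m ↦ ∑ m₀ a(m₁)`. -/
def ract (X : Bicoaction k C M) : ConvDual k C →ₗ[k] M →ₗ[k] M where
  toFun a := actRight a.ofConv X.right
  map_add' a b := by
    simp only [actRight, WithConv.ofConv_add, LinearMap.lTensor_add, LinearMap.add_comp,
      LinearMap.comp_add]
  map_smul' c a := by
    simp only [actRight, WithConv.ofConv_smul, LinearMap.lTensor_smul, LinearMap.smul_comp,
      LinearMap.comp_smul, RingHom.id_apply]

/-- The operators `m ↦ ∑ a(m₋₁) m₀`. -/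
def lact (X : Bicoaction k C M) : ConvDual k C →ₗ[k] M →ₗ[k] M where
  toFun a := actLeft a.ofConv X.left
  map_add' a b := by
    simp only [actLeft, WithConv.ofConv_add, LinearMap.rTensor_add, LinearMap.add_comp,
      LinearMap.comp_add]
  map_smul' c a := by
    simp only [actLeft, WithConv.ofConv_smul, LinearMap.rTensor_smul, LinearMap.smul_comp,
      LinearMap.comp_smul, RingHom.id_apply]

/-- `n ⊗ c ↦ a(c) n` -/
def slice {C N : Type*} [AddCommGroup C] [Module k C] [AddCommGroup N] [Module k N]
    (a : ConvDual k C) : N ⊗[k] C →ₗ[k] N :=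
  (TensorProduct.rid k N).toLinearMap ∘ₗ a.ofConv.lTensor N

@[simp] lemma slice_tmul (a : ConvDual k C) (n : N) (c : C) :
    slice a (n ⊗ₜ[k] c) = a c • n := by simp [slice]

lemma ract_apply (X : Bicoaction k C M) (a : ConvDual k C) (m : M) :
    X.ract a m = slice a (X.right m) := rfl

/-- `c ⊗ n ↦ a(c) n` -/
def lslice {C N : Type*} [AddCommGroup C] [Module k C] [AddCommGroup N] [Module k N]
    (a : ConvDual k C) : C ⊗[k] N →ₗ[k] N :=
  (TensorProduct.lid k N).toLinearMap ∘ₗ a.ofConv.rTensor N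

@[simp] lemma lslice_tmul (a : ConvDual k C) (n : N) (c : C) :
    lslice a (c ⊗ₜ[k] n) = a c • n := by simp [lslice]

lemma lact_apply (X : Bicoaction k C M) (a : ConvDual k C) (m : M) :
    X.lact a m = lslice a (X.left m) := rfl

lemma slice_comm (a : ConvDual k C) (t : C ⊗[k] N) :
    slice a (TensorProduct.comm k C N t) = lslice a t := by
  induction t using pure_induction₂ with
  | add x y hx hy => simp only [map_add, hx, hy]
  | tmul a b => simp

/-- Functionals on the second factor separate the elements of a tensor product. -/
lemma slice_ext {t t' : N ⊗[k] C} (h : ∀ a : ConvDual k C, slice a t = slice a t') : t = t' := by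
  let b := Module.Free.chooseBasis k C
  apply (TensorProduct.equivFinsuppOfBasisRight b).injective
  ext i
  have key (t : N ⊗[k] C) : TensorProduct.equivFinsuppOfBasisRight b t i =
      slice (toConv (b.coord i)) t := by
    induction t using pure_induction₂ with
    | add x y hx hy => simp only [map_add, Finsupp.add_apply, hx, hy]
    | tmul a c => simp
  rw [key, key, h]

lemma lslice_ext {t t' : C ⊗[k] N} (h : ∀ a : ConvDual k C, lslice a t = lslice a t') :
    t = t' := by
  apply (TensorProduct.comm k C N).injective
  refine slice_ext fun a ↦ ?_
  rw [slice_comm, slice_comm, h]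

lemma slice_rTensor {N' : Type*} [AddCommGroup N'] [Module k N'] (f : N →ₗ[k] N')
    (a : ConvDual k C) (t : N ⊗[k] C) : slice a (f.rTensor C t) = f (slice a t) := by
  induction t using pure_induction₂ with
  | add x y hx hy => simp only [map_add, hx, hy]
  | tmul a b => simp

lemma lslice_lTensor {N' : Type*} [AddCommGroup N'] [Module k N'] (f : N →ₗ[k] N')
    (a : ConvDual k C) (t : C ⊗[k] N) : lslice a (f.lTensor C t) = f (lslice a t) := by
  induction t using pure_induction₂ with
  | add x y hx hy => simp only [map_add, hx, hy]
  | tmul a b => simp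

lemma slice_slice_assoc_symm_comul [Coalgebra k C] (a b : ConvDual k C) (t : M ⊗[k] C) :
    slice a (slice b ((TensorProduct.assoc k M C C).symm (comul.lTensor M t))) =
      slice (a * b) t := by
  induction t using pure_induction₂ with
  | add x y hx hy => simp only [map_add, hx, hy]
  | tmul m x =>
    simp only [LinearMap.lTensor_tmul, slice_tmul, mul_apply_eq]
    induction comul (R := k) x using pure_induction₂ with
    | add x y hx hy => simp only [TensorProduct.tmul_add, map_add, add_smul, hx, hy]
    | tmul x y => simp [smul_smul, mul_comm (b y)]

lemma lslice_lslice_assoc_comul [Coalgebra k C] (a b : ConvDual k C) (t : C ⊗[k] M) :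
    lslice b (lslice a (TensorProduct.assoc k C C M (comul.rTensor M t))) =
      lslice (a * b) t := by
  induction t using pure_induction₂ with
  | add x y hx hy => simp only [map_add, hx, hy]
  | tmul x m =>
    simp only [LinearMap.rTensor_tmul, lslice_tmul, mul_apply_eq]
    induction comul (R := k) x using pure_induction₂ with
    | add x y hx hy => simp only [TensorProduct.add_tmul, map_add, add_smul, hx, hy]
    | tmul x y => simp [smul_smul]

lemma slice_lslice_assoc (a b : ConvDual k C) (t : (C ⊗[k] M) ⊗[k] C) :
    slice a (lslice b (TensorProduct.assoc k C M C t)) = lslice b (slice a t) := by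
  induction t using pure_induction₃ with
  | add x y hx hy => simp only [map_add, hx, hy]
  | tmul x m y => simp only [TensorProduct.assoc_tmul, slice_tmul, lslice_tmul, map_smul,
      smul_comm (a y)]

section Pair

variable {D : Type*} [AddCommGroup D] [Module k D] [Coalgebra k C] [Coalgebra k D]
  [FiniteDimensional k C] [FiniteDimensional k D]

lemma actRight_pair (r : M →ₗ[k] M ⊗[k] C) (r' : N →ₗ[k] N ⊗[k] D) (f : ConvDual k C)
    (g : ConvDual k D) (m : M) (n : N) :
    actRight (pair k C D (f ⊗ₜ g)).ofConv (extRight r r') (m ⊗ₜ n) =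
      actRight f.ofConv r m ⊗ₜ actRight g.ofConv r' n := by
  simp only [actRight, extRight, LinearMap.comp_apply, TensorProduct.map_tmul]
  induction r m using pure_induction₂ with
  | add x y hx hy => simp only [map_add, TensorProduct.add_tmul, hx, hy]
  | tmul a c =>
  induction r' n using pure_induction₂ with
  | add x y hx hy => simp only [map_add, TensorProduct.tmul_add, hx, hy]
  | tmul b d =>
    simp [mul_smul, TensorProduct.smul_tmul', smul_comm (f _)]

lemma actLeft_pair (l : M →ₗ[k] C ⊗[k] M) (l' : N →ₗ[k] D ⊗[k] N) (f : ConvDual k C)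
    (g : ConvDual k D) (m : M) (n : N) :
    actLeft (pair k C D (f ⊗ₜ g)).ofConv (extLeft l l') (m ⊗ₜ n) =
      actLeft f.ofConv l m ⊗ₜ actLeft g.ofConv l' n := by
  simp only [actLeft, extLeft, LinearMap.comp_apply, TensorProduct.map_tmul]
  induction l m using pure_induction₂ with
  | add x y hx hy => simp only [map_add, TensorProduct.add_tmul, hx, hy]
  | tmul a c =>
  induction l' n using pure_induction₂ with
  | add x y hx hy => simp only [map_add, TensorProduct.tmul_add, hx, hy]
  | tmul b d =>
    simp [mul_smul, TensorProduct.smul_tmul', smul_comm (f _)]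

end Pair

section Bicomodule

variable [Coalgebra k C] {X : Bicoaction k C M}

lemma IsBicomodule.ract_one (h : X.IsBicomodule) (m : M) : X.ract 1 m = m :=
  LinearMap.congr_fun h.right_counit m

lemma IsBicomodule.lact_one (h : X.IsBicomodule) (m : M) : X.lact 1 m = m :=
  LinearMap.congr_fun h.left_counit m

lemma IsBicomodule.ract_mul (h : X.IsBicomodule) (a b : ConvDual k C) (m : M) :
    X.ract (a * b) m = X.ract a (X.ract b m) := by
  have h1 : TensorProduct.assoc k M C C (X.right.rTensor C (X.right m)) =
    comul.lTensor M (X.right m) := LinearMap.congr_fun h.right_coassoc m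
  rw [ract_apply, ← slice_slice_assoc_symm_comul, ← h1, LinearEquiv.symm_apply_apply,
    slice_rTensor]
  rfl

lemma IsBicomodule.lact_mul (h : X.IsBicomodule) (a b : ConvDual k C) (m : M) :
    X.lact (a * b) m = X.lact b (X.lact a m) := by
  have h1 : TensorProduct.assoc k C C M (comul.rTensor M (X.left m)) =
    X.left.lTensor C (X.left m) := LinearMap.congr_fun h.left_coassoc m
  rw [lact_apply, ← lslice_lslice_assoc_comul, h1, lslice_lTensor]
  rfl

lemma IsBicomodule.lact_ract (h : X.IsBicomodule) (a b : ConvDual k C) (m : M) :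
    X.lact a (X.ract b m) = X.ract b (X.lact a m) := by
  have h1 : TensorProduct.assoc k C M C (X.left.rTensor C (X.right m)) =
    X.right.lTensor C (X.left m) := LinearMap.congr_fun h.comm m
  calc X.lact a (X.ract b m) = slice b (lslice a (TensorProduct.assoc k C M C
          (X.left.rTensor C (X.right m)))) := by
        rw [slice_lslice_assoc, slice_rTensor]; rfl
    _ = X.ract b (X.lact a m) := by
        rw [h1, lslice_lTensor]; rfl

lemma isBicomodule_of_act (hl1 : ∀ m, X.lact 1 m = m) (hr1 : ∀ m, X.ract 1 m = m)
    (hl : ∀ a b m, X.lact (a * b) m = X.lact b (X.lact a m))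
    (hr : ∀ a b m, X.ract (a * b) m = X.ract a (X.ract b m))
    (hc : ∀ a b m, X.lact a (X.ract b m) = X.ract b (X.lact a m)) : X.IsBicomodule where
  left_coassoc := by
    refine LinearMap.ext fun m ↦ lslice_ext fun a ↦ lslice_ext fun b ↦ ?_
    refine (lslice_lslice_assoc_comul _ _ _).trans ?_
    refine (hl a b m).trans ?_
    simp only [LinearMap.comp_apply, lslice_lTensor]
    rfl
  left_counit := LinearMap.ext hl1
  right_coassoc := by
    refine LinearMap.ext fun m ↦ (TensorProduct.assoc k M C C).symm.injective ?_
    refine slice_ext fun b ↦ slice_ext fun a ↦ ?_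
    simp only [LinearMap.comp_apply, LinearEquiv.coe_coe, LinearEquiv.symm_apply_apply,
      slice_slice_assoc_symm_comul, slice_rTensor]
    exact (hr a b m).symm
  right_counit := LinearMap.ext hr1
  comm := by
    refine LinearMap.ext fun m ↦ lslice_ext fun a ↦ slice_ext fun b ↦ ?_
    simp only [LinearMap.comp_apply, LinearEquiv.coe_coe, slice_lslice_assoc, slice_rTensor,
      lslice_lTensor]
    exact hc a b m

/-- A linear map is a morphism of bicomodules iff it commutes with the action of functionals. -/
lemma isHom_iff {Y : Bicoaction k C N} {f : M →ₗ[k] N} : X.IsHom Y f ↔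
    (∀ a m, f (X.lact a m) = Y.lact a (f m)) ∧ ∀ a m, f (X.ract a m) = Y.ract a (f m) := by
  refine ⟨fun h ↦ ⟨fun a m ↦ ?_, fun a m ↦ ?_⟩, fun h ↦ ⟨?_, ?_⟩⟩
  · have h1 : f.lTensor C (X.left m) = Y.left (f m) := LinearMap.congr_fun h.1 m
    rw [lact_apply, lact_apply, ← h1, lslice_lTensor]
  · have h1 : f.rTensor C (X.right m) = Y.right (f m) := LinearMap.congr_fun h.2 m
    rw [ract_apply, ract_apply, ← h1, slice_rTensor]
  · refine LinearMap.ext fun m ↦ lslice_ext fun a ↦ ?_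
    rw [LinearMap.comp_apply, lslice_lTensor]
    exact h.1 a m
  · refine LinearMap.ext fun m ↦ slice_ext fun a ↦ ?_
    rw [LinearMap.comp_apply, slice_rTensor]
    exact h.2 a m

lemma regular_isBicomodule : (regular k C).IsBicomodule where
  left_coassoc := by ext; simp [regular, Coalgebra.coassoc_apply]
  left_counit := by ext; simp [regular]
  right_coassoc := by ext; simp [regular, Coalgebra.coassoc_apply]
  right_counit := by ext; simp [regular]
  comm := by ext; simp [regular, Coalgebra.coassoc_apply]

lemma apply_regular_ract (a b : ConvDual k C) (x : C) :
    b ((regular k C).ract a x) = (b * a) x := by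
  rw [ract_apply, mul_apply_eq]
  change b (slice a (comul x)) = _
  induction comul (R := k) x using pure_induction₂ with
  | add x y hx hy => simp only [map_add, hx, hy]
  | tmul x y => simp [mul_comm]

lemma apply_regular_lact (a b : ConvDual k C) (x : C) :
    b ((regular k C).lact a x) = (a * b) x := by
  rw [lact_apply, mul_apply_eq]
  change b (lslice a (comul x)) = _
  induction comul (R := k) x using pure_induction₂ with
  | add x y hx hy => simp only [map_add, hx, hy]
  | tmul x y => simp

end Bicomodule

end Bicoaction

namespace CoquasiBialgebra

open WithConv Coalgebra Bicoaction

variable {k H L M N : Type*} [Field k] [AddCommGroup H] [Module k H] [Coalgebra k H]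
  [AddCommGroup L] [Module k L] [AddCommGroup M] [Module k M] [AddCommGroup N] [Module k N]
  [FiniteDimensional k H] (B : CoquasiBialgebra k H) (X : Bicoaction k H L)
  (Y : Bicoaction k H M) (Z : Bicoaction k H N)

/-- The operators on `M ⊗ N` given by elements of `H^* ⊗ H^*`. -/
def ract₂ (t : ConvDual k H ⊗[k] ConvDual k H) : L ⊗[k] M →ₗ[k] L ⊗[k] M :=
  actRight (pair k H H t).ofConv (extRight X.right Y.right)

/-- The operators on `M ⊗ N` given by elements of `H^* ⊗ H^*`. -/
def lact₂ (t : ConvDual k H ⊗[k] ConvDual k H) : L ⊗[k] M →ₗ[k] L ⊗[k] M :=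
  actLeft (pair k H H t).ofConv (extLeft X.left Y.left)

variable {X Y Z}

@[simp] lemma ract₂_tmul (a b : ConvDual k H) (x : L) (y : M) :
    ract₂ X Y (a ⊗ₜ b) (x ⊗ₜ y) = X.ract a x ⊗ₜ Y.ract b y := actRight_pair ..

@[simp] lemma lact₂_tmul (a b : ConvDual k H) (x : L) (y : M) :
    lact₂ X Y (a ⊗ₜ b) (x ⊗ₜ y) = X.lact a x ⊗ₜ Y.lact b y := actLeft_pair ..

end CoquasiBialgebra

namespace CoquasiBialgebra

open WithConv Coalgebra Bicoaction

variable {k H L M N : Type*} [Field k] [AddCommGroup H] [Module k H] [Coalgebra k H]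
  [AddCommGroup L] [Module k L] [AddCommGroup M] [Module k M] [AddCommGroup N] [Module k N]
  [FiniteDimensional k H] (B : CoquasiBialgebra k H) (X : Bicoaction k H L)
  (Y : Bicoaction k H M) (Z : Bicoaction k H N)

@[simp] lemma ract₂_add (t t' : ConvDual k H ⊗[k] ConvDual k H) :
    ract₂ X Y (t + t') = ract₂ X Y t + ract₂ X Y t' := by
  simp only [ract₂, map_add, actRight, WithConv.ofConv_add, LinearMap.lTensor_add,
    LinearMap.add_comp, LinearMap.comp_add]

@[simp] lemma lact₂_add (t t' : ConvDual k H ⊗[k] ConvDual k H) :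
    lact₂ X Y (t + t') = lact₂ X Y t + lact₂ X Y t' := by
  simp only [lact₂, map_add, actLeft, WithConv.ofConv_add, LinearMap.rTensor_add,
    LinearMap.add_comp, LinearMap.comp_add]

/-- The operators on `L ⊗ M ⊗ N` given by elements of `H^* ⊗ H^* ⊗ H^*`. -/
def ract₃ (t : (ConvDual k H ⊗[k] ConvDual k H) ⊗[k] ConvDual k H) :
    (L ⊗[k] M) ⊗[k] N →ₗ[k] (L ⊗[k] M) ⊗[k] N :=
  actRight (pair₃ k H t).ofConv (extRight (extRight X.right Y.right) Z.right)

/-- The operators on `L ⊗ M ⊗ N` given by elements of `H^* ⊗ H^* ⊗ H^*`. -/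
def lact₃ (t : (ConvDual k H ⊗[k] ConvDual k H) ⊗[k] ConvDual k H) :
    (L ⊗[k] M) ⊗[k] N →ₗ[k] (L ⊗[k] M) ⊗[k] N :=
  actLeft (pair₃ k H t).ofConv (extLeft (extLeft X.left Y.left) Z.left)

@[simp] lemma ract₃_add (t t' : (ConvDual k H ⊗[k] ConvDual k H) ⊗[k] ConvDual k H) :
    ract₃ X Y Z (t + t') = ract₃ X Y Z t + ract₃ X Y Z t' := by
  simp only [ract₃, map_add, actRight, WithConv.ofConv_add, LinearMap.lTensor_add,
    LinearMap.add_comp, LinearMap.comp_add]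

@[simp] lemma lact₃_add (t t' : (ConvDual k H ⊗[k] ConvDual k H) ⊗[k] ConvDual k H) :
    lact₃ X Y Z (t + t') = lact₃ X Y Z t + lact₃ X Y Z t' := by
  simp only [lact₃, map_add, actLeft, WithConv.ofConv_add, LinearMap.rTensor_add,
    LinearMap.add_comp, LinearMap.comp_add]

@[simp] lemma ract₃_tmul (t : ConvDual k H ⊗[k] ConvDual k H) (c : ConvDual k H) (u : L ⊗[k] M)
    (z : N) : ract₃ X Y Z (t ⊗ₜ c) (u ⊗ₜ z) = ract₂ X Y t u ⊗ₜ Z.ract c z := 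
  actRight_pair _ _ (pair k H H t) c u z

@[simp] lemma lact₃_tmul (t : ConvDual k H ⊗[k] ConvDual k H) (c : ConvDual k H) (u : L ⊗[k] M)
    (z : N) : lact₃ X Y Z (t ⊗ₜ c) (u ⊗ₜ z) = lact₂ X Y t u ⊗ₜ Z.lact c z :=
  actLeft_pair _ _ (pair k H H t) c u z

lemma associator_eq : B.associator X Y Z = (TensorProduct.assoc k L M N).toLinearMap ∘ₗ
    ract₃ X Y Z B.dualPhiInv ∘ₗ lact₃ X Y Z B.dualPhi := by
  simp only [associator, ract₃, lact₃, pair₃_dualPhi, pair₃_dualPhiInv]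

lemma associatorInv_eq : B.associatorInv X Y Z = lact₃ X Y Z B.dualPhiInv ∘ₗ
    ract₃ X Y Z B.dualPhi ∘ₗ (TensorProduct.assoc k L M N).symm.toLinearMap := by
  simp only [associatorInv, ract₃, lact₃, pair₃_dualPhi, pair₃_dualPhiInv]

variable {X Y Z}

lemma actRight_mul (a : H →ₗ[k] k) {V : Type*} [AddCommGroup V] [Module k V]
    (r : V →ₗ[k] V ⊗[k] (H ⊗[k] H)) :
    actRight a (B.mul.toLinearMap.lTensor V ∘ₗ r) = actRight (a ∘ₗ B.mul.toLinearMap) r := by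
  simp only [actRight, LinearMap.lTensor_comp, LinearMap.comp_assoc]

lemma actLeft_mul (a : H →ₗ[k] k) {V : Type*} [AddCommGroup V] [Module k V]
    (r : V →ₗ[k] (H ⊗[k] H) ⊗[k] V) :
    actLeft a (B.mul.toLinearMap.rTensor V ∘ₗ r) = actLeft (a ∘ₗ B.mul.toLinearMap) r := by
  simp only [actLeft, LinearMap.rTensor_comp, LinearMap.comp_assoc]

lemma ofConv_pair_dualComul (a : ConvDual k H) :
    (pair k H H (B.dualComul a)).ofConv = a.ofConv ∘ₗ B.mul.toLinearMap :=
  LinearMap.ext fun t ↦ B.pair_dualComul a t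

lemma tensor_ract (a : ConvDual k H) : (B.tensor X Y).ract a = ract₂ X Y (B.dualComul a) := by
  rw [ract₂, ofConv_pair_dualComul, ← actRight_mul]
  rfl

lemma tensor_lact (a : ConvDual k H) : (B.tensor X Y).lact a = lact₂ X Y (B.dualComul a) := by
  rw [lact₂, ofConv_pair_dualComul, ← actLeft_mul]
  rfl

/-- `t ↦ ∑ t(1) a`, for the trivial bicomodule `k 1 ⊆ H`. -/
lemma regular_ract_unit (a : ConvDual k H) :
    (regular k H).ract a (B.unit 1) = B.dualCounit a • B.unit 1 := by
  change slice a (comul (B.unit 1)) = _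
  rw [B.comul_unit, slice_tmul]
  rfl

lemma regular_lact_unit (a : ConvDual k H) :
    (regular k H).lact a (B.unit 1) = B.dualCounit a • B.unit 1 := by
  change lslice a (comul (B.unit 1)) = _
  rw [B.comul_unit, lslice_tmul]
  rfl

section Naturality

variable {L' : Type*} [AddCommGroup L'] [Module k L'] {X' : Bicoaction k H L'} {f : L →ₗ[k] L'}

lemma map_ract₂ (h : ∀ a m, f (X.ract a m) = X'.ract a (f m))
    (t : ConvDual k H ⊗[k] ConvDual k H) (u : L ⊗[k] M) :
    f.rTensor M (ract₂ X Y t u) = ract₂ X' Y t (f.rTensor M u) := by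
  induction t using pure_induction₂ with
  | add x y hx hy => simp only [ract₂_add, LinearMap.add_apply, map_add, hx, hy]
  | tmul a b =>
  induction u using pure_induction₂ with
  | add x y hx hy => simp only [map_add, hx, hy]
  | tmul x y => simp [h]

lemma map_lact₂ (h : ∀ a m, f (X.lact a m) = X'.lact a (f m))
    (t : ConvDual k H ⊗[k] ConvDual k H) (u : L ⊗[k] M) :
    f.rTensor M (lact₂ X Y t u) = lact₂ X' Y t (f.rTensor M u) := by
  induction t using pure_induction₂ with
  | add x y hx hy => simp only [lact₂_add, LinearMap.add_apply, map_add, hx, hy]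
  | tmul a b =>
  induction u using pure_induction₂ with
  | add x y hx hy => simp only [map_add, hx, hy]
  | tmul x y => simp [h]

lemma map_ract₃ (h : ∀ a m, f (X.ract a m) = X'.ract a (f m))
    (t : (ConvDual k H ⊗[k] ConvDual k H) ⊗[k] ConvDual k H) (u : (L ⊗[k] M) ⊗[k] N) :
    (f.rTensor M).rTensor N (ract₃ X Y Z t u) = ract₃ X' Y Z t ((f.rTensor M).rTensor N u) := by
  induction t using pure_induction₂ with
  | add x y hx hy => simp only [ract₃_add, LinearMap.add_apply, map_add, hx, hy]
  | tmul a b =>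
  induction u using pure_induction₂ with
  | add x y hx hy => simp only [map_add, hx, hy]
  | tmul x y => simp [map_ract₂ h]

lemma map_lact₃ (h : ∀ a m, f (X.lact a m) = X'.lact a (f m))
    (t : (ConvDual k H ⊗[k] ConvDual k H) ⊗[k] ConvDual k H) (u : (L ⊗[k] M) ⊗[k] N) :
    (f.rTensor M).rTensor N (lact₃ X Y Z t u) = lact₃ X' Y Z t ((f.rTensor M).rTensor N u) := by
  induction t using pure_induction₂ with
  | add x y hx hy => simp only [lact₃_add, LinearMap.add_apply, map_add, hx, hy]
  | tmul a b =>
  induction u using pure_induction₂ with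
  | add x y hx hy => simp only [map_add, hx, hy]
  | tmul x y => simp [map_lact₂ h]

lemma tensor_isHom (h : X.IsHom X' f) : (B.tensor X Y).IsHom (B.tensor X' Y) (f.rTensor M) := by
  rw [isHom_iff] at h ⊢
  refine ⟨fun a u ↦ ?_, fun a u ↦ ?_⟩
  · rw [tensor_lact, tensor_lact, map_lact₂ h.1]
  · rw [tensor_ract, tensor_ract, map_ract₂ h.2]

lemma associator_naturality (h : X.IsHom X' f) (u : (L ⊗[k] M) ⊗[k] N) :
    f.rTensor (M ⊗[k] N) (B.associator X Y Z u) =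
      B.associator X' Y Z ((f.rTensor M).rTensor N u) := by
  rw [isHom_iff] at h
  simp only [associator_eq, LinearMap.comp_apply]
  rw [← map_lact₃ h.1, ← map_ract₃ h.2]
  generalize (ract₃ X Y Z _ _) = v
  induction v using pure_induction₃ with
  | add x y hx hy => simp only [map_add, hx, hy]
  | tmul x y z => simp

end Naturality

end CoquasiBialgebra

namespace QuasiHopf

variable {k A : Type*} [Field k] [Ring A] [Algebra k A] (Q : QuasiHopf k A)
  (s' : A →ₗ[k] A) (h : ∀ a, s' (Q.s a) = a) (h' : ∀ a, Q.s (s' a) = a)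

lemma op_ω_op₃ (a b c : A) : (Q.op s' h h').ω (op₃ k A ((a ⊗ₜ b) ⊗ₜ c)) =
    op₂ k A (b ⊗ₜ c * Q.Δ (s' Q.β) * Q.Δ (s' a)) := by
  rw [op₂_mul, op₂_mul]
  simp only [op₃_tmul, op₂_tmul, ω_tmul, op, opMap_op, opComul_op, mul_assoc]

lemma op_foldβ_op₃ (a b c : A) : (Q.op s' h h').foldβ (op₃ k A ((a ⊗ₜ b) ⊗ₜ c)) =
    op₂ k A (a ⊗ₜ (s' c * s' Q.α * b)) := by
  simp only [op₃_tmul, op₂_tmul, foldβ_tmul, op, opMap_op, MulOpposite.op_mul, mul_assoc]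

/-- The element that describes, on the left, the action of `H` on `*H`. -/
def L : A ⊗[k] A := (op₂ k A).symm (Q.op s' h h').R

end QuasiHopf

namespace CoquasiHopfAlgebra

open WithConv Coalgebra Bicoaction CoquasiBialgebra

variable {k H : Type*} [Field k] [AddCommGroup H] [Module k H] [Coalgebra k H]
  [FiniteDimensional k H] (Q : CoquasiHopfAlgebra k H)

/-- The opposite of `Q.dual`. -/
abbrev dualOp : QuasiHopf k (ConvDual k H)ᵐᵒᵖ := Q.dual.op Q.dualSInv Q.dualSInv_s Q.s_dualSInv

lemma slice_apply (a : ConvDual k H) (t : Module.Dual k H ⊗[k] H) (y : H) :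
    slice a t y = a (dualTensorHom k H H t y) := by
  induction t using pure_induction₂ with
  | add x y hx hy => simp only [map_add, LinearMap.add_apply, hx, hy]
  | tmul f x => simp [mul_comm]

lemma starH_ract (a : ConvDual k H) (f : Module.Dual k H) :
    Q.starH.ract a f = (toConv f * Q.dual.s a).ofConv := by
  refine LinearMap.ext fun y ↦ ?_
  rw [ract_apply, slice_apply]
  have h1 : dualTensorHom k H H (Q.starH.right f) = Q.S ∘ₗ slantRight comul f :=
    (dualTensorHomEquiv k H H).apply_symm_apply _
  rw [h1]
  change a (Q.S (TensorProduct.lid k H (f.rTensor H (comul y)))) = (toConv f * Q.dual.s a) y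
  rw [mul_apply_eq]
  induction comul (R := k) y using pure_induction₂ with
  | add x y hx hy => simp only [map_add, hx, hy]
  | tmul x y => simp [dual]

lemma starH_lact (a : ConvDual k H) (f : Module.Dual k H) :
    Q.starH.lact a f = (Q.dualSInv a * toConv f).ofConv := by
  refine LinearMap.ext fun y ↦ ?_
  have h1 : dualTensorHom k H H (TensorProduct.comm k H _ (Q.starH.left f)) =
      Q.SInv ∘ₗ slantLeft comul f := by
    change dualTensorHom k H H ((TensorProduct.comm k _ H).symm (TensorProduct.comm k _ H _)) = _
    rw [LinearEquiv.symm_apply_apply]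
    exact (dualTensorHomEquiv k H H).apply_symm_apply _
  rw [lact_apply, ← slice_comm, slice_apply, h1]
  change a (Q.SInv (TensorProduct.rid k H (f.lTensor H (comul y)))) = (Q.dualSInv a * toConv f) y
  rw [mul_apply_eq]
  induction comul (R := k) y using pure_induction₂ with
  | add x y hx hy => simp only [map_add, hx, hy]
  | tmul x y => simp [mul_comm]

lemma starH_isBicomodule : Q.starH.IsBicomodule := by
  refine isBicomodule_of_act (fun f ↦ ?_) (fun f ↦ ?_) (fun a b f ↦ ?_) (fun a b f ↦ ?_)
    (fun a b f ↦ ?_)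
  · have : Q.dualSInv 1 = 1 := by
      have := Q.dualSInv_s 1
      rwa [Q.dual.s_one] at this
    rw [starH_lact, this, _root_.one_mul, ofConv_toConv]
  · rw [starH_ract, Q.dual.s_one, _root_.mul_one, ofConv_toConv]
  · simp only [starH_lact, toConv_ofConv]
    rw [Q.dual.inv_s_mul _ Q.dualSInv_s Q.s_dualSInv, mul_assoc]
  · simp only [starH_ract, toConv_ofConv]
    rw [Q.dual.s_mul, mul_assoc]
  · simp only [starH_lact, starH_ract, toConv_ofConv, mul_assoc]

lemma evLeft_tmul (f : Module.Dual k H) (y : H) : Q.evLeft (regular k H) (f ⊗ₜ y) =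
    (Q.dualSInv Q.dual.β * toConv f * Q.dual.α) y := by
  have : Q.evLeft (regular k H) (f ⊗ₜ y) = toConv f ((regular k H).lact (Q.dualSInv Q.dual.β)
    ((regular k H).ract Q.dual.α y)) := rfl
  rw [this, apply_regular_lact, apply_regular_ract]

lemma pair_ract_tmul_ract (t : ConvDual k H ⊗[k] ConvDual k H) (a b : ConvDual k H) (x y : H) :
    pair k H H t ((regular k H).ract a x ⊗ₜ (regular k H).ract b y) =
      pair k H H (t * a ⊗ₜ b) (x ⊗ₜ y) := by
  induction t using pure_induction₂ with
  | add x y hx hy =>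
    simp only [map_add, WithConv.ofConv_add, LinearMap.add_apply, hx, hy, add_mul]
  | tmul f g => simp [apply_regular_ract]

lemma pair_lact_tmul_lact (t : ConvDual k H ⊗[k] ConvDual k H) (a b : ConvDual k H) (x y : H) :
    pair k H H t ((regular k H).lact a x ⊗ₜ (regular k H).lact b y) =
      pair k H H (a ⊗ₜ b * t) (x ⊗ₜ y) := by
  induction t using pure_induction₂ with
  | add x y hx hy =>
    simp only [map_add, WithConv.ofConv_add, LinearMap.add_apply, hx, hy, mul_add]
  | tmul f g => simp [apply_regular_lact]

/-- The evaluation in the definition of the action, in terms of functionals. -/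
lemma evLeft_mul (T U : (ConvDual k H ⊗[k] ConvDual k H) ⊗[k] ConvDual k H)
    (t t' : ConvDual k H ⊗[k] ConvDual k H) (f : Module.Dual k H) (x z : H) :
    Q.evLeft (regular k H) (Q.mul.toLinearMap.lTensor _ (TensorProduct.assoc k _ H H
      (ract₃ Q.starH (regular k H) (regular k H) U (lact₃ Q.starH (regular k H) (regular k H) T
        (lact₂ Q.starH (regular k H) t' (ract₂ Q.starH (regular k H) t (f ⊗ₜ x)) ⊗ₜ z))))) =
    pair k H H ((op₂ k _).symm (Q.dualOp.ω (op₃ k _ T * op₂ k _ t' ⊗ₜ 1)) *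
      Q.dual.Δ (toConv f) * Q.dual.ω (U * t ⊗ₜ 1)) (x ⊗ₜ z) := by
  induction T using pure_induction₃ with
  | add x y hx hy =>
    simp only [lact₃_add, LinearMap.add_apply, map_add, add_mul, WithConv.ofConv_add, hx, hy]
  | tmul a₁ a₂ a₃ =>
  induction U using pure_induction₃ with
  | add x y hx hy =>
    simp only [ract₃_add, LinearMap.add_apply, map_add, add_mul, mul_add, WithConv.ofConv_add, hx,
      hy]
  | tmul b₁ b₂ b₃ =>
  induction t using pure_induction₂ with
  | add x y hx hy =>
    simp only [ract₂_add, LinearMap.add_apply, map_add, TensorProduct.add_tmul, mul_add,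
      WithConv.ofConv_add, hx, hy]
  | tmul t₁ t₂ =>
  induction t' using pure_induction₂ with
  | add x y hx hy =>
    simp only [lact₂_add, LinearMap.add_apply, map_add, TensorProduct.add_tmul, add_mul, mul_add,
      WithConv.ofConv_add, hx, hy]
  | tmul t₁' t₂' =>
  have hb := regular_isBicomodule (k := k) (C := H)
  simp only [ract₂_tmul, lact₂_tmul, lact₃_tmul, ract₃_tmul, TensorProduct.assoc_tmul,
    LinearMap.lTensor_tmul, evLeft_tmul, starH_ract, starH_lact, toConv_ofConv,
    ← hb.lact_ract, ← hb.lact_mul, ← hb.ract_mul]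
  have h1 : op₃ k _ ((a₁ ⊗ₜ a₂) ⊗ₜ a₃) * op₂ k _ (t₁' ⊗ₜ t₂') ⊗ₜ (1 : (ConvDual k H)ᵐᵒᵖ) =
      op₃ k _ (((t₁' * a₁) ⊗ₜ (t₂' * a₂)) ⊗ₜ a₃) := by simp
  rw [h1, QuasiHopf.op_ω_op₃, LinearEquiv.symm_apply_apply]
  refine (Q.pair_dualComul _ _).symm.trans ?_
  rw [pair_lact_tmul_lact, pair_ract_tmul_ract, Algebra.TensorProduct.tmul_mul_tmul,
    Algebra.TensorProduct.tmul_mul_tmul, QuasiHopf.ω_tmul]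
  change pair k H H (_ * Q.dual.Δ _ * _) _ = _
  simp only [Q.dual.inv_s_mul _ Q.dualSInv_s Q.s_dualSInv, QuasiHopf.s_mul, map_mul, mul_assoc,
    _root_.mul_one]

end CoquasiHopfAlgebra

namespace QuasiHopf

variable {k A : Type*} [Field k] [Ring A] [Algebra k A] (Q : QuasiHopf k A)
  (s' : A →ₗ[k] A) (h : ∀ a, s' (Q.s a) = a) (h' : ∀ a, Q.s (s' a) = a)

lemma ω_mul_onLeft_foldβ (T : (A ⊗[k] A) ⊗[k] A) (a b c : A) :
    Q.ω (T * onLeft Q.Δ (Q.foldβ ((a ⊗ₜ b) ⊗ₜ c))) =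
      Q.ω (T * Q.Δ a ⊗ₜ 1) * 1 ⊗ₜ (b * (Q.β * Q.s c)) := by
  rw [← ω_mul_shiftTwo, mul_assoc]
  simp [mul_assoc, ← Algebra.TensorProduct.one_def]

lemma op_ω_mul_onLeft_foldβ (T : (Aᵐᵒᵖ ⊗[k] Aᵐᵒᵖ) ⊗[k] Aᵐᵒᵖ) (a b c : A) :
    (op₂ k A).symm ((Q.op s' h h').ω (T * onLeft (Q.op s' h h').Δ
      ((Q.op s' h h').foldβ (op₃ k A ((a ⊗ₜ b) ⊗ₜ c))))) =
    1 ⊗ₜ (s' c * s' Q.α * b) *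
      (op₂ k A).symm ((Q.op s' h h').ω (T * op₂ k A (Q.Δ a) ⊗ₜ 1)) := by
  apply (op₂ k A).injective
  rw [op₂_mul, LinearEquiv.apply_symm_apply, LinearEquiv.apply_symm_apply, op₃_tmul, op₂_tmul,
    ω_mul_onLeft_foldβ]
  rfl

end QuasiHopf

namespace CoquasiHopfAlgebra

open WithConv Coalgebra Bicoaction CoquasiBialgebra

lemma apply_coevaluation {k V W : Type*} [Field k] [AddCommGroup V] [Module k V]
    [FiniteDimensional k V] [AddCommGroup W] [Module k W] (K : V ⊗[k] Module.Dual k V →ₗ[k] W)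
    (P : Module.Dual k V) (N : Module.Dual k V →ₗ[k] W) (h : ∀ e g, K (e ⊗ₜ g) = P e • N g) :
    K (coevaluation k V 1) = N P := by
  rw [coevaluation_apply_one, map_sum]
  simp only [h, ← map_smul, ← map_sum]
  congr 1
  exact Module.Basis.sum_dual_apply_smul_coord _ P

variable {k H : Type*} [Field k] [AddCommGroup H] [Module k H] [Coalgebra k H]
  [FiniteDimensional k H] (Q : CoquasiHopfAlgebra k H)

/-- The composition that defines the action of `H` on `*H`, applied to `f ⊗ x`, with the
inverse associativity constraint replaced by the operator given by `T` and `U`. -/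
def starCore (T U : (ConvDual k H ⊗[k] ConvDual k H) ⊗[k] ConvDual k H) (f : Module.Dual k H)
    (x : H) : H ⊗[k] Module.Dual k H →ₗ[k] Module.Dual k H :=
  (TensorProduct.lid k (Module.Dual k H)).toLinearMap ∘ₗ
    (Q.evLeft (regular k H)).rTensor (Module.Dual k H) ∘ₗ
    (Q.mul.toLinearMap.lTensor (Module.Dual k H)).rTensor (Module.Dual k H) ∘ₗ
    (Q.associator Q.starH (regular k H) (regular k H)).rTensor (Module.Dual k H) ∘ₗ
    lact₃ (Q.tensor Q.starH (regular k H)) (regular k H) Q.starH T ∘ₗ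
    ract₃ (Q.tensor Q.starH (regular k H)) (regular k H) Q.starH U ∘ₗ
    (TensorProduct.assoc k _ _ _).symm.toLinearMap ∘ₗ TensorProduct.mk k _ _ (f ⊗ₜ x)

lemma starCore_add_left (T T' U : (ConvDual k H ⊗[k] ConvDual k H) ⊗[k] ConvDual k H)
    (f : Module.Dual k H) (x : H) :
    Q.starCore (T + T') U f x = Q.starCore T U f x + Q.starCore T' U f x := by
  simp only [starCore, lact₃_add, LinearMap.add_comp, LinearMap.comp_add]

lemma starCore_add_right (T U U' : (ConvDual k H ⊗[k] ConvDual k H) ⊗[k] ConvDual k H)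
    (f : Module.Dual k H) (x : H) :
    Q.starCore T (U + U') f x = Q.starCore T U f x + Q.starCore T U' f x := by
  simp only [starCore, ract₃_add, LinearMap.add_comp, LinearMap.comp_add]

/-- The operator in the definition of the coevaluation. -/
def coevTwist : H →ₗ[k] H :=
  (regular k H).lact (Q.dualSInv Q.dual.α) ∘ₗ (regular k H).ract Q.dual.β

lemma starHAction_eq (f : Module.Dual k H) (x : H) : Q.starHAction (f ⊗ₜ x) =
    Q.starCore Q.dualPhiInv Q.dualPhi f x
      (Q.coevTwist.rTensor (Module.Dual k H) (coevaluation k H 1)) := by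
  rw [starHAction, dualAction, associatorInv_eq]
  rfl

lemma starCore_apply (T U : (ConvDual k H ⊗[k] ConvDual k H) ⊗[k] ConvDual k H)
    (f : Module.Dual k H) (x y : H) :
    Q.starCore T U f x (Q.coevTwist.rTensor (Module.Dual k H) (coevaluation k H 1)) y =
    pair k H H ((op₂ k _).symm (Q.dualOp.ω (Q.dualOp.Ψ *
        onLeft Q.dualOp.Δ (Q.dualOp.foldβ (op₃ k _ T)))) *
      Q.dual.Δ (toConv f) * Q.dual.ω (Q.dual.Ψ * onLeft Q.dual.Δ (Q.dual.foldβ U)))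
      (x ⊗ₜ y) := by
  induction T using pure_induction₃ with
  | add x y hx hy =>
    simp only [starCore_add_left, LinearMap.add_apply, map_add, add_mul, mul_add,
      WithConv.ofConv_add, hx, hy]
  | tmul c₁ c₂ c₃ =>
  induction U using pure_induction₃ with
  | add x y hx hy =>
    simp only [starCore_add_right, LinearMap.add_apply, map_add, mul_add,
      WithConv.ofConv_add, hx, hy]
  | tmul d₁ d₂ d₃ =>
  have hb := regular_isBicomodule (k := k) (C := H)
  let u := lact₂ Q.starH (regular k H) (Q.dual.Δ c₁)
    (ract₂ Q.starH (regular k H) (Q.dual.Δ d₁) (f ⊗ₜ x))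
  let P : Module.Dual k H := Q.evLeft (regular k H) ∘ₗ Q.mul.toLinearMap.lTensor _ ∘ₗ
    Q.associator Q.starH (regular k H) (regular k H) ∘ₗ TensorProduct.mk k _ _ u ∘ₗ
      (regular k H).lact c₂ ∘ₗ (regular k H).ract d₂ ∘ₗ Q.coevTwist
  let N : Module.Dual k H →ₗ[k] Module.Dual k H := Q.starH.lact c₃ ∘ₗ Q.starH.ract d₃
  have h1 : (Q.starCore ((c₁ ⊗ₜ c₂) ⊗ₜ c₃) ((d₁ ⊗ₜ d₂) ⊗ₜ d₃) f x)
      (Q.coevTwist.rTensor (Module.Dual k H) (coevaluation k H 1)) = N P := by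
    refine apply_coevaluation (Q.starCore ((c₁ ⊗ₜ c₂) ⊗ₜ c₃) ((d₁ ⊗ₜ d₂) ⊗ₜ d₃) f x ∘ₗ
      Q.coevTwist.rTensor (Module.Dual k H)) P N fun e g ↦ ?_
    simp only [starCore, LinearMap.comp_apply, LinearMap.rTensor_tmul, TensorProduct.mk_apply,
      LinearEquiv.coe_coe, TensorProduct.assoc_symm_tmul, ract₃_tmul, lact₃_tmul, ract₂_tmul,
      lact₂_tmul, tensor_lact, tensor_ract, TensorProduct.lid_tmul, P, N]
    rfl
  have h2 : N P y = (toConv P) ((regular k H).lact (Q.dualSInv c₃)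
      ((regular k H).ract (Q.dual.s d₃) y)) := by
    simp only [N, LinearMap.comp_apply, starH_lact, starH_ract, toConv_ofConv]
    rw [apply_regular_lact, apply_regular_ract, mul_assoc]
  rw [h1, h2]
  simp only [P, u, LinearMap.comp_apply, TensorProduct.mk_apply, associator_eq,
    LinearEquiv.coe_coe, coevTwist]
  rw [Q.evLeft_mul]
  simp only [← hb.lact_ract, ← hb.lact_mul, ← hb.ract_mul]
  set l := Q.dualSInv c₃ * Q.dualSInv Q.dual.α * c₂
  set r := d₂ * (Q.dual.β * Q.dual.s d₃)
  have h3 : x = (regular k H).lact 1 ((regular k H).ract 1 x) := by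
    rw [hb.ract_one, hb.lact_one]
  have h4 (W : ConvDual k H ⊗[k] ConvDual k H) (z : H) :
      pair k H H W (x ⊗ₜ (regular k H).lact l ((regular k H).ract r z)) =
        pair k H H (1 ⊗ₜ l * W * 1 ⊗ₜ r) (x ⊗ₜ z) := by
    conv_lhs => rw [h3]
    rw [pair_lact_tmul_lact, pair_ract_tmul_ract]
  rw [h4, QuasiHopf.ω_mul_onLeft_foldβ, QuasiHopf.op_ω_mul_onLeft_foldβ]
  simp only [mul_assoc, l, r]
  rfl

/-- The element of `H^* ⊗ H^*` that describes, on the left, the action of `H` on `*H`. -/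
abbrev dualL : ConvDual k H ⊗[k] ConvDual k H :=
  Q.dual.L Q.dualSInv Q.dualSInv_s Q.s_dualSInv

theorem starHAction_apply (f : Module.Dual k H) (x y : H) : Q.starHAction (f ⊗ₜ x) y =
    pair k H H (Q.dualL * Q.dual.Δ (toConv f) * Q.dual.R) (x ⊗ₜ y) := by
  rw [starHAction_eq, starCore_apply]
  rfl

end CoquasiHopfAlgebra

namespace QuasiHopf

variable {k A : Type*} [Field k] [Ring A] [Algebra k A] (Q : QuasiHopf k A)
  (s' : A →ₗ[k] A) (h : ∀ a, s' (Q.s a) = a) (h' : ∀ a, Q.s (s' a) = a)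

lemma op₂_L : op₂ k A (Q.L s' h h') = (Q.op s' h h').R := LinearEquiv.apply_symm_apply _ _

theorem s_mul_L (a : A) : 1 ⊗ₜ s' a * Q.L s' h h' =
    sandwich (inL k A).toLinearMap (Q.L s' h h') (Q.Δ.toLinearMap ∘ₗ s')
      (TensorProduct.comm k A A (Q.Δ a)) := by
  apply (op₂ k A).injective
  have h1 := (Q.op s' h h').R_mul_s (MulOpposite.op a)
  have key (t : A ⊗[k] A) : op₂ k A (sandwich (inL k A).toLinearMap (Q.L s' h h')
      (Q.Δ.toLinearMap ∘ₗ s') (TensorProduct.comm k A A t)) =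
      sandwich ((Q.op s' h h').Δ.toLinearMap ∘ₗ (Q.op s' h h').s) (Q.op s' h h').R
        (inL k Aᵐᵒᵖ).toLinearMap (op₂ k A t) := by
    induction t using pure_induction₂ with
    | add x y hx hy => simp only [map_add, hx, hy]
    | tmul a b =>
      simp only [TensorProduct.comm_tmul, sandwich_tmul, op₂_mul, op₂_L, op₂_tmul, mul_assoc]
      rfl
  rw [key, op₂_mul, op₂_L]
  exact h1

theorem killLeft_L : killLeft Q.ε (Q.L s' h h') = 1 := by
  have h1 := (Q.op s' h h').killLeft_R
  rw [← op₂_L] at h1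
  exact MulOpposite.op_injective ((killLeft_op₂ Q.ε _).symm.trans h1)

/-- The mirror image of `υ`. -/
def υL : (A ⊗[k] A) ⊗[k] A →ₗ[k] (A ⊗[k] A) ⊗[k] A :=
  (op₃ k A).symm.toLinearMap ∘ₗ (Q.op s' h h').υ ∘ₗ (op₃ k A).toLinearMap

@[simp] lemma υL_tmul (a b c : A) : Q.υL s' h h' ((a ⊗ₜ b) ⊗ₜ c) =
    (b ⊗ₜ c) ⊗ₜ 1 * onLeft Q.Δ (Q.L s' h h') * onLeft Q.Δ (Q.Δ (s' a)) := by
  apply (op₃ k A).injective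
  rw [υL, LinearMap.comp_apply, LinearEquiv.coe_coe, LinearEquiv.apply_symm_apply,
    LinearMap.comp_apply, LinearEquiv.coe_coe, op₃_tmul, op₂_tmul, υ_tmul, op₃_mul, op₃_mul,
    ← onLeft_op₂, ← onLeft_op₂, op₂_L, mul_assoc]
  rfl

theorem shiftTwo_mul_onRight_L : shiftTwo k A (Q.L s' h h') * onRight Q.Δ (Q.L s' h h') =
    Q.υL s' h h' Q.Φ * Q.Φ := by
  apply (op₃ k A).injective
  rw [op₃_mul, op₃_mul, ← shiftTwo_op₂, ← onRight_op₂, op₂_L, υL, LinearMap.comp_apply,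
    LinearEquiv.coe_coe, LinearEquiv.apply_symm_apply]
  exact (Q.op s' h h').onRight_R_mul

theorem onRight_L_mul_R (a : A) : shiftTwo k A (Q.L s' h h') *
    onRight Q.Δ (Q.L s' h h' * Q.Δ a * Q.R) * shiftTwo k A Q.R =
    Q.υL s' h h' Q.Φ * onLeft Q.Δ (Q.Δ a) * Q.υ Q.Ψ := by
  calc _ = (shiftTwo k A (Q.L s' h h') * onRight Q.Δ (Q.L s' h h')) * onRight Q.Δ (Q.Δ a) *
        (onRight Q.Δ Q.R * shiftTwo k A Q.R) := by
        rw [map_mul, map_mul]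
        simp only [mul_assoc]
    _ = Q.υL s' h h' Q.Φ * (Q.Φ * onRight Q.Δ (Q.Δ a)) * (Q.Ψ * Q.υ Q.Ψ) := by
        rw [shiftTwo_mul_onRight_L, onRight_R_mul]
        simp only [mul_assoc]
    _ = _ := by
        rw [← Q.Δ_Φ, mul_assoc, mul_assoc, ← mul_assoc Q.Φ, Q.Φ_mul_Ψ, one_mul, ← mul_assoc]

end QuasiHopf

namespace CoquasiHopfAlgebra

open WithConv Coalgebra Bicoaction CoquasiBialgebra

variable {k H : Type*} [Field k] [AddCommGroup H] [Module k H] [Coalgebra k H]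
  [FiniteDimensional k H] (Q : CoquasiHopfAlgebra k H)

lemma starHAction_ract₂ (t : ConvDual k H ⊗[k] ConvDual k H) (f : Module.Dual k H) (x y : H) :
    Q.starHAction (ract₂ Q.starH (regular k H) t (f ⊗ₜ x)) y =
      pair k H H (Q.dualL * Q.dual.Δ (toConv f) *
        sandwich (Q.dual.Δ.toLinearMap ∘ₗ Q.dual.s) Q.dual.R (inL k _).toLinearMap t)
        (x ⊗ₜ y) := by
  have hb := regular_isBicomodule (k := k) (C := H)
  induction t using pure_induction₂ with
  | add x y hx hy =>
    simp only [ract₂_add, LinearMap.add_apply, map_add, mul_add, WithConv.ofConv_add, hx, hy]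
  | tmul a b =>
    rw [ract₂_tmul, starHAction_apply, starH_ract, toConv_ofConv, ← hb.ract_one y,
      pair_ract_tmul_ract, hb.ract_one]
    simp [mul_assoc]

lemma starHAction_lact₂ (t : ConvDual k H ⊗[k] ConvDual k H) (f : Module.Dual k H) (x y : H) :
    Q.starHAction (lact₂ Q.starH (regular k H) t (f ⊗ₜ x)) y =
      pair k H H (sandwich (inL k _).toLinearMap Q.dualL (Q.dual.Δ.toLinearMap ∘ₗ Q.dualSInv)
          (TensorProduct.comm k _ _ t) * Q.dual.Δ (toConv f) * Q.dual.R) (x ⊗ₜ y) := by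
  have hb := regular_isBicomodule (k := k) (C := H)
  induction t using pure_induction₂ with
  | add x y hx hy =>
    simp only [lact₂_add, LinearMap.add_apply, map_add, add_mul, WithConv.ofConv_add, hx, hy]
  | tmul a b =>
    rw [lact₂_tmul, starHAction_apply, starH_lact, toConv_ofConv, ← hb.lact_one y,
      pair_lact_tmul_lact, hb.lact_one]
    simp [mul_assoc]

lemma starHAction_isHom :
    (Q.tensor Q.starH (regular k H)).IsHom Q.starH Q.starHAction := by
  have hb := regular_isBicomodule (k := k) (C := H)
  rw [isHom_iff]
  refine ⟨fun a t ↦ ?_, fun a t ↦ ?_⟩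
  · induction t using pure_induction₂ with
    | add x y hx hy => simp only [map_add, hx, hy]
    | tmul f x =>
    refine LinearMap.ext fun y ↦ ?_
    rw [tensor_lact, starHAction_lact₂]
    have h1 := Q.dual.s_mul_L Q.dualSInv Q.dualSInv_s Q.s_dualSInv a
    refine (congrArg (fun W ↦ pair k H H (W * Q.dual.Δ (toConv f) * Q.dual.R) (x ⊗ₜ y))
      h1.symm).trans ?_
    rw [mul_assoc, mul_assoc, ← pair_lact_tmul_lact, hb.lact_one, ← mul_assoc,
      ← starHAction_apply, starH_lact]
    exact apply_regular_lact _ (toConv (Q.starHAction (f ⊗ₜ x))) y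
  · induction t using pure_induction₂ with
    | add x y hx hy => simp only [map_add, hx, hy]
    | tmul f x =>
    refine LinearMap.ext fun y ↦ ?_
    rw [tensor_ract, starHAction_ract₂]
    have h1 := Q.dual.R_mul_s a
    refine (congrArg (fun W ↦ pair k H H (Q.dualL * Q.dual.Δ (toConv f) * W) (x ⊗ₜ y))
      h1.symm).trans ?_
    rw [← mul_assoc, ← pair_ract_tmul_ract, hb.ract_one,
      ← starHAction_apply, starH_ract]
    exact apply_regular_ract _ (toConv (Q.starHAction (f ⊗ₜ x))) y

lemma starHAction_one (f : Module.Dual k H) : Q.starHAction (f ⊗ₜ Q.unit 1) = f := by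
  refine LinearMap.ext fun y ↦ ?_
  rw [starHAction_apply, ← pair_killLeft]
  have h1 := Q.dual.killLeft_L Q.dualSInv Q.dualSInv_s Q.s_dualSInv
  have h2 := Q.dual.killLeft_R
  have h3 := Q.dual.killLeft_Δ (toConv f)
  have h4 : killLeft Q.dualCounit (Q.dualL * Q.dual.Δ (toConv f) * Q.dual.R) = toConv f := by
    rw [map_mul, map_mul]
    refine (congrArg₂ (· * ·) (congrArg₂ (· * ·) h1 h3) h2).trans ?_
    simp
  rw [h4]

lemma pair₃_ract_tmul (V : (ConvDual k H ⊗[k] ConvDual k H) ⊗[k] ConvDual k H)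
    (a b : ConvDual k H) (x z y : H) :
    pair₃ k H V (((regular k H).ract a x ⊗ₜ (regular k H).ract b z) ⊗ₜ y) =
      pair₃ k H (V * (a ⊗ₜ b) ⊗ₜ 1) ((x ⊗ₜ z) ⊗ₜ y) := by
  induction V using pure_induction₂ with
  | add x y hx hy =>
    simp only [map_add, WithConv.ofConv_add, LinearMap.add_apply, hx, hy, add_mul]
  | tmul f g => simp [pair_ract_tmul_ract]

lemma pair₃_lact_tmul (V : (ConvDual k H ⊗[k] ConvDual k H) ⊗[k] ConvDual k H)
    (a b : ConvDual k H) (x z y : H) :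
    pair₃ k H V (((regular k H).lact a x ⊗ₜ (regular k H).lact b z) ⊗ₜ y) =
      pair₃ k H ((a ⊗ₜ b) ⊗ₜ 1 * V) ((x ⊗ₜ z) ⊗ₜ y) := by
  induction V using pure_induction₂ with
  | add x y hx hy =>
    simp only [map_add, WithConv.ofConv_add, LinearMap.add_apply, hx, hy, mul_add]
  | tmul f g => simp [pair_lact_tmul_lact]

/-- Evaluation in the first factor. -/
def evalFirst (x : H) : ConvDual k H ⊗[k] ConvDual k H →ₗ[k] ConvDual k H :=
  (TensorProduct.lid k _).toLinearMap ∘ₗ (LinearMap.applyₗ x ∘ₗ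
    (WithConv.linearEquiv k (H →ₗ[k] k)).toLinearMap).rTensor _

@[simp] lemma evalFirst_tmul (x : H) (f g : ConvDual k H) : evalFirst x (f ⊗ₜ g) = f x • g := rfl

lemma evalFirst_apply (x y : H) (W : ConvDual k H ⊗[k] ConvDual k H) :
    evalFirst x W y = pair k H H W (x ⊗ₜ y) := by
  induction W using pure_induction₂ with
  | add x y hx hy => simp only [map_add, WithConv.ofConv_add, LinearMap.add_apply, hx, hy]
  | tmul f g => simp

lemma pair_Δ_evalFirst (l r W : ConvDual k H ⊗[k] ConvDual k H) (x z y : H) :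
    pair k H H (l * Q.dual.Δ (evalFirst x W) * r) (z ⊗ₜ y) =
      pair₃ k H (shiftTwo k _ l * onRight Q.dual.Δ W * shiftTwo k _ r) ((x ⊗ₜ z) ⊗ₜ y) := by
  induction W using pure_induction₂ with
  | add x y hx hy =>
    simp only [map_add, WithConv.ofConv_add, LinearMap.add_apply, hx, hy, mul_add, add_mul]
  | tmul f g =>
    have h1 (t : ConvDual k H ⊗[k] ConvDual k H) : shiftTwo k _ t =
        (Algebra.TensorProduct.assoc k k k _ _ _).symm (1 ⊗ₜ t) := by
      induction t using pure_induction₂ with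
      | add x y hx hy => simp only [map_add, TensorProduct.tmul_add, hx, hy]
      | tmul f g => simp
    rw [h1, h1, onRight_tmul, ← map_mul, ← map_mul,
      Algebra.TensorProduct.tmul_mul_tmul, Algebra.TensorProduct.tmul_mul_tmul, pair₃_assoc_symm]
    simp

lemma starHAction_associator (T U : (ConvDual k H ⊗[k] ConvDual k H) ⊗[k] ConvDual k H)
    (f : Module.Dual k H) (x z y : H) :
    Q.starHAction (Q.mul.toLinearMap.lTensor _ (TensorProduct.assoc k _ H H
      (ract₃ Q.starH (regular k H) (regular k H) U (lact₃ Q.starH (regular k H) (regular k H) T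
        ((f ⊗ₜ x) ⊗ₜ z))))) y =
    pair₃ k H (Q.dual.υL Q.dualSInv Q.dualSInv_s Q.s_dualSInv T *
      onLeft Q.dual.Δ (Q.dual.Δ (toConv f)) * Q.dual.υ U) ((x ⊗ₜ z) ⊗ₜ y) := by
  induction T using pure_induction₃ with
  | add x y hx hy =>
    simp only [lact₃_add, LinearMap.add_apply, map_add, add_mul, WithConv.ofConv_add, hx, hy]
  | tmul a₁ a₂ a₃ =>
  induction U using pure_induction₃ with
  | add x y hx hy =>
    simp only [ract₃_add, LinearMap.add_apply, map_add, mul_add, WithConv.ofConv_add, hx, hy]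
  | tmul b₁ b₂ b₃ =>
  have hb := regular_isBicomodule (k := k) (C := H)
  simp only [ract₂_tmul, lact₂_tmul, lact₃_tmul, ract₃_tmul, TensorProduct.assoc_tmul,
    LinearMap.lTensor_tmul, starHAction_apply, starH_ract, starH_lact, toConv_ofConv,
    ← hb.lact_ract]
  refine (Q.pair₃_onLeft _ _ _).symm.trans ?_
  rw [pair₃_lact_tmul, pair₃_ract_tmul, QuasiHopf.υL_tmul, QuasiHopf.υ_tmul]
  simp only [map_mul, mul_assoc]
  rfl

theorem starH_isHopfModule : Q.IsHopfModule Q.starH Q.starHAction where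
  isBicomodule := Q.starH_isBicomodule
  isHom := Q.starHAction_isHom
  act_one := Q.starHAction_one
  act_act := by
    refine TensorProduct.ext_threefold fun f x z ↦ LinearMap.ext fun y ↦ ?_
    simp only [LinearMap.comp_apply, LinearMap.rTensor_tmul, associator_eq, LinearEquiv.coe_coe]
    rw [starHAction_associator, starHAction_apply]
    have h1 : toConv (Q.starHAction (f ⊗ₜ x)) =
        evalFirst x (Q.dualL * Q.dual.Δ (toConv f) * Q.dual.R) := by
      ext y
      rw [evalFirst_apply, ← starHAction_apply]
    rw [h1, pair_Δ_evalFirst, QuasiHopf.onRight_L_mul_R]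
    rfl

end CoquasiHopfAlgebra

/-! ### Hopf modules and their coinvariants -/

namespace Bicoaction

open WithConv Coalgebra

variable {k C M : Type*} [Field k] [AddCommGroup C] [Module k C] [AddCommGroup M] [Module k M]

/-- `a ⊗ x ↦ (∑ a(m₋₁) m₀) ⊗ x` -/
def insert (X : Bicoaction k C M) (t : ConvDual k C ⊗[k] C) : M →ₗ[k] M ⊗[k] C :=
  LinearMap.applyₗ t ∘ₗ LinearMap.rTensorHom C ∘ₗ X.lact.flip

@[simp] lemma insert_tmul (X : Bicoaction k C M) (a : ConvDual k C) (x : C) (m : M) :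
    X.insert (a ⊗ₜ x) m = X.lact a m ⊗ₜ x := rfl

@[simp] lemma insert_add (X : Bicoaction k C M) (t t' : ConvDual k C ⊗[k] C) :
    X.insert (t + t') = X.insert t + X.insert t' := by
  simp only [insert, map_add, LinearMap.add_comp]

@[simp] lemma insert_smul (X : Bicoaction k C M) (c : k) (t : ConvDual k C ⊗[k] C) :
    X.insert (c • t) = c • X.insert t := by
  simp only [insert, map_smul, LinearMap.smul_comp]

/-- `(a ⊗ b) ⊗ x ↦ (∑ b(m₋₁) m₀ a(m₁)) ⊗ x` -/
def insert₂ (X : Bicoaction k C M) (m : M) :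
    (ConvDual k C ⊗[k] ConvDual k C) ⊗[k] C →ₗ[k] M ⊗[k] C :=
  (TensorProduct.lift (X.ract.compl₂ (X.lact.flip m))).rTensor C

variable (k C) in
/-- The canonical element `∑ eⁱ ⊗ eᵢ`. -/
def canonical [FiniteDimensional k C] : ConvDual k C ⊗[k] C :=
  (WithConv.linearEquiv k (C →ₗ[k] k)).symm.toLinearMap.rTensor C
    (TensorProduct.comm k C (Module.Dual k C) (coevaluation k C 1))

lemma slice_canonical [FiniteDimensional k C] (a : ConvDual k C) :
    slice a (canonical k C) = a := by
  refine CoquasiHopfAlgebra.apply_coevaluation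
    (slice a ∘ₗ (WithConv.linearEquiv k (C →ₗ[k] k)).symm.toLinearMap.rTensor C ∘ₗ
      (TensorProduct.comm k C (Module.Dual k C)).toLinearMap) a.ofConv
    (WithConv.linearEquiv k (C →ₗ[k] k)).symm.toLinearMap fun e g ↦ ?_
  simp

/-- `slice`, as a linear map in the functional. -/
def sliceBy {C N : Type*} [AddCommGroup C] [Module k C] [AddCommGroup N] [Module k N]
    (t : N ⊗[k] C) : ConvDual k C →ₗ[k] N where
  toFun a := slice a t
  map_add' a b := by
    induction t using pure_induction₂ with
    | add x y hx hy => simp only [map_add, hx, hy]; abel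
    | tmul n x => simp [add_smul]
  map_smul' c a := by
    induction t using pure_induction₂ with
    | add x y hx hy => simp only [map_add, smul_add, hx, hy]
    | tmul n x => simp [mul_smul]

lemma sliceBy_apply (t : M ⊗[k] C) (a : ConvDual k C) : sliceBy t a = slice a t := rfl

lemma sliceBy_add (t t' : M ⊗[k] C) : sliceBy (t + t') = sliceBy t + sliceBy t' :=
  LinearMap.ext fun a ↦ by simp [sliceBy_apply]

@[simp] lemma insert₂_tmul (X : Bicoaction k C M) (m : M) (a b : ConvDual k C) (x : C) :
    X.insert₂ m ((a ⊗ₜ b) ⊗ₜ x) = X.ract a (X.lact b m) ⊗ₜ x := by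
  simp [insert₂]

lemma eq_of_forall_apply_eq {x y : C} (h : ∀ c : ConvDual k C, c x = c y) : x = y := by
  rw [← sub_eq_zero, ← Module.forall_dual_apply_eq_zero_iff k]
  intro f
  rw [map_sub, sub_eq_zero]
  exact h (toConv f)

end Bicoaction

namespace CoquasiHopfAlgebra

open WithConv Coalgebra Bicoaction CoquasiBialgebra

variable {k H M : Type*} [Field k] [AddCommGroup H] [Module k H] [Coalgebra k H]
  [FiniteDimensional k H] (Q : CoquasiHopfAlgebra k H) [AddCommGroup M] [Module k M]
  (X : Bicoaction k H M) (act : M ⊗[k] H →ₗ[k] M)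

/-- The element of `H^* ⊗ H` that corresponds to `x ↦ ∑ α(S̄(x)₁) S̄(x)₂`. -/
def twist : ConvDual k H ⊗[k] H :=
  (LinearMap.mulRight k (Q.dualSInv Q.dual.α) ∘ₗ Q.dualSInv).rTensor H (canonical k H)

lemma slice_twist (a : ConvDual k H) :
    slice a Q.twist = Q.dualSInv a * Q.dualSInv Q.dual.α := by
  rw [twist, slice_rTensor, slice_canonical]
  rfl

/-- The projection of a Hopf module onto its coinvariants. -/
def coinvProj : M →ₗ[k] M := act ∘ₗ X.insert Q.twist

/-- The inverse of the action of `H` on the coinvariants of a Hopf module. -/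
def coinvInv : M →ₗ[k] M ⊗[k] H :=
  (Q.coinvProj X act).rTensor H ∘ₗ
    ract₂ X (regular k H) (Q.dualSInv.lTensor _ Q.dual.p) ∘ₗ X.insert (canonical k H)

variable {X act}

lemma lact₂_insert (hX : X.IsBicomodule) (a b : ConvDual k H) (t : ConvDual k H ⊗[k] H) (m : M) :
    lact₂ X (regular k H) (a ⊗ₜ b) (X.insert t m) =
      X.insert (TensorProduct.map (LinearMap.mulRight k a) ((regular k H).lact b) t) m := by
  induction t using pure_induction₂ with
  | add x y hx hy => simp only [insert_add, LinearMap.add_apply, map_add, hx, hy]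
  | tmul c x => simp [hX.lact_mul]

lemma slice_mulRight_lact (a b c : ConvDual k H) (t : ConvDual k H ⊗[k] H) :
    slice c (TensorProduct.map (LinearMap.mulRight k a) ((regular k H).lact b) t) =
      slice (b * c) t * a := by
  induction t using pure_induction₂ with
  | add x y hx hy => simp only [map_add, add_mul, hx, hy]
  | tmul d x => simp [apply_regular_lact]

lemma exists_lact₂_insert_twist (hX : X.IsBicomodule) (d : ConvDual k H ⊗[k] ConvDual k H) (m : M) :
    ∃ t, lact₂ X (regular k H) d (X.insert Q.twist m) = X.insert t m ∧
      ∀ c, slice c t = Q.dualSInv c * Q.dualSInv (sandwich Q.dual.s Q.dual.α LinearMap.id d) := by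
  induction d using pure_induction₂ with
  | add x y hx hy =>
    obtain ⟨t, ht, ht'⟩ := hx
    obtain ⟨u, hu, hu'⟩ := hy
    exact ⟨t + u, by simp only [lact₂_add, insert_add, LinearMap.add_apply, ht, hu],
      fun c ↦ by simp only [map_add, mul_add, ht', hu']⟩
  | tmul a b =>
    refine ⟨_, lact₂_insert hX a b _ m, fun c ↦ ?_⟩
    rw [slice_mulRight_lact, slice_twist]
    simp only [Q.dual.inv_s_mul _ Q.dualSInv_s Q.s_dualSInv, sandwich_tmul, LinearMap.id_apply,
      Q.dualSInv_s, mul_assoc]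

lemma lact_coinvProj (hM : Q.IsHopfModule X act) (a : ConvDual k H) (m : M) :
    X.lact a (Q.coinvProj X act m) = Q.dual.ε a • Q.coinvProj X act m := by
  obtain ⟨t, ht, ht'⟩ := Q.exists_lact₂_insert_twist hM.isBicomodule (Q.dual.Δ a) m
  have h1 : t = Q.dual.ε a • Q.twist := by
    refine slice_ext fun c ↦ ?_
    rw [ht', Q.dual.s_α, map_smul, map_smul, slice_twist, mul_smul_comm]
  have h2 := (isHom_iff.mp hM.isHom).1 a (X.insert Q.twist m)
  rw [tensor_lact] at h2
  refine h2.symm.trans ?_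
  refine (congrArg act ht).trans ?_
  rw [h1, insert_smul, LinearMap.smul_apply, map_smul]
  rfl

lemma act_act_insert (hM : Q.IsHopfModule X act) (t : ConvDual k H ⊗[k] H) (u : M ⊗[k] H) :
    act ((act ∘ₗ X.insert t).rTensor H u) = act (Q.mul.toLinearMap.lTensor M
      (TensorProduct.assoc k M H H (ract₃ X (regular k H) (regular k H) Q.dual.Ψ
        (lact₃ X (regular k H) (regular k H) Q.dual.Φ ((X.insert t).rTensor H u))))) := by
  have h1 := LinearMap.congr_fun hM.act_act ((X.insert t).rTensor H u)
  rw [associator_eq] at h1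
  refine Eq.trans ?_ h1
  rw [LinearMap.rTensor_comp]
  rfl

lemma exists_insert₂ (hX : X.IsBicomodule) (x₁ x₂ x₃ y₁ y₂ y₃ q₁ q₂ : ConvDual k H)
    (t t' : ConvDual k H ⊗[k] H) (m : M) :
    ∃ τ, Q.mul.toLinearMap.lTensor M (TensorProduct.assoc k M H H
      (ract₃ X (regular k H) (regular k H) ((x₁ ⊗ₜ x₂) ⊗ₜ x₃)
        (lact₃ X (regular k H) (regular k H) ((y₁ ⊗ₜ y₂) ⊗ₜ y₃) ((X.insert t').rTensor H
          (ract₂ X (regular k H) (q₁ ⊗ₜ q₂) (X.insert t m)))))) = X.insert₂ m τ ∧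
      ∀ c, slice c τ = (x₁ * q₁) ⊗ₜ (mulMap
        (sliceBy t ∘ₗ LinearMap.mulLeftRight k (y₃, x₃ * q₂))
        (sliceBy t' ∘ₗ LinearMap.mulLeftRight k (y₂, x₂))
        (TensorProduct.comm k _ _ (Q.dual.Δ c)) * y₁) := by
  induction t using pure_induction₂ with
  | add x y hx hy =>
    obtain ⟨τ, hτ, hτ'⟩ := hx
    obtain ⟨σ, hσ, hσ'⟩ := hy
    refine ⟨τ + σ, by simp only [insert_add, LinearMap.add_apply, map_add, hτ, hσ], fun c ↦ ?_⟩
    rw [map_add, hτ', hσ', ← TensorProduct.tmul_add, ← add_mul]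
    congr 2
    generalize TensorProduct.comm k _ _ (Q.dual.Δ c) = d
    induction d using pure_induction₂ with
    | add x y hx hy => simp only [map_add, ← hx, ← hy]; abel
    | tmul a b =>
      simp only [mulMap_tmul, LinearMap.comp_apply, sliceBy_add,
        LinearMap.add_apply, add_mul]
  | tmul d y =>
  induction t' using pure_induction₂ with
  | add x y hx hy =>
    obtain ⟨τ, hτ, hτ'⟩ := hx
    obtain ⟨σ, hσ, hσ'⟩ := hy
    refine ⟨τ + σ, ?_, fun c ↦ ?_⟩
    · simp only [insert_add, LinearMap.rTensor_add, LinearMap.add_apply, map_add, hτ, hσ]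
    rw [map_add, hτ', hσ', ← TensorProduct.tmul_add, ← add_mul]
    congr 2
    generalize TensorProduct.comm k _ _ (Q.dual.Δ c) = d
    induction d using pure_induction₂ with
    | add x y hx hy => simp only [map_add, ← hx, ← hy]; abel
    | tmul a b =>
      simp only [mulMap_tmul, LinearMap.comp_apply, sliceBy_add,
        LinearMap.add_apply, mul_add]
  | tmul d' y' =>
  have hb := regular_isBicomodule (k := k) (C := H)
  refine ⟨((x₁ * q₁) ⊗ₜ (d * d' * y₁)) ⊗ₜ Q.mul ((regular k H).ract x₂ ((regular k H).lact y₂ y') ⊗ₜ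
    (regular k H).ract x₃ ((regular k H).lact y₃ ((regular k H).ract q₂ y))), ?_, fun c ↦ ?_⟩
  · simp only [insert_tmul, ract₂_tmul, LinearMap.rTensor_tmul, lact₃_tmul, lact₂_tmul,
      ract₃_tmul, TensorProduct.assoc_tmul, LinearMap.lTensor_tmul, insert₂_tmul, hX.lact_mul,
      hX.ract_mul, hX.lact_ract]
    rfl
  · rw [slice_tmul, ← Q.pair_dualComul]
    change pair k H H (Q.dual.Δ c) _ • _ = _
    rw [← TensorProduct.tmul_smul]
    congr 1
    induction Q.dual.Δ c using pure_induction₂ with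
    | add x y hx hy =>
      simp only [map_add, WithConv.ofConv_add, LinearMap.add_apply, add_mul, add_smul, hx, hy]
    | tmul a b =>
      simp only [pair_tmul, apply_regular_lact, apply_regular_ract, ← hb.lact_ract,
        TensorProduct.comm_tmul, mulMap_tmul, LinearMap.comp_apply, sliceBy_apply, slice_tmul,
        LinearMap.mulLeftRight_apply]
      rw [mul_comm]
      simp only [mul_assoc, smul_mul_assoc, mul_smul_comm, mul_smul]
      exact smul_comm _ _ _

lemma sandwich_add_mid {M N E : Type*} [AddCommGroup M] [Module k M] [AddCommGroup N] [Module k N]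
    [Ring E] [Algebra k E] (f : M →ₗ[k] E) (x y : E) (g : N →ₗ[k] E) (t : M ⊗[k] N) :
    sandwich f (x + y) g t = sandwich f x g t + sandwich f y g t := by
  induction t using pure_induction₂ with
  | add x y hx hy => simp only [map_add, hx, hy]; abel
  | tmul a b => simp [mul_add, add_mul]

lemma exists_insert₂_twist (hX : X.IsBicomodule)
    (T U V : (ConvDual k H ⊗[k] ConvDual k H) ⊗[k] ConvDual k H) (m : M) :
    ∃ τ, Q.mul.toLinearMap.lTensor M (TensorProduct.assoc k M H H
      (ract₃ X (regular k H) (regular k H) U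
        (lact₃ X (regular k H) (regular k H) T ((X.insert Q.twist).rTensor H
          (ract₂ X (regular k H) (Q.dualSInv.lTensor _ (Q.dual.foldβ V))
            (X.insert (canonical k H) m)))))) = X.insert₂ m τ ∧
      ∀ c, slice c τ = Q.dualSInv.lTensor _
        (sandwich (sandwich ((inR k _).toLinearMap ∘ₗ Q.dual.s) (1 ⊗ₜ Q.dual.α)
          (inR k _).toLinearMap) (sandwich (inR k _).toLinearMap (Q.dual.foldβ (U * V))
          ((inR k _).toLinearMap ∘ₗ Q.dual.s) (Q.dual.Δ c))
          ((inR k _).toLinearMap ∘ₗ Q.dual.s) T) := by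
  induction T using pure_induction₃ with
  | add x y hx hy =>
    obtain ⟨τ, hτ, hτ'⟩ := hx
    obtain ⟨σ, hσ, hσ'⟩ := hy
    exact ⟨τ + σ, by simp only [lact₃_add, LinearMap.add_apply, map_add, hτ, hσ],
      fun c ↦ by simp only [map_add, hτ', hσ']⟩
  | tmul y₁ y₂ y₃ =>
  induction U using pure_induction₃ with
  | add x y hx hy =>
    obtain ⟨τ, hτ, hτ'⟩ := hx
    obtain ⟨σ, hσ, hσ'⟩ := hy
    exact ⟨τ + σ, by simp only [ract₃_add, LinearMap.add_apply, map_add, hτ, hσ],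
      fun c ↦ by simp only [map_add, add_mul, sandwich_add_mid, hτ', hσ']⟩
  | tmul x₁ x₂ x₃ =>
  induction V using pure_induction₃ with
  | add x y hx hy =>
    obtain ⟨τ, hτ, hτ'⟩ := hx
    obtain ⟨σ, hσ, hσ'⟩ := hy
    exact ⟨τ + σ, by simp only [ract₂_add, LinearMap.add_apply, map_add, hτ, hσ],
      fun c ↦ by simp only [map_add, mul_add, sandwich_add_mid, hτ', hσ']⟩
  | tmul z₁ z₂ z₃ =>
  obtain ⟨τ, hτ, hτ'⟩ := Q.exists_insert₂ hX x₁ x₂ x₃ y₁ y₂ y₃ z₁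
    (Q.dualSInv (z₂ * Q.dual.β * Q.dual.s z₃)) (canonical k H) Q.twist m
  refine ⟨τ, by rw [← hτ, QuasiHopf.foldβ_tmul, LinearMap.lTensor_tmul], fun c ↦ ?_⟩
  rw [hτ']
  induction Q.dual.Δ c using pure_induction₂ with
  | add x y hx hy =>
    simp only [map_add, add_mul, TensorProduct.tmul_add, sandwich_add_mid, hx, hy]
  | tmul a b =>
    simp only [TensorProduct.comm_tmul, mulMap_tmul, LinearMap.comp_apply, sliceBy_apply,
      slice_canonical, slice_twist, LinearMap.mulLeftRight_apply, sandwich_tmul,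
      AlgHom.toLinearMap_apply, Algebra.TensorProduct.includeRight_apply,
      Algebra.TensorProduct.tmul_mul_tmul, QuasiHopf.foldβ_tmul, LinearMap.lTensor_tmul,
      _root_.one_mul, _root_.mul_one, Q.dual.inv_s_mul _ Q.dualSInv_s Q.s_dualSInv, Q.dualSInv_s,
      mul_assoc]

end CoquasiHopfAlgebra

namespace QuasiHopf

variable {k A : Type*} [Field k] [Ring A] [Algebra k A] (Q : QuasiHopf k A)
  (s' : A →ₗ[k] A) (h : ∀ a, s' (Q.s a) = a) (h' : ∀ a, Q.s (s' a) = a)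

/-- The mirror image of `p_triangle`. -/
theorem op_p_triangle : sandwich (inR k A).toLinearMap ((op₂ k A).symm (Q.op s' h h').p)
    Q.Δ.toLinearMap (TensorProduct.comm k A A (s'.lTensor A Q.p)) = 1 := by
  have key (T : (A ⊗[k] A) ⊗[k] A) : op₂ k A (sandwich (inR k A).toLinearMap
      ((op₂ k A).symm (Q.op s' h h').p) Q.Δ.toLinearMap
        (TensorProduct.comm k A A (s'.lTensor A (Q.foldβ T)))) =
      sandwich (sandwich (Q.op s' h h').Δ.toLinearMap (Q.op s' h h').p
        ((inR k Aᵐᵒᵖ).toLinearMap ∘ₗ (Q.op s' h h').s)) (1 ⊗ₜ (Q.op s' h h').α)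
        (inR k Aᵐᵒᵖ).toLinearMap (op₃ k A T) := by
    induction T using pure_induction₃ with
    | add x y hx hy => simp only [map_add, hx, hy]
    | tmul a b c =>
      simp only [foldβ_tmul, LinearMap.lTensor_tmul, TensorProduct.comm_tmul, sandwich_tmul,
        op₂_mul, LinearEquiv.apply_symm_apply, Q.inv_s_mul s' h h', h, AlgHom.toLinearMap_apply,
        Algebra.TensorProduct.includeRight_apply, op₂_tmul, op₃_tmul, mul_assoc,
        LinearMap.comp_apply, Algebra.TensorProduct.tmul_mul_tmul, one_mul, MulOpposite.op_mul,
        MulOpposite.op_one]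
      rfl
  apply (op₂ k A).injective
  exact (key Q.Φ).trans (Q.op s' h h').p_triangle

end QuasiHopf

namespace CoquasiHopfAlgebra

open WithConv Coalgebra Bicoaction CoquasiBialgebra

variable {k H M : Type*} [Field k] [AddCommGroup H] [Module k H] [Coalgebra k H]
  [FiniteDimensional k H] (Q : CoquasiHopfAlgebra k H) [AddCommGroup M] [Module k M]
  {X : Bicoaction k H M} {act : M ⊗[k] H →ₗ[k] M}

theorem act_coinvInv (hM : Q.IsHopfModule X act) (m : M) : act (Q.coinvInv X act m) = m := by
  obtain ⟨τ, hτ, hτ'⟩ := Q.exists_insert₂_twist hM.isBicomodule Q.dual.Φ Q.dual.Ψ Q.dual.Φ m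
  have h1 : τ = (1 ⊗ₜ 1) ⊗ₜ Q.unit 1 := by
    refine slice_ext fun c ↦ ?_
    have e1 (t : ConvDual k H ⊗[k] ConvDual k H) : sandwich (inR k _).toLinearMap
        (1 ⊗ₜ Q.dual.β) ((inR k _).toLinearMap ∘ₗ Q.dual.s) t =
        1 ⊗ₜ sandwich LinearMap.id Q.dual.β Q.dual.s t := by
      induction t using pure_induction₂ with
      | add x y hx hy => simp only [map_add, TensorProduct.tmul_add, hx, hy]
      | tmul a b => simp
    have e2 (t : (ConvDual k H ⊗[k] ConvDual k H) ⊗[k] ConvDual k H) :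
        sandwich (sandwich ((inR k _).toLinearMap ∘ₗ Q.dual.s) (1 ⊗ₜ Q.dual.α)
          (inR k _).toLinearMap) (Q.dual.ε c • 1 ⊗ₜ Q.dual.β)
          ((inR k _).toLinearMap ∘ₗ Q.dual.s) t =
        Q.dual.ε c • 1 ⊗ₜ sandwich (sandwich Q.dual.s Q.dual.α LinearMap.id) Q.dual.β
          Q.dual.s t := by
      induction t using pure_induction₃ with
      | add x y hx hy => simp only [map_add, TensorProduct.tmul_add, smul_add, hx, hy]
      | tmul a b => simp
    have e3 : Q.dual.foldβ 1 = 1 ⊗ₜ Q.dual.β := by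
      simp [Algebra.TensorProduct.one_def]
    have e4 : Q.dualSInv 1 = 1 := by
      have := Q.dualSInv_s 1
      rwa [Q.dual.s_one] at this
    rw [hτ', Q.dual.Ψ_mul_Φ, e3, e1, Q.dual.β_s, TensorProduct.tmul_smul, e2, Q.dual.Φ_s,
      map_smul, LinearMap.lTensor_tmul, e4, slice_tmul]
    rfl
  refine (Q.act_act_insert hM Q.twist _).trans ?_
  refine (congrArg act hτ).trans ?_
  rw [h1, insert₂_tmul, hM.isBicomodule.lact_one, hM.isBicomodule.ract_one, hM.act_one]

lemma lact₂_coinv {w : M} (hw : ∀ a, X.lact a w = Q.dual.ε a • w)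
    (d : ConvDual k H ⊗[k] ConvDual k H) (x : H) : lact₂ X (regular k H) d (w ⊗ₜ x) =
      w ⊗ₜ (regular k H).lact (killLeft Q.dual.ε d) x := by
  induction d using pure_induction₂ with
  | add x y hx hy =>
    simp only [lact₂_add, map_add, LinearMap.add_apply, TensorProduct.tmul_add, hx, hy]
  | tmul a b => simp [hw, TensorProduct.smul_tmul]

lemma lact_act_coinv (hM : Q.IsHopfModule X act) {w : M} (hw : ∀ a, X.lact a w = Q.dual.ε a • w)
    (a : ConvDual k H) (x : H) :
    X.lact a (act (w ⊗ₜ x)) = act (w ⊗ₜ (regular k H).lact a x) := by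
  rw [← (isHom_iff.mp hM.isHom).1, tensor_lact]
  exact congrArg act ((Q.lact₂_coinv hw _ _).trans (congrArg (fun b ↦ w ⊗ₜ (regular k H).lact b x)
    (Q.dual.killLeft_Δ a)))

lemma lact₃_coinv {w : M} (hw : ∀ a, X.lact a w = Q.dual.ε a • w)
    (T : (ConvDual k H ⊗[k] ConvDual k H) ⊗[k] ConvDual k H) (x y : H) :
    lact₃ X (regular k H) (regular k H) T ((w ⊗ₜ x) ⊗ₜ y) =
      (TensorProduct.assoc k M H H).symm
        (w ⊗ₜ lact₂ (regular k H) (regular k H) (killFirst Q.dual.ε T) (x ⊗ₜ y)) := by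
  induction T using pure_induction₂ with
  | add x y hx hy =>
    simp only [lact₃_add, lact₂_add, map_add, LinearMap.add_apply, TensorProduct.tmul_add, hx, hy]
  | tmul t c =>
    rw [lact₃_tmul, Q.lact₂_coinv hw, killFirst_tmul, lact₂_tmul, TensorProduct.assoc_symm_tmul]

lemma lact₃_Φ_coinv {w : M} (hw : ∀ a, X.lact a w = Q.dual.ε a • w) (x y : H) :
    lact₃ X (regular k H) (regular k H) Q.dual.Φ ((w ⊗ₜ x) ⊗ₜ y) = (w ⊗ₜ x) ⊗ₜ y := by
  have hb := regular_isBicomodule (k := k) (C := H)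
  rw [Q.lact₃_coinv hw, Q.dual.killFirst_Φ, Algebra.TensorProduct.one_def, lact₂_tmul,
    hb.lact_one, hb.lact_one, TensorProduct.assoc_symm_tmul]

lemma lact_ract_coinv (hX : X.IsBicomodule) {w : M} (hw : ∀ a, X.lact a w = Q.dual.ε a • w)
    (b a : ConvDual k H) : X.lact a (X.ract b w) = Q.dual.ε a • X.ract b w := by
  rw [hX.lact_ract, hw, map_smul]

/-- Evaluation in the second factor. -/
def evalSecond (x : H) : ConvDual k H ⊗[k] ConvDual k H →ₗ[k] ConvDual k H :=
  (TensorProduct.rid k _).toLinearMap ∘ₗ (LinearMap.applyₗ x ∘ₗ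
    (WithConv.linearEquiv k (H →ₗ[k] k)).toLinearMap).lTensor _

@[simp] lemma evalSecond_tmul (x : H) (f g : ConvDual k H) : evalSecond x (f ⊗ₜ g) = g x • f := rfl

/-- `∑ b ⊗ y ↦ ∑ (w ⊗ (z ↼ b)) ⊗ y` -/
def insertRegular (w : M) (z : H) : ConvDual k H ⊗[k] H →ₗ[k] (M ⊗[k] H) ⊗[k] H :=
  (TensorProduct.mk k M H w ∘ₗ (regular k H).lact.flip z).rTensor H

@[simp] lemma insertRegular_tmul (w : M) (z : H) (b : ConvDual k H) (y : H) :
    insertRegular w z (b ⊗ₜ y) = (w ⊗ₜ (regular k H).lact b z) ⊗ₜ y := rfl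

lemma insert_act_coinv (hM : Q.IsHopfModule X act) {w : M}
    (hw : ∀ a, X.lact a w = Q.dual.ε a • w) (t : ConvDual k H ⊗[k] H) (z : H) :
    X.insert t (act (w ⊗ₜ z)) = act.rTensor H (insertRegular w z t) := by
  induction t using pure_induction₂ with
  | add x y hx hy => simp only [insert_add, LinearMap.add_apply, map_add, hx, hy]
  | tmul b y => rw [insert_tmul, Q.lact_act_coinv hM hw, insertRegular_tmul, LinearMap.rTensor_tmul]

lemma exists_ract₃_insertRegular (w : M) (z : H) (x₁ x₂ x₃ : ConvDual k H)
    (t : ConvDual k H ⊗[k] H) : ∃ y, Q.mul.toLinearMap.lTensor M (TensorProduct.assoc k M H H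
      (ract₃ X (regular k H) (regular k H) ((x₁ ⊗ₜ x₂) ⊗ₜ x₃) (insertRegular w z t))) =
      X.ract x₁ w ⊗ₜ y ∧ ∀ c : ConvDual k H, c y =
        mulMap (sliceBy t ∘ₗ LinearMap.mulRight k x₃) (LinearMap.mulRight k x₂)
          (TensorProduct.comm k _ _ (Q.dual.Δ c)) z := by
  induction t using pure_induction₂ with
  | add x y hx hy =>
    obtain ⟨u, hu, hu'⟩ := hx
    obtain ⟨v, hv, hv'⟩ := hy
    refine ⟨u + v, by simp only [map_add, TensorProduct.tmul_add, hu, hv], fun c ↦ ?_⟩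
    rw [map_add, hu', hv', ← LinearMap.add_apply, ← WithConv.ofConv_add]
    congr 2
    generalize TensorProduct.comm k _ _ (Q.dual.Δ c) = d
    induction d using pure_induction₂ with
    | add x y hx hy => simp only [map_add, ← hx, ← hy]; abel
    | tmul a b => simp only [mulMap_tmul, LinearMap.comp_apply, sliceBy_add, LinearMap.add_apply,
        add_mul]
  | tmul d y =>
  refine ⟨Q.mul ((regular k H).ract x₂ ((regular k H).lact d z) ⊗ₜ (regular k H).ract x₃ y),
    by simp, fun c ↦ ?_⟩
  have hb := regular_isBicomodule (k := k) (C := H)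
  rw [← Q.pair_dualComul]
  change pair k H H (Q.dual.Δ c) _ = _
  induction Q.dual.Δ c using pure_induction₂ with
  | add x y hx hy => simp only [map_add, WithConv.ofConv_add, LinearMap.add_apply, hx, hy]
  | tmul a b =>
    simp only [pair_tmul, apply_regular_lact, apply_regular_ract, ← hb.lact_ract,
      TensorProduct.comm_tmul, mulMap_tmul, LinearMap.comp_apply, sliceBy_apply, slice_tmul,
      LinearMap.mulRight_apply, smul_mul_assoc, mul_assoc]
    rw [mul_comm]
    rfl

lemma ract₃_insertRegular_twist (w : M) (z : H)
    (T : (ConvDual k H ⊗[k] ConvDual k H) ⊗[k] ConvDual k H) :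
    Q.mul.toLinearMap.lTensor M (TensorProduct.assoc k M H H
      (ract₃ X (regular k H) (regular k H) T (insertRegular w z Q.twist))) =
      X.ract (evalSecond z ((op₂ k _).symm (Q.dualOp.foldβ (op₃ k _ T)))) w ⊗ₜ Q.unit 1 := by
  induction T using pure_induction₃ with
  | add x y hx hy =>
    simp only [ract₃_add, LinearMap.add_apply, map_add, TensorProduct.add_tmul, hx, hy]
  | tmul x₁ x₂ x₃ =>
  obtain ⟨y, hy, hy'⟩ := Q.exists_ract₃_insertRegular (X := X) w z x₁ x₂ x₃ Q.twist
  rw [hy, QuasiHopf.op_foldβ_op₃, LinearEquiv.symm_apply_apply, evalSecond_tmul, map_smul,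
    LinearMap.smul_apply, TensorProduct.smul_tmul]
  congr 1
  refine eq_of_forall_apply_eq (k := k) fun c ↦ ?_
  rw [hy']
  have h1 (d : ConvDual k H ⊗[k] ConvDual k H) :
      mulMap (sliceBy Q.twist ∘ₗ LinearMap.mulRight k x₃) (LinearMap.mulRight k x₂)
          (TensorProduct.comm k _ _ d) = Q.dualSInv x₃ *
        Q.dualSInv (sandwich Q.dual.s Q.dual.α LinearMap.id d) * x₂ := by
    induction d using pure_induction₂ with
    | add x y hx hy => simp only [map_add, mul_add, add_mul, hx, hy]
    | tmul a b =>
      simp only [TensorProduct.comm_tmul, mulMap_tmul, LinearMap.comp_apply, sliceBy_apply,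
        slice_twist, LinearMap.mulRight_apply, sandwich_tmul, LinearMap.id_apply,
        Q.dual.inv_s_mul _ Q.dualSInv_s Q.s_dualSInv, Q.dualSInv_s, mul_assoc]
  rw [h1, Q.dual.s_α, map_smul, mul_smul_comm, smul_mul_assoc, map_smul]
  exact mul_comm (Q.dual.ε c) _

lemma coinvProj_act (hM : Q.IsHopfModule X act) {w : M}
    (hw : ∀ a, X.lact a w = Q.dual.ε a • w) (z : H) :
    Q.coinvProj X act (act (w ⊗ₜ z)) =
      X.ract (evalSecond z ((op₂ k _).symm Q.dualOp.p)) w := by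
  have h1 (t : ConvDual k H ⊗[k] H) :
      lact₃ X (regular k H) (regular k H) Q.dual.Φ (insertRegular w z t) =
        insertRegular w z t := by
    induction t using pure_induction₂ with
    | add x y hx hy => simp only [map_add, hx, hy]
    | tmul b y => rw [insertRegular_tmul, Q.lact₃_Φ_coinv hw]
  have h2 := LinearMap.congr_fun hM.act_act (insertRegular w z Q.twist)
  simp only [associator_eq, LinearMap.comp_apply] at h2
  rw [coinvProj, LinearMap.comp_apply, Q.insert_act_coinv hM hw]
  refine h2.trans ?_
  refine (congrArg (fun u ↦ act (Q.mul.toLinearMap.lTensor M (TensorProduct.assoc k M H H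
    (ract₃ X (regular k H) (regular k H) Q.dualPhiInv u)))) (h1 Q.twist)).trans ?_
  rw [ract₃_insertRegular_twist, hM.act_one]
  rfl

lemma coinvProj_act_ract₂ (hM : Q.IsHopfModule X act) {w : M}
    (hw : ∀ a, X.lact a w = Q.dual.ε a • w) (d : ConvDual k H ⊗[k] ConvDual k H) (z : H) :
    Q.coinvProj X act (act (ract₂ X (regular k H) d (w ⊗ₜ z))) =
      X.ract (evalSecond z ((op₂ k _).symm Q.dualOp.p * d)) w := by
  induction d using pure_induction₂ with
  | add x y hx hy => simp only [ract₂_add, LinearMap.add_apply, map_add, mul_add, hx, hy]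
  | tmul a b =>
    rw [ract₂_tmul, Q.coinvProj_act hM (Q.lact_ract_coinv hM.isBicomodule hw a)]
    generalize (op₂ k _).symm Q.dualOp.p = t
    induction t using pure_induction₂ with
    | add x y hx hy => simp only [map_add, LinearMap.add_apply, add_mul, hx, hy]
    | tmul c d =>
      simp only [evalSecond_tmul, map_smul, LinearMap.smul_apply, apply_regular_ract,
        Algebra.TensorProduct.tmul_mul_tmul, hM.isBicomodule.ract_mul]

/-- `∑ b ⊗ y ↦ (v ↦ ∑ (b v)(x) y)` -/
def evalMul (x : H) : ConvDual k H ⊗[k] H →ₗ[k] ConvDual k H →ₗ[k] H :=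
  TensorProduct.lift (LinearMap.smulRightₗ ∘ₗ
    LinearMap.compRight k (LinearMap.applyₗ x ∘ₗ
      (WithConv.linearEquiv k (H →ₗ[k] k)).toLinearMap) ∘ₗ LinearMap.mul k (ConvDual k H))

@[simp] lemma evalMul_tmul (x : H) (b : ConvDual k H) (y : H) (v : ConvDual k H) :
    evalMul x (b ⊗ₜ y) v = (b * v) x • y := rfl

lemma evalMul_canonical (x : H) (v : ConvDual k H) :
    evalMul x (canonical k H) v = (regular k H).ract v x := by
  refine eq_of_forall_apply_eq (k := k) fun c ↦ ?_
  have h1 (t : ConvDual k H ⊗[k] H) : c (evalMul x t v) = (slice c t * v) x := by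
    induction t using pure_induction₂ with
    | add x y hx hy =>
      simp only [map_add, LinearMap.add_apply, add_mul, WithConv.ofConv_add, hx, hy]
    | tmul b y => simp [mul_comm]
  rw [h1, slice_canonical, apply_regular_ract]

lemma coinvProj_insertRegular (hM : Q.IsHopfModule X act) {w : M}
    (hw : ∀ a, X.lact a w = Q.dual.ε a • w) (q₁ q₂ : ConvDual k H)
    (t : ConvDual k H ⊗[k] H) (x : H) :
    (Q.coinvProj X act).rTensor H (ract₂ X (regular k H) (q₁ ⊗ₜ q₂)
      (act.rTensor H (insertRegular w x t))) =
    TensorProduct.map (X.ract.flip w) ((regular k H).ract q₂ ∘ₗ evalMul x t)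
      ((op₂ k _).symm Q.dualOp.p * Q.dual.Δ q₁) := by
  induction t using pure_induction₂ with
  | add x y hx hy =>
    simp only [map_add, hx, hy, LinearMap.comp_add, TensorProduct.map_add_right,
      LinearMap.add_apply]
  | tmul b y =>
    rw [insertRegular_tmul, LinearMap.rTensor_tmul, ract₂_tmul, LinearMap.rTensor_tmul,
      ← (isHom_iff.mp hM.isHom).2, tensor_ract, Q.coinvProj_act_ract₂ hM hw]
    change X.ract (evalSecond _ (_ * Q.dual.Δ q₁)) w ⊗ₜ _ = _
    generalize (op₂ k _).symm Q.dualOp.p * Q.dual.Δ q₁ = d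
    induction d using pure_induction₂ with
    | add x y hx hy =>
      simp only [map_add, LinearMap.add_apply, TensorProduct.add_tmul, hx, hy]
    | tmul c d =>
      simp [apply_regular_lact, TensorProduct.smul_tmul]

theorem coinvInv_act (hM : Q.IsHopfModule X act) {w : M}
    (hw : ∀ a, X.lact a w = Q.dual.ε a • w) (x : H) :
    Q.coinvInv X act (act (w ⊗ₜ x)) = w ⊗ₜ x := by
  have hX := hM.isBicomodule
  have hb := regular_isBicomodule (k := k) (C := H)
  have key (q : ConvDual k H ⊗[k] ConvDual k H) :
      (Q.coinvProj X act).rTensor H (ract₂ X (regular k H) q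
        (act.rTensor H (insertRegular w x (canonical k H)))) =
      ract₂ X (regular k H) (sandwich (inR k _).toLinearMap ((op₂ k _).symm Q.dualOp.p)
        Q.dual.Δ.toLinearMap (TensorProduct.comm k _ _ q)) (w ⊗ₜ x) := by
    induction q using pure_induction₂ with
    | add x y hx hy => simp only [ract₂_add, LinearMap.add_apply, map_add, hx, hy]
    | tmul q₁ q₂ =>
      rw [Q.coinvProj_insertRegular hM hw, TensorProduct.comm_tmul, sandwich_tmul, mul_assoc,
        AlgHom.toLinearMap_apply, AlgHom.toLinearMap_apply]
      generalize (op₂ k _).symm Q.dualOp.p * Q.dual.Δ q₁ = d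
      induction d using pure_induction₂ with
      | add x y hx hy => simp only [map_add, mul_add, ract₂_add, LinearMap.add_apply, hx, hy]
      | tmul c d =>
        simp [evalMul_canonical, hb.ract_mul]
  rw [coinvInv, LinearMap.comp_apply, LinearMap.comp_apply, Q.insert_act_coinv hM hw, key,
    QuasiHopf.op_p_triangle, Algebra.TensorProduct.one_def, ract₂_tmul, hX.ract_one, hb.ract_one]

end CoquasiHopfAlgebra

/-! ### The space of left cointegrals and the Frobenius isomorphism -/

namespace RightComodule

open WithConv Coalgebra Bicoaction

variable {k C V : Type*} [Field k] [AddCommGroup C] [Module k C] [Coalgebra k C]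
  [AddCommGroup V] [Module k V]

/-- A comodule structure from an action of the convolution algebra. -/
def ofAct (r : V →ₗ[k] V ⊗[k] C) (h1 : ∀ v, slice 1 (r v) = v)
    (hmul : ∀ a b v, slice (a * b) (r v) = slice a (r (slice b (r v)))) : RightComodule k C V where
  coact := r
  coassoc := by
    refine LinearMap.ext fun m ↦ (TensorProduct.assoc k V C C).symm.injective ?_
    refine slice_ext fun b ↦ slice_ext fun a ↦ ?_
    simp only [LinearMap.comp_apply, LinearEquiv.coe_coe, LinearEquiv.symm_apply_apply,
      slice_slice_assoc_symm_comul, slice_rTensor]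
    exact (hmul a b m).symm
  counit := LinearMap.ext h1

end RightComodule

namespace CoquasiBialgebra

open WithConv Coalgebra Bicoaction

variable {k H V : Type*} [Field k] [AddCommGroup H] [Module k H] [Coalgebra k H]
  [AddCommGroup V] [Module k V] (B : CoquasiBialgebra k H) (X : RightComodule k H V)

lemma trivialLeft_lact (a : ConvDual k H) (v : V) :
    (B.trivialLeft X).lact a v = B.dualCounit a • v := lslice_tmul a v (B.unit 1)

lemma trivialLeft_ract (a : ConvDual k H) (v : V) :
    (B.trivialLeft X).ract a v = slice a (X.coact v) := rfl

lemma one_unit : (1 : ConvDual k H) (B.unit 1) = 1 := B.dualCounit.map_one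

end CoquasiBialgebra

namespace CoquasiHopfAlgebra

open WithConv Coalgebra Bicoaction CoquasiBialgebra

variable {k H : Type*} [Field k] [AddCommGroup H] [Module k H] [Coalgebra k H]
  [FiniteDimensional k H] (Q : CoquasiHopfAlgebra k H)

lemma SInv_unit : Q.SInv (Q.unit 1) = Q.unit 1 := by
  conv_lhs => rw [← Q.S_unit]
  exact Q.SInv_S _

lemma mem_leftCointegrals_iff (f : Module.Dual k H) :
    f ∈ Q.leftCointegrals ↔ ∀ a, Q.starH.lact a f = Q.dual.ε a • f := by
  have h1 (x : H) : slantLeft (comul (R := k) (A := H)) f x =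
      (regular k H).ract (toConv f) x := rfl
  have h2 (a : ConvDual k H) (x : H) :
      Q.starH.lact a f x = a (Q.SInv ((regular k H).ract (toConv f) x)) := by
    rw [starH_lact]
    exact (apply_regular_ract (toConv f) (Q.dualSInv a) x).symm
  refine ⟨fun h a ↦ LinearMap.ext fun x ↦ ?_, fun h x ↦ ?_⟩
  · rw [h2, ← h1, h x, map_smul, map_smul, SInv_unit]
    exact mul_comm _ _
  · have h3 : Q.SInv ((regular k H).ract (toConv f) x) = f x • Q.unit 1 := by
      refine eq_of_forall_apply_eq (k := k) fun a ↦ ?_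
      rw [← h2, h a, map_smul]
      exact mul_comm _ _
    rw [h1, ← Q.S_SInv ((regular k H).ract (toConv f) x), h3, map_smul, S_unit]

/-- The action of functionals on the space of left cointegrals. -/
def cointegralsRact : ConvDual k H →ₗ[k] Q.leftCointegrals →ₗ[k] Q.leftCointegrals where
  toFun a := (Q.starH.ract a).restrict fun f hf ↦ by
    rw [mem_leftCointegrals_iff] at hf ⊢
    exact Q.lact_ract_coinv Q.starH_isBicomodule hf a
  map_add' a b := by
    ext
    simp
  map_smul' a b := by
    ext
    simp

/-- The coaction on the space of left cointegrals. -/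
def cointegralsCoact : Q.leftCointegrals →ₗ[k] Q.leftCointegrals ⊗[k] H :=
  LinearMap.applyₗ (canonical k H) ∘ₗ LinearMap.rTensorHom H ∘ₗ Q.cointegralsRact.flip

lemma slice_cointegralsCoact (a : ConvDual k H) (f : Q.leftCointegrals) :
    slice a (Q.cointegralsCoact f) = Q.cointegralsRact a f := by
  change slice a ((Q.cointegralsRact.flip f).rTensor H (canonical k H)) = _
  rw [slice_rTensor, slice_canonical]
  rfl

/-- The right comodule of left cointegrals. -/
def cointegralsComodule : RightComodule k H Q.leftCointegrals :=
  RightComodule.ofAct Q.cointegralsCoact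
    (fun f ↦ by
      rw [slice_cointegralsCoact]
      exact Subtype.ext (Q.starH_isBicomodule.ract_one _))
    (fun a b f ↦ by
      rw [slice_cointegralsCoact, slice_cointegralsCoact, slice_cointegralsCoact]
      exact Subtype.ext (Q.starH_isBicomodule.ract_mul _ _ _))

lemma subtype_cointegralsCoact (f : Q.leftCointegrals) :
    Q.leftCointegrals.subtype.rTensor H (Q.cointegralsComodule.coact f) = Q.starH.right f := by
  refine slice_ext fun a ↦ ?_
  rw [slice_rTensor]
  exact congrArg Subtype.val (Q.slice_cointegralsCoact a f)

lemma subtype_isHom : (Q.trivialLeft Q.cointegralsComodule).IsHom Q.starH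
    Q.leftCointegrals.subtype := by
  rw [isHom_iff]
  refine ⟨fun a f ↦ ?_, fun a f ↦ ?_⟩
  · rw [trivialLeft_lact]
    exact ((Q.mem_leftCointegrals_iff f).mp f.2 a).symm
  · rw [trivialLeft_ract]
    exact congrArg Subtype.val (Q.slice_cointegralsCoact a f)

/-- The map `φ ⊗ x ↦ φ · x` on the space of left cointegrals. -/
def frobeniusMap : Q.leftCointegrals ⊗[k] H →ₗ[k] Module.Dual k H :=
  Q.starHAction ∘ₗ Q.leftCointegrals.subtype.rTensor H

lemma coinvInv_frobeniusMap (u : Q.leftCointegrals ⊗[k] H) :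
    Q.coinvInv Q.starH Q.starHAction (Q.frobeniusMap u) =
      Q.leftCointegrals.subtype.rTensor H u := by
  induction u using pure_induction₂ with
  | add x y hx hy => simp only [map_add, hx, hy]
  | tmul f x =>
    rw [frobeniusMap, LinearMap.comp_apply, LinearMap.rTensor_tmul, Submodule.subtype_apply]
    exact Q.coinvInv_act Q.starH_isHopfModule ((Q.mem_leftCointegrals_iff f).mp f.2) x

lemma frobeniusMap_bijective : Function.Bijective Q.frobeniusMap := by
  refine ⟨fun u v h ↦ ?_, fun f ↦ ?_⟩
  · refine Module.Flat.rTensor_preserves_injective_linearMap (M := H) Q.leftCointegrals.subtype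
      Subtype.val_injective ?_
    rw [← coinvInv_frobeniusMap, ← coinvInv_frobeniusMap, h]
  · let E : Module.Dual k H →ₗ[k] Q.leftCointegrals :=
      (Q.coinvProj Q.starH Q.starHAction).codRestrict Q.leftCointegrals fun g ↦ by
        rw [mem_leftCointegrals_iff]
        exact fun a ↦ Q.lact_coinvProj Q.starH_isHopfModule a g
    refine ⟨E.rTensor H (ract₂ Q.starH (regular k H) (Q.dualSInv.lTensor _ Q.dual.p)
      (Q.starH.insert (canonical k H) f)), ?_⟩
    have hE : Q.leftCointegrals.subtype ∘ₗ E = Q.coinvProj Q.starH Q.starHAction :=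
      LinearMap.subtype_comp_codRestrict _ _ _
    conv_rhs => rw [← Q.act_coinvInv Q.starH_isHopfModule f]
    rw [frobeniusMap, LinearMap.comp_apply, ← LinearMap.comp_apply (LinearMap.rTensor _ _),
      ← LinearMap.rTensor_comp, hE, coinvInv, LinearMap.comp_apply, LinearMap.comp_apply]

/-- The Frobenius isomorphism. -/
def frobeniusEquiv : Q.leftCointegrals ⊗[k] H ≃ₗ[k] Module.Dual k H :=
  LinearEquiv.ofBijective Q.frobeniusMap Q.frobeniusMap_bijective

lemma frobeniusEquiv_toLinearMap : Q.frobeniusEquiv.toLinearMap = Q.frobeniusMap := rfl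

lemma act_comp_freeAction {M N : Type*} [AddCommGroup M] [Module k M] [AddCommGroup N]
    [Module k N] {X : Bicoaction k H M} {Y : Bicoaction k H N} {a : N ⊗[k] H →ₗ[k] N}
    (ha : Q.IsHopfModule Y a) {f : M →ₗ[k] N} (hf : X.IsHom Y f) :
    (a ∘ₗ f.rTensor H) ∘ₗ Q.freeAction X = a ∘ₗ (a ∘ₗ f.rTensor H).rTensor H := by
  refine LinearMap.ext fun u ↦ ?_
  have h1 := LinearMap.congr_fun ha.act_act ((f.rTensor H).rTensor H u)
  rw [LinearMap.rTensor_comp]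
  simp only [LinearMap.comp_apply, freeAction] at h1 ⊢
  rw [h1, ← Q.associator_naturality hf]
  congr 1
  generalize Q.associator _ _ _ u = v
  induction v using pure_induction₂ with
  | add x y hx hy => simp only [map_add, hx, hy]
  | tmul m x => simp

theorem isFrobeniusIso_frobeniusEquiv :
    Q.IsFrobeniusIso Q.cointegralsComodule Q.frobeniusEquiv := by
  refine ⟨?_, ?_⟩
  · have h1 := Q.tensor_isHom (Y := regular k H) Q.subtype_isHom
    have h2 := Q.starHAction_isHom
    rw [frobeniusEquiv_toLinearMap, frobeniusMap, free]
    rw [isHom_iff] at h1 h2 ⊢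
    refine ⟨fun a u ↦ ?_, fun a u ↦ ?_⟩
    · rw [LinearMap.comp_apply, h1.1, h2.1, LinearMap.comp_apply]
    · rw [LinearMap.comp_apply, h1.2, h2.2, LinearMap.comp_apply]
  · rw [frobeniusEquiv_toLinearMap, frobeniusMap]
    exact Q.act_comp_freeAction Q.starH_isHopfModule Q.subtype_isHom

lemma frobeniusMap_tmul (f : Q.leftCointegrals) (x : H) :
    Q.frobeniusEquiv (f ⊗ₜ x) = Q.starHAction ((f : Module.Dual k H) ⊗ₜ x) := by
  change Q.frobeniusMap (f ⊗ₜ x) = _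
  rw [frobeniusMap, LinearMap.comp_apply, LinearMap.rTensor_tmul, Submodule.subtype_apply]

theorem finrank_leftCointegrals : Module.finrank k Q.leftCointegrals = 1 := by
  have h1 := Q.frobeniusEquiv.finrank_eq
  rw [Module.finrank_tensorProduct, Subspace.dual_finrank_eq] at h1
  have : Nontrivial H := by
    refine ⟨Q.unit 1, 0, fun h ↦ ?_⟩
    have := Q.one_unit
    rw [h, map_zero] at this
    exact zero_ne_one this
  exact Nat.eq_of_mul_eq_mul_right Module.finrank_pos (h1.trans (_root_.one_mul _).symm)

section Uniqueness

variable {V V' : Type*} [AddCommGroup V] [Module k V] [AddCommGroup V'] [Module k V']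
  (X : RightComodule k H V) (X' : RightComodule k H V')

lemma free_lact (a : ConvDual k H) (u : V ⊗[k] H) :
    (Q.free (Q.trivialLeft X)).lact a u = ((regular k H).lact a).lTensor V u := by
  induction u using pure_induction₂ with
  | add x y hx hy => simp only [map_add, hx, hy]
  | tmul v x =>
    rw [free, tensor_lact]
    refine (Q.lact₂_coinv (fun a ↦ Q.trivialLeft_lact X a v) _ _).trans ?_
    exact congrArg (fun b ↦ v ⊗ₜ (regular k H).lact b x) (Q.dual.killLeft_Δ a)

lemma free_ract_unit (a : ConvDual k H) (v : V) :
    (Q.free (Q.trivialLeft X)).ract a (v ⊗ₜ Q.unit 1) = slice a (X.coact v) ⊗ₜ Q.unit 1 := by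
  have h1 (d : ConvDual k H ⊗[k] ConvDual k H) :
      ract₂ (Q.trivialLeft X) (regular k H) d (v ⊗ₜ Q.unit 1) =
        (Q.trivialLeft X).ract (killRight Q.dual.ε d) v ⊗ₜ Q.unit 1 := by
    induction d using pure_induction₂ with
    | add x y hx hy =>
      simp only [ract₂_add, map_add, LinearMap.add_apply, TensorProduct.add_tmul, hx, hy]
    | tmul a b =>
      rw [ract₂_tmul, regular_ract_unit, killRight_tmul, map_smul, LinearMap.smul_apply,
        TensorProduct.smul_tmul]
      rfl
  rw [free, tensor_ract, h1]
  exact congrArg (fun b ↦ (Q.trivialLeft X).ract b v ⊗ₜ Q.unit 1) (Q.dual.killRight_Δ a)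

lemma eq_tmul_unit_of_coinv {u : V ⊗[k] H}
    (h : ∀ a, (Q.free (Q.trivialLeft X)).lact a u = Q.dual.ε a • u) :
    u = slice 1 u ⊗ₜ Q.unit 1 := by
  refine slice_ext fun a ↦ ?_
  have h1 (u : V ⊗[k] H) : slice 1 (((regular k H).lact a).lTensor V u) = slice a u := by
    induction u using pure_induction₂ with
    | add x y hx hy => simp only [map_add, hx, hy]
    | tmul v x => simp [apply_regular_lact]
  rw [← h1, ← free_lact, h, map_smul, slice_tmul]
  rfl

/-- The map induced by a morphism of free Hopf modules on the generating comodules. -/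
def generatorMap (θ : V ⊗[k] H →ₗ[k] V' ⊗[k] H) : V →ₗ[k] V' :=
  slice 1 ∘ₗ θ ∘ₗ (TensorProduct.mk k V H).flip (Q.unit 1)

variable {X X'}

lemma generatorMap_tmul_unit {θ : V ⊗[k] H →ₗ[k] V' ⊗[k] H}
    (hθ : (Q.free (Q.trivialLeft X)).IsHom (Q.free (Q.trivialLeft X')) θ) (v : V) :
    θ (v ⊗ₜ Q.unit 1) = Q.generatorMap θ v ⊗ₜ Q.unit 1 := by
  refine Q.eq_tmul_unit_of_coinv X' fun a ↦ ?_
  rw [← (isHom_iff.mp hθ).1, free_lact, LinearMap.lTensor_tmul, regular_lact_unit,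
    TensorProduct.tmul_smul, map_smul]
  rfl

lemma generatorMap_slice {θ : V ⊗[k] H →ₗ[k] V' ⊗[k] H}
    (hθ : (Q.free (Q.trivialLeft X)).IsHom (Q.free (Q.trivialLeft X')) θ) (a : ConvDual k H)
    (v : V) : Q.generatorMap θ (slice a (X.coact v)) = slice a (X'.coact (Q.generatorMap θ v)) := by
  have h1 := (isHom_iff.mp hθ).2 a (v ⊗ₜ Q.unit 1)
  rw [free_ract_unit, Q.generatorMap_tmul_unit hθ, Q.generatorMap_tmul_unit hθ,
    free_ract_unit] at h1
  have h2 := congrArg (slice (1 : ConvDual k H)) h1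
  rwa [slice_tmul, slice_tmul, one_unit, one_smul, one_smul] at h2

lemma generatorMap_generatorMap {θ : V ⊗[k] H →ₗ[k] V' ⊗[k] H} {θ' : V' ⊗[k] H →ₗ[k] V ⊗[k] H}
    (hθ : (Q.free (Q.trivialLeft X)).IsHom (Q.free (Q.trivialLeft X')) θ)
    (h : ∀ u, θ' (θ u) = u) (v : V) : Q.generatorMap θ' (Q.generatorMap θ v) = v := by
  change slice 1 (θ' (Q.generatorMap θ v ⊗ₜ Q.unit 1)) = v
  rw [← Q.generatorMap_tmul_unit hθ, h, slice_tmul, one_unit, one_smul]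

lemma isHom_symm_comp {M N P : Type*} [AddCommGroup M] [Module k M] [AddCommGroup N] [Module k N]
    [AddCommGroup P] [Module k P] {Y : Bicoaction k H M} {Y' : Bicoaction k H N}
    {Z : Bicoaction k H P} {e : M ≃ₗ[k] P} {e' : N ≃ₗ[k] P} (he : Y.IsHom Z e.toLinearMap)
    (he' : Y'.IsHom Z e'.toLinearMap) : Y.IsHom Y' (e.trans e'.symm).toLinearMap := by
  rw [isHom_iff] at he he' ⊢
  simp only [LinearEquiv.coe_coe, LinearEquiv.trans_apply] at he he' ⊢
  refine ⟨fun a m ↦ ?_, fun a m ↦ ?_⟩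
  · rw [LinearEquiv.symm_apply_eq, he'.1, LinearEquiv.apply_symm_apply, he.1]
  · rw [LinearEquiv.symm_apply_eq, he'.2, LinearEquiv.apply_symm_apply, he.2]

theorem exists_isIso_of_isFrobeniusIso {e : V ⊗[k] H ≃ₗ[k] Module.Dual k H}
    {e' : V' ⊗[k] H ≃ₗ[k] Module.Dual k H} (he : Q.IsFrobeniusIso X e)
    (he' : Q.IsFrobeniusIso X' e') : ∃ i : V ≃ₗ[k] V', X.IsIso X' i := by
  have h := isHom_symm_comp he.1 he'.1
  have h' := isHom_symm_comp he'.1 he.1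
  refine ⟨LinearEquiv.ofLinearMap (Q.generatorMap (e.trans e'.symm).toLinearMap)
    (Q.generatorMap (e'.trans e.symm).toLinearMap)
    (LinearMap.ext (Q.generatorMap_generatorMap h' (by simp)))
    (LinearMap.ext (Q.generatorMap_generatorMap h (by simp))), ?_⟩
  refine LinearMap.ext fun v ↦ slice_ext fun a ↦ ?_
  rw [LinearMap.comp_apply, slice_rTensor]
  exact Q.generatorMap_slice h a v

end Uniqueness

end CoquasiHopfAlgebra

end

theorem mainTheorem4 {k : Type u} {H : Type v} [Field k] [AddCommGroup H] [Module k H]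
    [Coalgebra k H] [FiniteDimensional k H] (Q : CoquasiHopfAlgebra k H) :
    -- the antipode is invertible, and the left dual of `H` is a Hopf module
    Function.Bijective Q.S ∧
    Q.IsHopfModule Q.starH Q.starHAction ∧
    -- existence
    (∃ (V : Type (max u v)) (_ : AddCommGroup V) (_ : Module k V) (X : RightComodule k H V),
      Module.finrank k V = 1 ∧
      ∃ e : V ⊗[k] H ≃ₗ[k] Module.Dual k H, Q.IsFrobeniusIso X e) ∧
    -- uniqueness up to isomorphism
    (∀ (V : Type w) (V' : Type w') [AddCommGroup V] [Module k V] [AddCommGroup V'] [Module k V']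
      (X : RightComodule k H V) (X' : RightComodule k H V'),
      Module.finrank k V = 1 → Module.finrank k V' = 1 →
      (∃ e : V ⊗[k] H ≃ₗ[k] Module.Dual k H, Q.IsFrobeniusIso X e) →
      (∃ e : V' ⊗[k] H ≃ₗ[k] Module.Dual k H, Q.IsFrobeniusIso X' e) →
      ∃ i : V ≃ₗ[k] V', X.IsIso X' i) ∧
    -- the space of left cointegrals, a right subcomodule of the dual, is such an object
    Module.finrank k Q.leftCointegrals = 1 ∧
    ∃ W : RightComodule k H Q.leftCointegrals,
      (∀ f : Q.leftCointegrals,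
        Q.leftCointegrals.subtype.rTensor H (W.coact f) = Q.starH.right f) ∧
      ∃ F : Q.leftCointegrals ⊗[k] H ≃ₗ[k] Module.Dual k H,
        (∀ (f : Q.leftCointegrals) (x : H),
          F (f ⊗ₜ[k] x) = Q.starHAction ((f : Module.Dual k H) ⊗ₜ[k] x)) ∧
        Q.IsFrobeniusIso W F := by
  have hF : ∃ e : Q.leftCointegrals ⊗[k] H ≃ₗ[k] Module.Dual k H,
      Q.IsFrobeniusIso Q.cointegralsComodule e :=
    ⟨Q.frobeniusEquiv, Q.isFrobeniusIso_frobeniusEquiv⟩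
  refine ⟨Q.S_bijective, Q.starH_isHopfModule,
    ⟨Q.leftCointegrals, inferInstance, inferInstance, Q.cointegralsComodule,
      Q.finrank_leftCointegrals, hF⟩, ?_, Q.finrank_leftCointegrals, Q.cointegralsComodule,
    Q.subtype_cointegralsCoact, Q.frobeniusEquiv, fun f x ↦ ?_, Q.isFrobeniusIso_frobeniusEquiv⟩
  · rintro V V' _ _ _ _ X X' - - ⟨e, he⟩ ⟨e', he'⟩
    exact Q.exists_isIso_of_isFrobeniusIso he he'
  · exact Q.frobeniusMap_tmul f x
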